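/- Let $n\ge 2$ and let $\mathfrak g=\mathfrak{so}_{2n+1}(\mathbb C)$ be the simple Lie algebra of type $\mathsf B_n$, with Cartan subalgebra $\mathfrak h$ having a basis $h_1,\dots,h_n$ whose dual basis $\varepsilon_1,\dots,\varepsilon_n$ of $\mathfrak h^*$ is such that the positive roots are $\varepsilon_i$ $(1\le i\le n)$ and $\varepsilon_i\pm\varepsilon_j$ $(1\le i<j\le n)$. Put $\mathbf I_n=\{\pm1,\dots,\pm n\}$ and $\varepsilon_{-a}=-\varepsilon_a$. Let $K$ be a field of characteristic $0$ and $q\in K$ nonzero (for instance $q$ an indeterminate and $K=\mathbb C(q)$). For a family of variables $L_a$ $(a\in\mathbf I_n)$ with $L_{-a}=L_a^{-1}$ and an integer $k\ge 0$ put \[ G_{n,k}=q^{-k}+\sum_{a\in\mathbf I_n}\frac{qL_a-q^{-1}L_a^{-1}+q-q^{-1}}{L_a-L_a^{-1}}\,L_a^k\prod_{b\in\mathbf I_n\setminus\{\pm a\}}\frac{qL_a-q^{-1}L_b}{L_a-L_b}, \] and let $\mathbf{Ch}\,G_{n,k}$ be the element obtained from $G_{n,k}$ by replacing every $L_a$ with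 the formal exponential $e^{\varepsilon_a}$; it lies in the field of fractions of the group algebra over $K$ of the lattice $\bigoplus_i\mathbb Z\varepsilon_i$. For $0\le r\le 2n-1$ let $\bar r=\min\{r,2n-1-r\}$ and \[ \lambda_k^r=(k-r)\varepsilon_1+\mu_{\bar r},\qquad \mu_{\bar r}=\varepsilon_2+\cdots+\varepsilon_{\bar r+1}\quad(\mu_0=0). \] When $k-r\ge1$, this is a dominant integral weight; let $\chi(\lambda_k^r)=\sum_\mu \dim L(\lambda_k^r)_\mu\, e^\mu$ be the character of the simple $\mathfrak g$-module $L(\lambda_k^r)$ with highest weight $\lambda_k^r$. Then for all integers $k\ge0$, \[ \mathbf{Ch}\,G_{n,k}= \begin{cases} 1+\displaystyle\sum_{r=0}^{2n-1}q^{2n-2r-1}, & k=0,\\[2ex] \displaystyle\sum_{r=0}^{k-1}(-1)^rq^{2n-2r-1}\chi(\lambda_k^r), & 1\le k\le 2n-1 \text{ and } k \text{ odd},\\[2ex] q^{-k}+\displaystyle\sum_{r=0}^{\min\{k-1,2n-1\}}(-1)^rq^{2n-2r-1}\chi(\lambda_k^r), & \text{otherwise.} \end{cases} \] -/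

import Mathlib

noncomputable section

namespace TypeB

attribute [local instance 100] LieRing.ofAssociativeRing

/-! ### The simple Lie algebra of type `B_n` and its irreducible characters

A weight `∑ i, μ i • ε_i` in the lattice spanned by the `ε_i` is written as its coordinate vector
`μ : Fin n → ℤ`. The index `i : Fin n` stands for the traditional index `i + 1`, so `ε_1`
has its `1` at the index `0 : Fin n`. -/

/-- The Lie algebra `𝔰𝔬_{2n+1}(ℂ)` (type `B_n`), as the matrices that are skew-adjoint for the
symmetric form `2 x₀² + 2 ∑ xᵢ xᵢ'` on `ℂ^(1 + n + n)`. -/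
abbrev Lie (n : ℕ) := LieAlgebra.Orthogonal.typeB (Fin n) ℂ

/-- The diagonal matrix of `h_i`: it has entry `1` at the `i`-th place of the first block of
length `n`, entry `-1` at the `i`-th place of the second one, and `0` elsewhere. -/
def cartanMatrix (n : ℕ) (i : Fin n) : Matrix (Unit ⊕ (Fin n ⊕ Fin n)) (Unit ⊕ (Fin n ⊕ Fin n)) ℂ :=
  Matrix.diagonal (Sum.elim (fun _ => 0) (Sum.elim (Pi.single i 1) (-Pi.single i 1)))

theorem cartanMatrix_mem (n : ℕ) (i : Fin n) : cartanMatrix n i ∈ Lie n := by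
  rw [Lie, LieAlgebra.Orthogonal.typeB, mem_skewAdjointMatricesLieSubalgebra,
    mem_skewAdjointMatricesSubmodule]
  unfold Matrix.IsSkewAdjoint Matrix.IsAdjointPair
  ext a b
  rcases a with a | a | a <;> rcases b with b | b | b <;>
    simp [cartanMatrix, LieAlgebra.Orthogonal.JB, LieAlgebra.Orthogonal.JD, Matrix.one_apply] <;>
    split_ifs with h <;> simp [h]

/-- The basis `h_1, …, h_n` of the diagonal Cartan subalgebra, dual to `ε_1, …, ε_n`. -/
def cartan (n : ℕ) (i : Fin n) : Lie n := ⟨cartanMatrix n i, cartanMatrix_mem n i⟩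

/-- The weight `ε_i`. -/
def eps {n : ℕ} (i : Fin n) : Fin n → ℤ := Pi.single i 1

/-- The positive roots `ε_i` and `ε_i ± ε_j` with `i < j`. -/
def posRoots (n : ℕ) : Set (Fin n → ℤ) :=
  {α | (∃ i, α = eps i) ∨ ∃ i j, i < j ∧ (α = eps i + eps j ∨ α = eps i - eps j)}

/-- The positive root vectors: `x` with `[h, x] = α(h) x` for all `h` in the Cartan subalgebra,
for some positive root `α`. -/
def posRootVectors (n : ℕ) : Set (Lie n) :=
  {x | ∃ α ∈ posRoots n, ∀ i, ⁅cartan n i, x⁆ = (α i : ℂ) • x}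

/-- The universal enveloping algebra of the Lie algebra of type `B_n`. -/
abbrev Env (n : ℕ) := UniversalEnvelopingAlgebra ℂ (Lie n)

/-- The canonical map from the Lie algebra to its enveloping algebra. -/
def toEnv (n : ℕ) (x : Lie n) : Env n := UniversalEnvelopingAlgebra.ι ℂ x

/-- The left ideal generated by the positive root vectors and the elements `h - lam(h)`. -/
def vermaIdeal {n : ℕ} (lam : Fin n → ℤ) : Submodule (Env n) (Env n) :=
  Submodule.span (Env n)
    (toEnv n '' posRootVectors n ∪
      Set.range fun i => toEnv n (cartan n i) - algebraMap ℂ (Env n) (lam i : ℂ))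

/-- The Verma module `M(lam)`. -/
abbrev Verma {n : ℕ} (lam : Fin n → ℤ) := Env n ⧸ vermaIdeal lam

/-- The sum of all proper submodules of the Verma module, which is its largest proper
submodule. -/
def vermaRadical {n : ℕ} (lam : Fin n → ℤ) : Submodule (Env n) (Verma lam) :=
  sSup {N | N ≠ ⊤}

/-- The simple module `L(lam)` with highest weight `lam`. -/
abbrev Simple {n : ℕ} (lam : Fin n → ℤ) := Verma lam ⧸ vermaRadical lam

/-- The weight space `L(lam)_μ`. -/
def weightSpace {n : ℕ} (lam μ : Fin n → ℤ) : Submodule ℂ (Simple lam) where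
  carrier := {v | ∀ i, toEnv n (cartan n i) • v = (μ i : ℂ) • v}
  zero_mem' := by intro i; rw [smul_zero, smul_zero]
  add_mem' := by intro a b ha hb i; rw [smul_add, smul_add, ha i, hb i]
  smul_mem' := by intro c a ha i; rw [smul_comm, ha i, smul_comm]

/-! ### Formal exponentials -/

/-- The fraction field of the group algebra over `K` of the lattice spanned by the `ε_i`. -/
abbrev CharField (K : Type*) [Field K] (n : ℕ) := FractionRing (AddMonoidAlgebra K (Fin n → ℤ))

section

variable {K : Type*} [Field K] {n : ℕ}

/-- The formal exponential `e^μ`. -/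
def fexp (K : Type*) [Field K] {n : ℕ} (μ : Fin n → ℤ) : CharField K n :=
  algebraMap (AddMonoidAlgebra K (Fin n → ℤ)) (CharField K n) (AddMonoidAlgebra.single μ 1)

/-- A scalar of `K`, as a constant. -/
def const (n : ℕ) (c : K) : CharField K n := algebraMap K (CharField K n) c

/-- The formal character `χ(lam) = ∑_μ dim L(lam)_μ e^μ`. All weights of `L(lam)` lie in `lam` plus
the root lattice, which is the lattice spanned by the `ε_i`. -/
def chi (K : Type*) [Field K] {n : ℕ} (lam : Fin n → ℤ) : CharField K n :=
  ∑ᶠ μ : Fin n → ℤ, (Module.finrank ℂ (weightSpace lam μ) : CharField K n) * fexp K μ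

/-- The index set `{±1, …, ±n}`, an index `± i` being the pair `(i, ±1)`. -/
abbrev Idx (n : ℕ) := Fin n × ℤˣ

/-- `P_{n,a}` as an expression in `q` and a family `L_a`; the product is over `b ≠ ± a`. -/
def P {F : Type*} [Field F] (q : F) (L : Idx n → F) (a : Idx n) : F :=
  ∏ b : Idx n with b.1 ≠ a.1, (q * L a - q⁻¹ * L b) / (L a - L b)

/-- `G_{n,k}` of type `B_n` as an expression in `q` and a family `L_a`. -/
def G {F : Type*} [Field F] (q : F) (L : Idx n → F) (k : ℕ) : F :=
  (q ^ k)⁻¹ +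
    ∑ a : Idx n, (q * L a - q⁻¹ * (L a)⁻¹ + q - q⁻¹) / (L a - (L a)⁻¹) * L a ^ k * P q L a

/-- `Ch G_{n,k}`: the expression `G_{n,k}` with `e^{ε_a}` in place of `L_a`, where
`ε_{-a} = -ε_a`. -/
def ChG (n : ℕ) (q : K) (k : ℕ) : CharField K n :=
  G (const n q) (fun a : Idx n => fexp K ((a.2 : ℤ) • eps a.1)) k

end

/-- `r̄ = min {r, 2n - 1 - r}`, for `0 ≤ r ≤ 2n - 1`. -/
def rbar (n r : ℕ) : ℕ := min r (2 * n - 1 - r)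

/-- The hook weight `λ_k^r = (k - r) ε_1 + (ε_2 + ⋯ + ε_{r̄+1})`. -/
def hook (n k r : ℕ) : Fin n → ℤ := fun i =>
  if (i : ℕ) = 0 then (k : ℤ) - r else if (i : ℕ) ≤ rbar n r then 1 else 0

end TypeB

end

/-!
Let `A(l)` denote the alternant with exponent vector `l`, and `ρ` the half sum of the positive
roots. In the Weyl denominator `A(ρ)` the variable `x_1` enters through
`(x_1 - 1) ∏_{j > 1} (x_1 + x_1⁻¹ - x_j - x_j⁻¹)`, so that replacing `x_1 = L_a` by `q² L_a`
multiplies `A(ρ)` by `q` times the `a`-th coefficient of `G_{n,k}`. Expanding the new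
alternant along its first row, and recognizing the sum over `a` as the expansion of an alternant
along its first column, gives
`A(ρ) (G_{n,k} - q^{-k}) = ∑_r (-1)^r q^{2n-2r-1} A(λ_k^r + ρ)`, `0 ≤ r ≤ 2n - 1`.
For `r < k` the Weyl character formula turns `A(λ_k^r + ρ)` into `A(ρ) χ(λ_k^r)`; for `r ≥ k` the
alternant is `0` or `± A(ρ)`, which accounts for the extra terms of the three cases.

The character formula comes from the Casimir element, which acts on `L(λ)` by a scalar. Its trace,
graded by the weights, shows that all monomials `e^μ` of `A(ρ) χ(λ)` have the same `(μ, μ)`. As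
`A(ρ) χ(λ)` is antisymmetric under the Weyl group and has the leading term `e^(λ + ρ)`, it is
`A(λ + ρ)`. That `L(λ)` has finite dimension is seen from a highest weight vector of weight `λ` in a
polynomial ring, namely a product of minors.
-/

noncomputable section

namespace TypeB

attribute [local instance 100] LieRing.ofAssociativeRing

/-! ### Alternants of type `B` -/

section Alternant

open Polynomial

variable {R : Type*} [CommRing R] {n : ℕ}

/-- The difference `y ^ m - y ^ (1 - m)`, which is `y ^ (1/2)` times the antisymmetrization of
`y ^ (m - 1/2)` under `y ↦ y⁻¹`. -/
def altEntry (y : Rˣ) (m : ℤ) : R := ((y ^ m : Rˣ) : R) - ((y ^ (1 - m) : Rˣ) : R)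

/-- The alternant with exponents `l`. Up to the factor `∏ x_i ^ (1/2)` it is the antisymmetrization
of the monomial with exponents `l_j - 1/2` over the Weyl group of type `B_n`; shifting the exponents
by `1/2` keeps them integral. -/
def alt (x : Fin n → Rˣ) (l : Fin n → ℤ) : R := (Matrix.of fun i j => altEntry (x i) (l j)).det

/-- The vector `(n, n - 1, …, 1)`, which is the half sum of the positive roots with `1/2` added to
each coordinate. -/
def rho (n : ℕ) (j : Fin n) : ℤ := (n : ℤ) - (j : ℕ)

theorem altEntry_one_sub (y : Rˣ) (m : ℤ) : altEntry y (1 - m) = -altEntry y m := by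
  simp [altEntry]

theorem altEntry_inv (y : Rˣ) (m : ℤ) : altEntry y⁻¹ m = -(y⁻¹ : Rˣ) * altEntry y m := by
  have h (k : ℤ) : (y⁻¹ ^ k : Rˣ) = y⁻¹ * y ^ (1 - k) := by rw [zpow_sub, zpow_one]; simp
  simp only [altEntry, h, sub_sub_cancel, Units.val_mul]
  ring

theorem map_alt {S : Type*} [CommRing S] (f : R →+* S) (x : Fin n → Rˣ) (l : Fin n → ℤ) :
    f (alt x l) = alt (fun i => Units.map (f : R →* S) (x i)) l := by
  rw [alt, RingHom.map_det]
  congr 1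
  ext i j
  simp [altEntry, ← map_zpow]

theorem alt_comp_perm (x : Fin n → Rˣ) (l : Fin n → ℤ) (σ : Equiv.Perm (Fin n)) :
    alt x (l ∘ σ) = ((Equiv.Perm.sign σ : ℤ) : R) * alt x l :=
  Matrix.det_permute' σ (Matrix.of fun i j => altEntry (x i) (l j))

theorem alt_perm_comp (x : Fin n → Rˣ) (l : Fin n → ℤ) (σ : Equiv.Perm (Fin n)) :
    alt (x ∘ σ) l = ((Equiv.Perm.sign σ : ℤ) : R) * alt x l :=
  Matrix.det_permute σ (Matrix.of fun i j => altEntry (x i) (l j))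

theorem alt_eq_zero_of_apply_eq (x : Fin n → Rˣ) {l : Fin n → ℤ} {i j : Fin n} (hij : i ≠ j)
    (h : l i = l j) : alt x l = 0 :=
  Matrix.det_zero_of_column_eq hij fun k => by simp [h]

theorem alt_update_one_sub (x : Fin n → Rˣ) (l : Fin n → ℤ) (j : Fin n) :
    alt x (Function.update l j (1 - l j)) = -alt x l := by
  have h : (Matrix.of fun i k => altEntry (x i) (Function.update l j (1 - l j) k)) =
      Matrix.of fun i k => Pi.mulSingle (M := fun _ => R) j (-1) k *
        Matrix.of (fun i k => altEntry (x i) (l k)) i k := by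
    ext i k
    rcases eq_or_ne k j with rfl | hk
    · simp [altEntry_one_sub]
    · simp [hk]
  rw [alt, h, Matrix.det_mul_row, Fintype.prod_pi_mulSingle', neg_one_mul, alt]

theorem alt_update_inv (x : Fin n → Rˣ) (l : Fin n → ℤ) (i : Fin n) :
    alt (Function.update x i (x i)⁻¹) l = -((x i)⁻¹ : Rˣ) * alt x l := by
  have h : (Matrix.of fun a k => altEntry (Function.update x i (x i)⁻¹ a) (l k)) =
      Matrix.of fun a k => Pi.mulSingle (M := fun _ => R) i (-((x i)⁻¹ : Rˣ) : R) a *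
        Matrix.of (fun a k => altEntry (x a) (l k)) a k := by
    ext a k
    rcases eq_or_ne a i with rfl | ha
    · simp [altEntry_inv]
    · simp [ha]
  rw [alt, h, Matrix.det_mul_column, Fintype.prod_pi_mulSingle', alt]

/-- The polynomial `p` of degree `l` with `(y - 1) p (y + y⁻¹) = y ^ (l + 1) - y ^ (-l)`. -/
def altPoly (R : Type*) [CommRing R] : ℕ → R[X]
  | 0 => 1
  | 1 => X + 1
  | (l + 2) => X * altPoly R (l + 1) - altPoly R l

theorem altPoly_monic_natDegree [Nontrivial R] (l : ℕ) :
    (altPoly R l).Monic ∧ (altPoly R l).natDegree = l := by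
  induction l using Nat.twoStepInduction with
  | zero => simp [altPoly]
  | one => exact ⟨monic_X_add_C 1, natDegree_X_add_C 1⟩
  | more l ih₀ ih₁ =>
    obtain ⟨-, deg₀⟩ := ih₀
    obtain ⟨monic₁, deg₁⟩ := ih₁
    have monic_mul : (X * altPoly R (l + 1)).Monic := monic_X.mul monic₁
    have deg_mul : (X * altPoly R (l + 1)).natDegree = l + 2 := by
      rw [natDegree_X_mul monic₁.ne_zero, deg₁]
    have deg_lt : (altPoly R l).degree < (X * altPoly R (l + 1)).degree :=
      degree_lt_degree (by omega)
    exact ⟨monic_mul.sub_of_left deg_lt,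
      (natDegree_eq_of_degree_eq (degree_sub_eq_left_of_degree_lt deg_lt)).trans deg_mul⟩

theorem sub_one_mul_eval_altPoly (y : Rˣ) (l : ℕ) :
    ((y : R) - 1) * (altPoly R l).eval ((y : R) + (y⁻¹ : Rˣ)) = altEntry y (l + 1) := by
  have altEntry_succ (m : ℤ) :
      altEntry y (m + 1) = ((y : R) + (y⁻¹ : Rˣ)) * altEntry y m - altEntry y (m - 1) := by
    have h₁ : (y ^ (m + 1) : Rˣ) = y * y ^ m := zpow_add_one y m |>.trans (mul_comm _ _)
    have h₂ : (y ^ (1 - (m + 1)) : Rˣ) = y⁻¹ * y ^ (1 - m) := by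
      rw [← zpow_neg_one, ← zpow_add]; congr 1; ring
    have h₃ : (y ^ (m - 1) : Rˣ) = y⁻¹ * y ^ m := (zpow_sub_one y m).trans (mul_comm _ _)
    have h₄ : (y ^ (1 - (m - 1)) : Rˣ) = y * y ^ (1 - m) := by
      rw [← zpow_one_add]; congr 1; ring
    simp only [altEntry, h₁, h₂, h₃, h₄, Units.val_mul]
    ring
  induction l using Nat.twoStepInduction with
  | zero => simp [altPoly, altEntry]
  | one =>
    rw [Nat.cast_one, altEntry_succ]
    simp only [altPoly, altEntry, eval_add, eval_X, eval_one, sub_self, sub_zero, zpow_one,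
      zpow_zero, Units.val_one]
    ring
  | more l ih₀ ih₁ =>
    have h := altEntry_succ ((l : ℤ) + 2)
    rw [show (l : ℤ) + 2 - 1 = l + 1 by ring, ← ih₀, show (l : ℤ) + 2 = (l + 1 : ℕ) + 1 by
      push_cast; ring, ← ih₁] at h
    rw [show ((l + 2 : ℕ) : ℤ) = (l + 1 : ℕ) + 1 by push_cast; ring, h, altPoly, eval_sub,
      eval_mul, eval_X]
    ring

theorem alt_eq_vandermonde (x : Fin n → Rˣ) :
    alt x (fun j => ((j : ℕ) : ℤ) + 1) = (∏ i, ((x i : R) - 1)) *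
      (Matrix.vandermonde fun i => (x i : R) + ((x i)⁻¹ : Rˣ)).det := by
  nontriviality R
  rw [Matrix.det_eval_matrixOfPolynomials_eq_det_vandermonde _ (fun j : Fin n => altPoly R j)
    (fun j => (altPoly_monic_natDegree _).2) (fun j => (altPoly_monic_natDegree _).1),
    ← Matrix.det_mul_column, alt]
  simp only [Matrix.of_apply, sub_one_mul_eval_altPoly]

theorem prod_Ioi_rev {M : Type*} [CommMonoid M] (f : Fin n → Fin n → M) :
    ∏ i : Fin n, ∏ j ∈ Finset.Ioi i, f j.rev i.rev = ∏ i, ∏ j ∈ Finset.Ioi i, f i j := by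
  rw [Finset.prod_sigma', Finset.prod_sigma']
  refine Finset.prod_nbij' (fun p => ⟨p.2.rev, p.1.rev⟩) (fun p => ⟨p.2.rev, p.1.rev⟩)
    ?_ ?_ ?_ ?_ ?_ <;> simp

/-- The Weyl denominator formula of type `B`. -/
theorem alt_rho (x : Fin n → Rˣ) :
    alt x (rho n) = (∏ i, ((x i : R) - 1)) * ∏ i, ∏ j ∈ Finset.Ioi i,
      (((x i : R) + ((x i)⁻¹ : Rˣ)) - ((x j : R) + ((x j)⁻¹ : Rˣ))) := by
  have rho_comp_rev : rho n ∘ Fin.revPerm = fun j : Fin n => ((j : ℕ) : ℤ) + 1 := by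
    ext j
    simp only [rho, Function.comp, Fin.revPerm_apply, Fin.val_rev]
    omega
  have alt_comp_rev : alt x (rho n) = alt (x ∘ Fin.revPerm) (rho n ∘ Fin.revPerm) :=
    (Matrix.det_submatrix_equiv_self Fin.revPerm _).symm
  rw [alt_comp_rev, rho_comp_rev, alt_eq_vandermonde, Matrix.det_vandermonde]
  congr 1
  · exact Equiv.prod_comp Fin.revPerm fun i => (x i : R) - 1
  · exact prod_Ioi_rev fun i j => ((x i : R) + ((x i)⁻¹ : Rˣ)) - ((x j : R) + ((x j)⁻¹ : Rˣ))

theorem alt_cons_rho (y : Rˣ) (x : Fin n → Rˣ) :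
    alt (Fin.cons y x) (rho (n + 1)) = ((y : R) - 1) *
      (∏ j, (((y : R) + (y⁻¹ : Rˣ)) - ((x j : R) + ((x j)⁻¹ : Rˣ)))) * alt x (rho n) := by
  simp only [alt_rho, Fin.prod_univ_succ, Fin.cons_zero, Fin.cons_succ, Fin.prod_Ioi_zero,
    Fin.prod_Ioi_succ]
  ring

theorem alt_cons_exponent (x : Fin (n + 1) → Rˣ) (c : ℤ) (l : Fin n → ℤ) :
    alt x (Fin.cons c l) =
      ∑ i : Fin (n + 1), (-1) ^ (i : ℕ) * altEntry (x i) c * alt (x ∘ i.succAbove) l :=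
  Matrix.det_succ_column_zero _

theorem alt_cons_one_sub (x : Fin (n + 1) → Rˣ) (c : ℤ) (l : Fin n → ℤ) :
    alt x (Fin.cons (1 - c) l) = -alt x (Fin.cons c l) := by
  simpa [Fin.update_cons_zero] using alt_update_one_sub x (Fin.cons c l : Fin (n + 1) → ℤ) 0

theorem alt_cons_inv (y : Rˣ) (x : Fin n → Rˣ) (l : Fin (n + 1) → ℤ) :
    alt (Fin.cons y⁻¹ x) l = -(y⁻¹ : Rˣ) * alt (Fin.cons y x) l := by
  simpa [Fin.update_cons_zero] using alt_update_inv (Fin.cons y x : Fin (n + 1) → Rˣ) l 0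

theorem alt_cons_succAbove (x : Fin (n + 1) → Rˣ) (l : Fin (n + 1) → ℤ) (i : Fin (n + 1)) :
    alt (Fin.cons (x i) (x ∘ i.succAbove)) l = (-1) ^ (i : ℕ) * alt x l := by
  have h : (Fin.cons (x i) (x ∘ i.succAbove) : Fin (n + 1) → Rˣ) = x ∘ i.cycleRange.symm := by
    ext a
    refine Fin.cases ?_ (fun a => ?_) a <;> simp
  rw [h, alt_perm_comp, Equiv.Perm.sign_symm, Fin.sign_cycleRange]
  simp

theorem alt_exponent_cons_succAbove (x : Fin (n + 1) → Rˣ) (l : Fin (n + 1) → ℤ)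
    (j : Fin (n + 1)) :
    alt x (Fin.cons (l j) (l ∘ j.succAbove)) = (-1) ^ (j : ℕ) * alt x l := by
  have h : (Fin.cons (l j) (l ∘ j.succAbove) : Fin (n + 1) → ℤ) = l ∘ j.cycleRange.symm := by
    ext a
    refine Fin.cases ?_ (fun a => ?_) a <;> simp
  rw [h, alt_comp_perm, Equiv.Perm.sign_symm, Fin.sign_cycleRange]
  simp

end Alternant

/-! ### The expression `G_{n,k}` in terms of alternants -/

section AlternantG

variable {R : Type*} [CommRing R] {n : ℕ}

/-- The vector `(n + 1, n, …, 1)` without its entry `n + 1 - j`. -/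
def rhoOmit (n j : ℕ) (a : Fin n) : ℤ := (n : ℤ) - (a : ℕ) + if (a : ℕ) < j then 1 else 0

theorem rho_comp_succAbove (j : Fin (n + 1)) : rho (n + 1) ∘ j.succAbove = rhoOmit n j := by
  ext a
  simp only [rho, rhoOmit, Function.comp, Fin.succAbove, Fin.lt_def, Fin.val_castSucc]
  split_ifs
  · simp
    ring
  · simp

theorem neg_one_pow_two_mul_add_one_sub {r : ℕ} (hr : r ≤ 2 * n + 1) :
    (-1 : R) ^ (2 * n + 1 - r) = -(-1) ^ r := by
  rw [← neg_one_mul ((-1 : R) ^ r), ← pow_succ']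
  exact neg_one_pow_congr (by simp only [Nat.even_iff]; omega)

theorem alt_cons_rho_eq_sum (y : Rˣ) (x : Fin n → Rˣ) :
    alt (Fin.cons y x) (rho (n + 1)) = ∑ r ∈ Finset.range (2 * (n + 1)), (-1) ^ r *
      ((y ^ ((n : ℤ) + 1 - r) : Rˣ) : R) * alt x (rhoOmit n (rbar (n + 1) r)) := by
  have laplace : alt (Fin.cons y x) (rho (n + 1)) = ∑ j ∈ Finset.range (n + 1), (-1) ^ j *
      altEntry y ((n : ℤ) + 1 - j) * alt x (rhoOmit n j) := by
    rw [alt, Matrix.det_succ_row_zero, Finset.sum_range]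
    refine Finset.sum_congr rfl fun j _ => ?_
    rw [← rho_comp_succAbove]
    simp [rho, alt, Matrix.submatrix]
  rw [laplace, two_mul, Finset.sum_range_add _ (n + 1) (n + 1), ← Finset.sum_range_reflect
    (fun r => (-1 : R) ^ (n + 1 + r) * ((y ^ ((n : ℤ) + 1 - (n + 1 + r : ℕ)) : Rˣ) : R) *
      alt x (rhoOmit n (rbar (n + 1) (n + 1 + r)))), ← Finset.sum_add_distrib]
  refine Finset.sum_congr rfl fun j hj => ?_
  rw [Finset.mem_range] at hj
  have reflect : n + 1 + (n + 1 - 1 - j) = 2 * n + 1 - j := by omega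
  have rbar_left : rbar (n + 1) j = j := by unfold rbar; omega
  have rbar_right : rbar (n + 1) (2 * n + 1 - j) = j := by unfold rbar; omega
  have exponent : (n : ℤ) + 1 - (2 * n + 1 - j : ℕ) = 1 - ((n : ℤ) + 1 - j) := by omega
  rw [reflect, rbar_left, rbar_right, exponent, neg_one_pow_two_mul_add_one_sub (by omega),
    altEntry]
  ring

/-- The factor with `x_1 ^ c - x_1 ^ (1 - c) = ∑ s, signFactor x_1 s * (x_1 ^ s) ^ c`; by it an
alternant changes when `x_1` is replaced by `x_1 ^ s`. -/
def signFactor (y : Rˣ) (s : ℤˣ) : R := if s = 1 then 1 else -y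

theorem altEntry_eq_sum (y : Rˣ) (c : ℤ) :
    altEntry y c = ∑ s : ℤˣ, signFactor y s * (((y ^ (s : ℤ)) ^ c : Rˣ) : R) := by
  have h : (y ^ (1 - c) : Rˣ) = y * (y⁻¹) ^ c := by rw [zpow_sub, zpow_one, inv_zpow]
  simp [altEntry, h, signFactor, UnitsInt.univ, ← sub_eq_add_neg]

theorem alt_eq_signFactor_mul (x : Fin (n + 1) → Rˣ) (l : Fin (n + 1) → ℤ) (i : Fin (n + 1))
    (s : ℤˣ) : alt x l = (-1) ^ (i : ℕ) *
      (signFactor (x i) s * alt (Fin.cons (x i ^ (s : ℤ)) (x ∘ i.succAbove)) l) := by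
  have h : signFactor (x i) s * alt (Fin.cons (x i ^ (s : ℤ)) (x ∘ i.succAbove)) l =
      alt (Fin.cons (x i) (x ∘ i.succAbove)) l := by
    rcases Int.units_eq_one_or s with rfl | rfl
    · simp [signFactor]
    · simp [signFactor, alt_cons_inv]
  rw [h, alt_cons_succAbove, ← mul_assoc, ← mul_pow]
  simp

variable {F : Type*} [Field F]

theorem alt_cons_sq_mul_rho (q y : Fˣ) (x : Fin n → Fˣ) (hy : (y : F) ≠ 1)
    (hne : ∀ j, y ≠ x j) (hne' : ∀ j, y ≠ (x j)⁻¹) :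
    alt (Fin.cons (q ^ 2 * y) x) (rho (n + 1)) = q * (alt (Fin.cons y x) (rho (n + 1)) *
      (((q : F) * y - (q : F)⁻¹) / (y - 1) * ∏ j,
        (((q : F) * y - (q : F)⁻¹ * x j) / (y - x j) *
          (((q : F) * y - (q : F)⁻¹ * (x j : F)⁻¹) / (y - (x j : F)⁻¹))))) := by
  have factor_one : ((q ^ 2 * y : Fˣ) : F) - 1 =
      q * (((y : F) - 1) * (((q : F) * y - (q : F)⁻¹) / (y - 1))) := by
    have : (y : F) - 1 ≠ 0 := sub_ne_zero.2 hy
    push_cast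
    field_simp
  have factor (j : Fin n) :
      ((q ^ 2 * y : Fˣ) : F) + ((q ^ 2 * y)⁻¹ : Fˣ) - ((x j : F) + ((x j)⁻¹ : Fˣ)) =
        ((y : F) + (y⁻¹ : Fˣ) - ((x j : F) + ((x j)⁻¹ : Fˣ))) *
          (((q : F) * y - (q : F)⁻¹ * x j) / (y - x j) *
            (((q : F) * y - (q : F)⁻¹ * (x j : F)⁻¹) / (y - (x j : F)⁻¹))) := by
    have sub_ne : (y : F) - x j ≠ 0 := sub_ne_zero.2 fun h => hne j (Units.ext h)
    have sub_inv_ne : (y : F) - (x j : F)⁻¹ ≠ 0 :=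
      sub_ne_zero.2 fun h => hne' j (Units.ext (by simpa using h))
    have split (z : Fˣ) : (z : F) + (z⁻¹ : Fˣ) - ((x j : F) + ((x j)⁻¹ : Fˣ)) =
        (z : F)⁻¹ * ((z - x j) * (z - (x j : F)⁻¹)) := by
      push_cast
      field_simp
      ring
    rw [split, split, div_mul_div_comm, mul_assoc,
      mul_div_cancel₀ _ (mul_ne_zero sub_ne sub_inv_ne)]
    push_cast
    field_simp
  rw [alt_cons_rho, alt_cons_rho, factor_one, Finset.prod_congr rfl fun j _ => factor j,
    Finset.prod_mul_distrib]
  ring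

theorem P_eq_prod_succAbove (q : F) (x : Fin (n + 1) → Fˣ) (i : Fin (n + 1)) (s : ℤˣ) {y : F}
    (hy : y = ((x i ^ (s : ℤ) : Fˣ) : F)) :
    P q (fun a : Idx (n + 1) => ((x a.1 ^ (a.2 : ℤ) : Fˣ) : F)) (i, s) =
      ∏ j, ((q * y - q⁻¹ * x (i.succAbove j)) / (y - x (i.succAbove j)) *
        ((q * y - q⁻¹ * (x (i.succAbove j) : F)⁻¹) / (y - (x (i.succAbove j) : F)⁻¹))) := by
  subst hy
  rw [P, Finset.prod_filter, Fintype.prod_prod_type, Fin.prod_univ_succAbove _ i]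
  simp [UnitsInt.univ, Finset.prod_pair (show (1 : ℤˣ) ≠ -1 by decide)]

theorem sub_inv_div_sub_inv {q y : F} (hq : q ≠ 0) (hy0 : y ≠ 0) (hy : y ≠ y⁻¹) :
    (q * y - q⁻¹ * y⁻¹ + q - q⁻¹) / (y - y⁻¹) = (q * y - q⁻¹) / (y - 1) := by
  have h_mul : y * (y - y⁻¹) = (y - 1) * (y + 1) := by field_simp; ring
  have h_ne : (y - 1) * (y + 1) ≠ 0 := h_mul ▸ mul_ne_zero hy0 (sub_ne_zero.2 hy)
  rw [div_eq_div_iff (sub_ne_zero.2 hy) (left_ne_zero_of_mul h_ne)]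
  field_simp
  ring

theorem alt_rho_mul_G_term (q : Fˣ) (x : Fin (n + 1) → Fˣ)
    (hx : Function.Injective fun a : Idx (n + 1) => x a.1 ^ (a.2 : ℤ)) (k : ℕ) (i : Fin (n + 1))
    (s : ℤˣ) {y : Fˣ} (hy : y = x i ^ (s : ℤ)) :
    alt x (rho (n + 1)) *
      (((q : F) * y - (q : F)⁻¹ * (y : F)⁻¹ + q - (q : F)⁻¹) / ((y : F) - (y : F)⁻¹) *
        (y : F) ^ k * P (q : F) (fun a : Idx (n + 1) => ((x a.1 ^ (a.2 : ℤ) : Fˣ) : F)) (i, s)) =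
    ∑ r ∈ Finset.range (2 * (n + 1)), (-1) ^ r * (q : F) ^ (2 * ((n + 1 : ℕ) : ℤ) - 2 * r - 1) *
      ((-1) ^ (i : ℕ) * (signFactor (x i) s * ((y ^ ((k : ℤ) - r + (n + 1)) : Fˣ) : F)) *
        alt (x ∘ i.succAbove) (rhoOmit n (rbar (n + 1) r))) := by
  have y_ne (j t) (hj : j ≠ i) : y ≠ x j ^ ((t : ℤˣ) : ℤ) := fun h =>
    hj (congrArg Prod.fst (hx (a₁ := (i, s)) (a₂ := (j, t)) (hy.symm.trans h))).symm
  have y_ne_inv : (y : F) ≠ (y : F)⁻¹ := fun h => by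
    have y_eq_inv : y = y⁻¹ := Units.ext (by simpa using h)
    have s_eq_neg : s = -s := congrArg Prod.snd (hx (a₁ := (i, s)) (a₂ := (i, -s))
      (by simpa [← hy] using y_eq_inv))
    exact (by decide : ∀ t : ℤˣ, t ≠ -t) s s_eq_neg
  have shift := alt_cons_sq_mul_rho q y (x ∘ i.succAbove)
    (fun h => y_ne_inv (by simp [h])) (fun j => by simpa using y_ne _ 1 (i.succAbove_ne j))
    (fun j => by simpa using y_ne _ (-1) (i.succAbove_ne j))
  calc _ = (-1) ^ (i : ℕ) * signFactor (x i) s * (y : F) ^ k * ((q : F)⁻¹ *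
        alt (Fin.cons (q ^ 2 * y) (x ∘ i.succAbove)) (rho (n + 1))) := by
        rw [shift, inv_mul_cancel_left₀ q.ne_zero, sub_inv_div_sub_inv q.ne_zero y.ne_zero y_ne_inv,
          P_eq_prod_succAbove (q : F) x i s (congrArg _ hy), alt_eq_signFactor_mul x _ i s, ← hy]
        simp only [Function.comp]
        ring
    _ = _ := by
        rw [alt_cons_rho_eq_sum, Finset.mul_sum, Finset.mul_sum]
        refine Finset.sum_congr rfl fun r _ => ?_
        have q_pow : (q : F) ^ (2 * ((n + 1 : ℕ) : ℤ) - 2 * r - 1) =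
            (q : F)⁻¹ * ((q : F) ^ 2) ^ ((n : ℤ) + 1 - r) := by
          rw [← zpow_natCast, ← zpow_mul, ← zpow_neg_one, ← zpow_add₀ q.ne_zero]
          congr 1
          push_cast
          ring
        have y_pow : (y : F) ^ ((k : ℤ) - r + (n + 1)) =
            (y : F) ^ k * (y : F) ^ ((n : ℤ) + 1 - r) := by
          rw [← zpow_natCast, ← zpow_add₀ y.ne_zero]
          congr 1
          ring
        simp only [q_pow, Units.val_zpow_eq_zpow_val, y_pow, Units.val_mul,
          Units.val_pow_eq_pow_val, mul_zpow]
        ring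

theorem alt_rho_mul_G (q : Fˣ) (x : Fin (n + 1) → Fˣ)
    (hx : Function.Injective fun a : Idx (n + 1) => x a.1 ^ (a.2 : ℤ)) (k : ℕ) :
    alt x (rho (n + 1)) *
        (G (q : F) (fun a : Idx (n + 1) => ((x a.1 ^ (a.2 : ℤ) : Fˣ) : F)) k - ((q : F) ^ k)⁻¹) =
      ∑ r ∈ Finset.range (2 * (n + 1)), (-1) ^ r *
        (q : F) ^ (2 * ((n + 1 : ℕ) : ℤ) - 2 * r - 1) *
          alt x (Fin.cons ((k : ℤ) - r + (n + 1)) (rhoOmit n (rbar (n + 1) r))) := by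
  rw [G, add_sub_cancel_left, Finset.mul_sum,
    Finset.sum_congr rfl fun a _ => alt_rho_mul_G_term q x hx k a.1 a.2 rfl, Finset.sum_comm]
  refine Finset.sum_congr rfl fun r _ => ?_
  rw [← Finset.mul_sum, alt_cons_exponent, Fintype.sum_prod_type]
  simp only [altEntry_eq_sum, Finset.mul_sum, Finset.sum_mul]

end AlternantG

/-! ### Straightening -/

section Straightening

variable {R : Type*} [CommRing R] {n : ℕ}

theorem alt_cons_rhoOmit (x : Fin (n + 1) → Rˣ) {r : ℕ} (hr : r < 2 * (n + 1)) :
    alt x (Fin.cons ((n : ℤ) + 1 - r) (rhoOmit n (rbar (n + 1) r))) =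
      (-1) ^ r * alt x (rho (n + 1)) := by
  have of_le (j : ℕ) (hj : j ≤ n) :
      alt x (Fin.cons ((n : ℤ) + 1 - j) (rhoOmit n j)) = (-1) ^ j * alt x (rho (n + 1)) := by
    simpa [rho_comp_succAbove, rho] using
      alt_exponent_cons_succAbove x (rho (n + 1)) ⟨j, Nat.lt_succ_of_le hj⟩
  rcases le_or_gt r n with h | h
  · rw [show rbar (n + 1) r = r by unfold rbar; omega, of_le r h]
  · have reflect : (n : ℤ) + 1 - r = 1 - ((n : ℤ) + 1 - (2 * n + 1 - r : ℕ)) := by omega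
    rw [show rbar (n + 1) r = 2 * n + 1 - r by unfold rbar; omega, reflect, alt_cons_one_sub,
      of_le _ (by omega), neg_one_pow_two_mul_add_one_sub (by omega)]
    ring

theorem alt_cons_rhoOmit_eq_zero (x : Fin (n + 1) → Rˣ) {c : ℤ} {j : ℕ} (hj : j ≤ n)
    (hc_ge : -n ≤ c) (hc_le : c ≤ n + 1) (hc : c ≠ n + 1 - j) (hc' : c ≠ j - n) :
    alt x (Fin.cons c (rhoOmit n j)) = 0 := by
  have of_pos (d : ℤ) (hd_pos : 0 < d) (hd_le : d ≤ n + 1) (hd : d ≠ n + 1 - j) :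
      alt x (Fin.cons d (rhoOmit n j)) = 0 := by
    obtain ⟨a, rfl⟩ : ∃ a, d = rhoOmit n j a := by
      rcases lt_or_gt_of_ne hd with h | h
      · exact ⟨⟨(n - d).toNat, by omega⟩, by simp only [rhoOmit]; split_ifs <;> omega⟩
      · exact ⟨⟨(n + 1 - d).toNat, by omega⟩, by simp only [rhoOmit]; split_ifs <;> omega⟩
    exact alt_eq_zero_of_apply_eq x (Fin.succ_ne_zero a).symm rfl
  rcases lt_or_ge 0 c with h | h
  · exact of_pos c h hc_le hc
  · rw [← sub_sub_cancel 1 c, alt_cons_one_sub, of_pos (1 - c) (by omega) (by omega) (by omega),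
      neg_zero]

theorem alt_cons_rhoOmit_of_le (x : Fin (n + 1) → Rˣ) {k r : ℕ} (hr : r < 2 * (n + 1))
    (hk : k ≤ r) :
    alt x (Fin.cons ((k : ℤ) - r + (n + 1)) (rhoOmit n (rbar (n + 1) r))) =
      (if k = 0 then (-1) ^ r else if k + 2 * n + 1 = 2 * r then -(-1) ^ r else 0) *
        alt x (rho (n + 1)) := by
  split_ifs with h0 h1
  · rw [← alt_cons_rhoOmit x hr, h0]
    congr 2
    push_cast
    ring
  · rw [neg_mul, ← alt_cons_rhoOmit x hr, ← alt_cons_one_sub]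
    congr 2
    omega
  · rw [zero_mul]
    have rbar_eq : rbar (n + 1) r = min r (2 * (n + 1) - 1 - r) := rfl
    apply alt_cons_rhoOmit_eq_zero <;> omega

end Straightening

/-! ### Root vectors of `𝔰𝔬_{2n+1}` -/

section RootVectors

variable {n : ℕ}

/-- The index set of the standard basis of the vector representation `ℂ^(1 + n + n)`. -/
abbrev VecIdx (n : ℕ) := Unit ⊕ (Fin n ⊕ Fin n)

/-- The weight of a standard basis vector of the vector representation. -/
def wt : VecIdx n → Fin n → ℤ := Sum.elim 0 (Sum.elim eps fun i => -eps i)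

/-- The involution `a ↦ a'` of the indices for which the basis vectors `e_a` and `e_b` are
orthogonal unless `b = a'`. -/
def dualIdx : VecIdx n → VecIdx n := Sum.map id Sum.swap

/-- The value of the symmetric form at the basis vectors with indices `a` and `dualIdx a`. -/
def formCoeff : VecIdx n → ℂ := Sum.elim 2 1

@[simp] theorem dualIdx_dualIdx (a : VecIdx n) : dualIdx (dualIdx a) = a := by
  rcases a with _ | _ | _ <;> rfl

@[simp] theorem formCoeff_dualIdx (a : VecIdx n) : formCoeff (dualIdx a) = formCoeff a := by
  rcases a with _ | _ | _ <;> rfl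

@[simp] theorem wt_dualIdx (a : VecIdx n) : wt (dualIdx a) = -wt a := by
  rcases a with _ | _ | _ <;> simp [wt, dualIdx]

theorem formCoeff_ne_zero (a : VecIdx n) : formCoeff a ≠ 0 := by
  rcases a with _ | _ | _ <;> simp [formCoeff]

theorem dualIdx_inj {a b : VecIdx n} : dualIdx a = dualIdx b ↔ a = b :=
  (Function.LeftInverse.injective dualIdx_dualIdx).eq_iff

theorem dualIdx_eq_iff {a b : VecIdx n} : dualIdx a = b ↔ a = dualIdx b := by
  rw [← dualIdx_inj, dualIdx_dualIdx]

theorem eq_dualIdx_comm {a b : VecIdx n} : a = dualIdx b ↔ b = dualIdx a := by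
  rw [← dualIdx_eq_iff, eq_comm]

theorem JB_apply (a b : VecIdx n) :
    LieAlgebra.Orthogonal.JB (Fin n) ℂ a b = if b = dualIdx a then formCoeff a else 0 := by
  rcases a with a | a | a <;> rcases b with b | b | b <;>
    simp [LieAlgebra.Orthogonal.JB, LieAlgebra.Orthogonal.JD, dualIdx, formCoeff,
      Matrix.one_apply, eq_comm]

theorem mem_Lie_iff (X : Matrix (VecIdx n) (VecIdx n) ℂ) :
    X ∈ Lie n ↔ ∀ a b, formCoeff b * X (dualIdx b) a = -(formCoeff a * X (dualIdx a) b) := by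
  rw [Lie, LieAlgebra.Orthogonal.typeB, mem_skewAdjointMatricesLieSubalgebra,
    mem_skewAdjointMatricesSubmodule, Matrix.IsSkewAdjoint, Matrix.IsAdjointPair, ← Matrix.ext_iff]
  refine forall₂_congr fun a b => ?_
  have h (c : VecIdx n) : (b = dualIdx c) = (c = dualIdx b) := propext eq_dualIdx_comm
  simp only [Matrix.mul_apply, Matrix.transpose_apply, JB_apply, Matrix.neg_apply]
  simp [h, mul_comm]

/-- The matrix of `v ↦ (e_c, v) e_a - (e_a, v) e_c`. -/
def wedgeMatrix (a c : VecIdx n) : Matrix (VecIdx n) (VecIdx n) ℂ :=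
  Matrix.single a (dualIdx c) (formCoeff c) - Matrix.single c (dualIdx a) (formCoeff a)

theorem wedgeMatrix_apply (a c d e : VecIdx n) : wedgeMatrix a c d e =
    (if a = d ∧ dualIdx c = e then formCoeff c else 0) -
      (if c = d ∧ dualIdx a = e then formCoeff a else 0) := by
  simp [wedgeMatrix, Matrix.single_apply]

theorem wedgeMatrix_mem (a c : VecIdx n) : wedgeMatrix a c ∈ Lie n := by
  rw [mem_Lie_iff]
  intro d e
  simp only [wedgeMatrix_apply, dualIdx_eq_iff]
  have hdual (x : VecIdx n) : formCoeff (dualIdx x) = formCoeff x := formCoeff_dualIdx x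
  grind

/-- The element of `𝔰𝔬_{2n+1}` that corresponds to `e_a ∧ e_c` under `𝔰𝔬(V) ≅ ⋀² V`. -/
def wedge (a c : VecIdx n) : Lie n := ⟨wedgeMatrix a c, wedgeMatrix_mem a c⟩

theorem wedge_self (a : VecIdx n) : wedge a a = 0 := Subtype.ext (sub_self _)

theorem wedge_swap (a c : VecIdx n) : wedge c a = -wedge a c := Subtype.ext (neg_sub _ _).symm

theorem sum_ite_eq_dualIdx {M : Type*} [AddCommMonoid M] (c : VecIdx n) (f : VecIdx n → M) :
    ∑ x, (if c = dualIdx x then f x else 0) = f (dualIdx c) := by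
  simp [eq_dualIdx_comm (a := c)]

theorem lie_wedge (X : Lie n) (a c : VecIdx n) :
    ⁅X, wedge a c⁆ = ∑ b, X.1 b a • wedge b c + ∑ b, X.1 b c • wedge a b := by
  have hX (a e : VecIdx n) : formCoeff a * X.1 (dualIdx a) e = -(X.1 (dualIdx e) a * formCoeff e) :=
    by rw [(mem_Lie_iff X.1).1 X.2 e a, mul_comm]
  apply Subtype.ext
  ext d e
  simp only [LieSubalgebra.coe_bracket, Ring.lie_def, AddMemClass.coe_add,
    AddSubmonoidClass.coe_finsetSum, SetLike.val_smul, wedge, Matrix.sub_apply, Matrix.mul_apply,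
    Matrix.add_apply, Matrix.sum_apply, Matrix.smul_apply, wedgeMatrix_apply, smul_eq_mul, mul_sub,
    sub_mul, Finset.sum_sub_distrib, ite_and, mul_ite, ite_mul, mul_zero, zero_mul]
  simp only [dualIdx_eq_iff, sum_ite_eq_dualIdx, Finset.sum_ite_eq, Finset.sum_ite_eq',
    Finset.mem_univ, if_true, Finset.sum_ite_irrel, Finset.sum_const_zero, hX, formCoeff_dualIdx]
  split_ifs <;> ring

theorem eq_sum_wedge (X : Lie n) :
    X = ∑ a, ∑ b, (2⁻¹ * X.1 a (dualIdx b) * (formCoeff b)⁻¹) • wedge a b := by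
  apply Subtype.ext
  ext d e
  have hd := formCoeff_ne_zero d
  have he := formCoeff_ne_zero e
  have skew : X.1 (dualIdx e) (dualIdx d) * formCoeff e * (formCoeff d)⁻¹ = -X.1 d e := by
    have h := (mem_Lie_iff X.1).1 X.2 (dualIdx d) e
    rw [dualIdx_dualIdx, formCoeff_dualIdx] at h
    field_simp
    linear_combination h
  simp only [AddSubmonoidClass.coe_finsetSum, SetLike.val_smul, wedge, Matrix.sum_apply,
    Matrix.smul_apply, wedgeMatrix_apply, smul_eq_mul, mul_sub, Finset.sum_sub_distrib, ite_and,
    mul_ite, mul_zero, dualIdx_eq_iff, Finset.sum_ite_eq', Finset.mem_univ, if_true,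
    Finset.sum_ite_irrel, Finset.sum_const_zero, dualIdx_dualIdx, formCoeff_dualIdx]
  linear_combination (1 / 2 : ℂ) * skew - (1 / 2 : ℂ) * X.1 d e * inv_mul_cancel₀ he

theorem span_wedge :
    Submodule.span ℂ (Set.range fun p : VecIdx n × VecIdx n => wedge p.1 p.2) = ⊤ := by
  refine eq_top_iff.2 fun X _ => ?_
  rw [eq_sum_wedge X]
  exact Submodule.sum_mem _ fun a _ => Submodule.sum_mem _ fun b _ =>
    Submodule.smul_mem _ _ (Submodule.subset_span ⟨(a, b), rfl⟩)

theorem cartan_apply (i : Fin n) (a b : VecIdx n) :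
    (cartan n i).1 a b = if a = b then (wt a i : ℂ) else 0 := by
  simp only [cartan, cartanMatrix, Matrix.diagonal_apply]
  split_ifs with h
  · rcases a with a | a | a <;> simp [wt, eps, Pi.single_apply, eq_comm]
  · rfl

/-- `x` lies in the root space of `α`, or in the Cartan subalgebra if `α = 0`. -/
def IsRootVector (α : Fin n → ℤ) (x : Lie n) : Prop := ∀ i, ⁅cartan n i, x⁆ = (α i : ℂ) • x

theorem isRootVector_wedge (a c : VecIdx n) : IsRootVector (wt a + wt c) (wedge a c) := fun i => by
  rw [lie_wedge]
  simp [cartan_apply, ite_smul, add_smul]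

theorem wedge_dualIdx (a : VecIdx n) :
    wedge a (dualIdx a) = formCoeff a • ∑ i, (wt a i : ℂ) • cartan n i := by
  apply Subtype.ext
  ext d e
  simp only [AddSubmonoidClass.coe_finsetSum, SetLike.val_smul, wedge, Matrix.sum_apply,
    Matrix.smul_apply, wedgeMatrix_apply, smul_eq_mul, cartan_apply, dualIdx_dualIdx,
    formCoeff_dualIdx]
  rcases a with a | a | a <;> rcases d with d | d | d <;> rcases e with e | e | e <;>
    simp [dualIdx, wt, formCoeff, eps, Pi.single_apply] <;> grind

theorem lie_wedge_wedge_dualIdx {a c : VecIdx n} (h : a ≠ c) :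
    ⁅wedge a c, wedge (dualIdx c) (dualIdx a)⁆ =
      (formCoeff a * formCoeff c) • ∑ i, ((wt a i : ℂ) + (wt c i : ℂ)) • cartan n i := by
  have apply_left (b : VecIdx n) :
      (wedge a c).1 b (dualIdx c) = if a = b then formCoeff c else 0 := by
    simp [wedge, wedgeMatrix_apply, dualIdx_inj, h]
  have apply_right (b : VecIdx n) :
      (wedge a c).1 b (dualIdx a) = if c = b then -formCoeff a else 0 := by
    simp [wedge, wedgeMatrix_apply, dualIdx_inj, h.symm, neg_ite]
  rw [lie_wedge]
  simp only [apply_left, apply_right, ite_smul, zero_smul, Finset.sum_ite_eq, Finset.mem_univ,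
    if_true]
  rw [wedge_swap c (dualIdx c), wedge_dualIdx, wedge_dualIdx]
  simp only [add_smul, Finset.sum_add_distrib, smul_neg, smul_add, smul_smul]
  rw [mul_comm (formCoeff c), neg_mul, neg_smul, neg_neg]

theorem wt_add_wt_cases (a c : VecIdx n) : a = c ∨ c = dualIdx a ∨ wt a + wt c ∈ posRoots n ∨
    -(wt a + wt c) ∈ posRoots n := by
  have short (i : Fin n) : eps i ∈ posRoots n := .inl ⟨i, rfl⟩
  have long (i j : Fin n) (h : i < j) : eps i + eps j ∈ posRoots n ∧ eps i - eps j ∈ posRoots n :=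
    ⟨.inr ⟨i, j, h, .inl rfl⟩, .inr ⟨i, j, h, .inr rfl⟩⟩
  rcases a with a | a | a <;> rcases c with c | c | c
  case inl.inl => exact .inl rfl
  case inl.inr.inl | inl.inr.inr | inr.inl.inl | inr.inr.inl => simp [wt, short]
  all_goals
    rcases lt_trichotomy a c with h | rfl | h
    · simp [wt, long _ _ h, ← sub_eq_add_neg, add_comm]
    · simp [dualIdx]
    · simp [wt, long _ _ h, ← sub_eq_add_neg, neg_add_eq_sub, add_comm (eps a) (eps c)]

section Weights

variable {ι : Type*} [Fintype ι] [DecidableEq ι]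

/-- The representation `R` by matrices refers to a basis of weight vectors with the weights `w`. -/
def HasWeights (R : Lie n →ₗ⁅ℂ⁆ Matrix ι ι ℂ) (w : ι → Fin n → ℤ) : Prop :=
  ∀ k, R (cartan n k) = Matrix.diagonal fun i => (w i k : ℂ)

variable {R : Lie n →ₗ⁅ℂ⁆ Matrix ι ι ℂ} {w : ι → Fin n → ℤ}

theorem HasWeights.eq_add_of_apply_ne_zero (hw : HasWeights R w) {x : Lie n} {α : Fin n → ℤ}
    (hx : IsRootVector α x) (i j : ι) (h : R x i j ≠ 0) : w i = w j + α := by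
  ext k
  have entry := congrArg (fun y => R y i j) (hx k)
  simp only [LieHom.map_lie, Ring.lie_def, hw k, Matrix.sub_apply, Matrix.diagonal_mul,
    Matrix.mul_diagonal, map_smul, Matrix.smul_apply, smul_eq_mul] at entry
  have eq_coe : (w i k : ℂ) = w j k + α k := mul_right_cancel₀ h (by linear_combination entry)
  exact_mod_cast eq_coe

theorem hasWeights_incl : HasWeights (Lie n).incl (wt : VecIdx n → Fin n → ℤ) := fun k => by
  ext a b
  rw [LieSubalgebra.coe_incl, cartan_apply, Matrix.diagonal_apply]

end Weights

end RootVectors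

/-! ### Highest weight vectors -/

section HighestWeight

variable {n : ℕ}

/-- The vectors in the root spaces of the negative roots. -/
def negRootVectors (n : ℕ) : Set (Lie n) := {y | ∃ α ∈ posRoots n, IsRootVector (-α) y}

theorem span_cartan_rootVectors :
    Submodule.span ℂ (Set.range (cartan n) ∪ posRootVectors n ∪ negRootVectors n) = ⊤ := by
  rw [eq_top_iff, ← span_wedge, Submodule.span_le]
  rintro _ ⟨⟨a, c⟩, rfl⟩
  rcases wt_add_wt_cases a c with rfl | rfl | h | h
  · simp only [wedge_self, SetLike.mem_coe, zero_mem]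
  · simp only [wedge_dualIdx]
    exact Submodule.smul_mem _ _ (Submodule.sum_mem _ fun i _ => Submodule.smul_mem _ _
      (Submodule.subset_span (.inl (.inl ⟨i, rfl⟩))))
  · exact Submodule.subset_span (.inl (.inr ⟨_, h, isRootVector_wedge a c⟩))
  · refine Submodule.subset_span (.inr ⟨_, h, ?_⟩)
    rw [neg_neg]
    exact isRootVector_wedge a c

variable {W : Type*} [AddCommGroup W] [Module ℂ W] {ρ : Lie n →ₗ⁅ℂ⁆ Module.End ℂ W}

theorem apply_mem_of_cartan_of_rootVectors {p : Submodule ℂ W} {w : W}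
    (hcartan : ∀ i, ρ (cartan n i) w ∈ p) (hpos : ∀ x ∈ posRootVectors n, ρ x w ∈ p)
    (hneg : ∀ y ∈ negRootVectors n, ρ y w ∈ p) (x : Lie n) : ρ x w ∈ p := by
  suffices ⊤ ≤ p.comap ((ρ : Lie n →ₗ[ℂ] Module.End ℂ W).flip w) from this (x := x) trivial
  rw [← span_cartan_rootVectors, Submodule.span_le]
  rintro _ ((⟨i, rfl⟩ | hx) | hy)
  exacts [hcartan i, hpos _ hx, hneg _ hy]

theorem apply_apply (x y : Lie n) (w : W) : ρ x (ρ y w) = ρ ⁅x, y⁆ w + ρ y (ρ x w) := by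
  simp [LieHom.map_lie, Ring.lie_def]

/-- The space of the vectors of weight `μ` in a representation. -/
def wtSpace (ρ : Lie n →ₗ⁅ℂ⁆ Module.End ℂ W) (μ : Fin n → ℤ) : Submodule ℂ W :=
  ⨅ i, Module.End.eigenspace (ρ (cartan n i)) (μ i : ℂ)

theorem mem_wtSpace {μ : Fin n → ℤ} {w : W} :
    w ∈ wtSpace ρ μ ↔ ∀ i, ρ (cartan n i) w = (μ i : ℂ) • w := by
  simp [wtSpace]

theorem IsRootVector.apply_mem_wtSpace {α μ : Fin n → ℤ} {x : Lie n} (hx : IsRootVector α x)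
    {w : W} (hw : w ∈ wtSpace ρ μ) : ρ x w ∈ wtSpace ρ (μ + α) :=
  mem_wtSpace.2 fun i => by
    rw [apply_apply, hx i, mem_wtSpace.1 hw i, map_smul, map_smul, LinearMap.smul_apply, ← add_smul]
    simp [add_comm]

theorem sum_smul_cartan_apply {μ : Fin n → ℤ} {w : W} (hw : w ∈ wtSpace ρ μ) (κ : Fin n → ℂ) :
    ρ (∑ i, κ i • cartan n i) w = (∑ i, κ i * μ i) • w := by
  simp [map_sum, mem_wtSpace.1 hw, smul_smul, Finset.sum_smul]

/-- `v` is a vector of weight `lam` that is killed by the positive root vectors. -/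
structure IsHighest (ρ : Lie n →ₗ⁅ℂ⁆ Module.End ℂ W) (lam : Fin n → ℤ) (v : W) : Prop where
  mem : v ∈ wtSpace ρ lam
  apply_eq_zero : ∀ x ∈ posRootVectors n, ρ x v = 0

/-- `Descendant ρ v δ w` says that `w` arises from `v` by applying negative root vectors whose
weights have sum `-δ`. -/
inductive Descendant (ρ : Lie n →ₗ⁅ℂ⁆ Module.End ℂ W) (v : W) : (Fin n → ℤ) → W → Prop
  | base : Descendant ρ v 0 v
  | step {δ α : Fin n → ℤ} {w : W} {y : Lie n} : Descendant ρ v δ w → α ∈ posRoots n →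
      IsRootVector (-α) y → Descendant ρ v (δ + α) (ρ y w)

/-- The span of the descendants of `v`. -/
def descSpan (ρ : Lie n →ₗ⁅ℂ⁆ Module.End ℂ W) (v : W) : Submodule ℂ W :=
  Submodule.span ℂ {w | ∃ δ, Descendant ρ v δ w}

variable {lam : Fin n → ℤ} {v : W}

theorem Descendant.mem_descSpan {δ : Fin n → ℤ} {w : W} (h : Descendant ρ v δ w) :
    w ∈ descSpan ρ v := Submodule.subset_span ⟨δ, h⟩

theorem self_mem_descSpan : v ∈ descSpan ρ v := Descendant.base.mem_descSpan

theorem apply_mem_descSpan_of_forall {x : Lie n}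
    (hx : ∀ δ w, Descendant ρ v δ w → ρ x w ∈ descSpan ρ v) {w : W} (hw : w ∈ descSpan ρ v) :
    ρ x w ∈ descSpan ρ v := by
  suffices descSpan ρ v ≤ (descSpan ρ v).comap (ρ x) from this hw
  exact Submodule.span_le.2 fun w ⟨δ, h⟩ => hx δ w h

theorem neg_apply_mem_descSpan {y : Lie n} (hy : y ∈ negRootVectors n) {w : W}
    (hw : w ∈ descSpan ρ v) : ρ y w ∈ descSpan ρ v := by
  obtain ⟨α, hα, hy⟩ := hy
  exact apply_mem_descSpan_of_forall (fun δ w h => (h.step hα hy).mem_descSpan) hw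

theorem IsHighest.apply_mem_descSpan (hv : IsHighest ρ lam v) (x : Lie n) {w : W}
    (hw : w ∈ descSpan ρ v) : ρ x w ∈ descSpan ρ v := by
  refine apply_mem_descSpan_of_forall (fun δ w h => ?_) hw
  induction h generalizing x with
  | base =>
    refine apply_mem_of_cartan_of_rootVectors (fun i => ?_) (fun x hx => ?_)
      (fun y hy => neg_apply_mem_descSpan hy self_mem_descSpan) x
    · rw [mem_wtSpace.1 hv.mem i]
      exact Submodule.smul_mem _ _ self_mem_descSpan
    · rw [hv.apply_eq_zero x hx]
      exact zero_mem _
  | @step _ α _ y _ hα hy ih =>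
    rw [apply_apply]
    exact add_mem (ih _) (neg_apply_mem_descSpan ⟨α, hα, hy⟩ (ih x))

theorem Descendant.mem_wtSpace (hv : IsHighest ρ lam v) {δ : Fin n → ℤ} {w : W}
    (h : Descendant ρ v δ w) : w ∈ wtSpace ρ (lam - δ) := by
  induction h with
  | base => rw [sub_zero]; exact hv.mem
  | step _ _ hy ih =>
    rw [← sub_sub, sub_eq_add_neg _ (_ : Fin n → ℤ)]
    exact hy.apply_mem_wtSpace ih

end HighestWeight

/-! ### The cone spanned by the positive roots -/

section Cone

variable {n : ℕ} {κ : Fin n → ℤ}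

/-- The cone spanned by the positive roots. -/
def cone (n : ℕ) : AddSubmonoid (Fin n → ℤ) := AddSubmonoid.closure (posRoots n)

theorem dotProduct_pos_of_mem_posRoots (hκ : StrictAnti κ) (hpos : ∀ i, 0 < κ i)
    {α : Fin n → ℤ} (hα : α ∈ posRoots n) : 0 < κ ⬝ᵥ α := by
  rcases hα with ⟨i, rfl⟩ | ⟨i, j, hij, rfl | rfl⟩
  · simpa only [eps, dotProduct_single_one] using hpos i
  · simpa only [eps, dotProduct_add, dotProduct_single_one] using add_pos (hpos i) (hpos j)
  · simpa only [eps, dotProduct_sub, dotProduct_single_one, sub_pos] using hκ hij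

theorem eq_zero_or_dotProduct_pos_of_mem_cone (hκ : StrictAnti κ) (hpos : ∀ i, 0 < κ i)
    {δ : Fin n → ℤ} (hδ : δ ∈ cone n) : δ = 0 ∨ 0 < κ ⬝ᵥ δ := by
  induction hδ using AddSubmonoid.closure_induction with
  | mem α hα => exact .inr (dotProduct_pos_of_mem_posRoots hκ hpos hα)
  | zero => exact .inl rfl
  | add x y _ _ hx hy =>
    rcases hx with rfl | hx
    · simpa only [zero_add] using hy
    · rcases hy with rfl | hy
      · simpa only [add_zero] using Or.inr hx
      · exact .inr (by simpa only [dotProduct_add] using add_pos hx hy)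

theorem rho_strictAnti (n : ℕ) : StrictAnti (rho n) := fun i j (h : (i : ℕ) < j) => by
  simp only [rho]; omega

theorem rho_pos (i : Fin n) : 0 < rho n i := by
  have := i.isLt
  simp only [rho]; omega

variable {W : Type*} [AddCommGroup W] [Module ℂ W] {ρ : Lie n →ₗ⁅ℂ⁆ Module.End ℂ W} {v w : W}
  {δ : Fin n → ℤ}

theorem Descendant.mem_cone (h : Descendant ρ v δ w) : δ ∈ cone n := by
  induction h with
  | base => exact zero_mem _
  | step _ hα _ ih => exact add_mem ih (AddSubmonoid.subset_closure hα)

theorem Descendant.eq_or_rho_dotProduct_pos (h : Descendant ρ v δ w) :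
    δ = 0 ∧ w = v ∨ 0 < rho n ⬝ᵥ δ := by
  cases h with
  | base => exact .inl ⟨rfl, rfl⟩
  | step h hα _ =>
    have hα := dotProduct_pos_of_mem_posRoots (rho_strictAnti n) rho_pos hα
    rw [dotProduct_add]
    rcases eq_zero_or_dotProduct_pos_of_mem_cone (rho_strictAnti n) rho_pos h.mem_cone with
      rfl | hδ
    · simpa using .inr hα
    · exact .inr (add_pos hδ hα)

end Cone

/-! ### The Verma module and its simple quotient -/

section Eigenspaces

variable {F V : Type*} [Field F] [AddCommGroup V] [Module F V] {f : Module.End F V} {Λ : F} {v : V}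

theorem exists_eval_ne_zero_of_mem_iSup_eigenspace {y : V}
    (hy : y ∈ ⨆ μ, ⨆ _ : μ ≠ Λ, f.eigenspace μ) :
    ∃ p : Polynomial F, p.eval Λ ≠ 0 ∧ Polynomial.aeval f p y = 0 := by
  rw [iSup_subtype'] at hy
  induction hy using Submodule.iSup_induction' with
  | mem μ y hy =>
    refine ⟨.X - .C μ.1, by simpa using sub_ne_zero.2 μ.2.symm, ?_⟩
    rw [map_sub, Polynomial.aeval_X, Polynomial.aeval_C, LinearMap.sub_apply,
      Module.End.mem_eigenspace_iff.1 hy, Module.algebraMap_end_apply, sub_self]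
  | zero => exact ⟨1, by simp, by simp⟩
  | add y z _ _ hy hz =>
    obtain ⟨p, hp, hpy⟩ := hy
    obtain ⟨r, hr, hrz⟩ := hz
    refine ⟨p * r, by rw [Polynomial.eval_mul]; exact mul_ne_zero hp hr, ?_⟩
    rw [map_add, map_mul, Module.End.mul_apply, Module.End.mul_apply, hrz, map_zero, add_zero,
      ← Module.End.mul_apply, ← map_mul, mul_comm, map_mul, Module.End.mul_apply, hpy, map_zero]

theorem notMem_iSup_eigenspace_ne (hv : f v = Λ • v) (hv0 : v ≠ 0) :
    v ∉ ⨆ μ, ⨆ _ : μ ≠ Λ, f.eigenspace μ := fun h =>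
  hv0 (Submodule.disjoint_def.1 (f.eigenspaces_iSupIndep Λ) v
    (Module.End.mem_eigenspace_iff.2 hv) h)

theorem le_iSup_eigenspace_ne (hv : f v = Λ • v)
    (htop : Submodule.span F {v} ⊔ ⨆ μ, ⨆ _ : μ ≠ Λ, f.eigenspace μ = ⊤) {p : Submodule F V}
    (hp : p ≤ p.comap f) (hvp : v ∉ p) : p ≤ ⨆ μ, ⨆ _ : μ ≠ Λ, f.eigenspace μ := by
  intro w hw
  obtain ⟨_, hcv, y, hy, rfl⟩ := Submodule.mem_sup.1 (htop ▸ Submodule.mem_top : w ∈ _)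
  obtain ⟨c, rfl⟩ := Submodule.mem_span_singleton.1 hcv
  obtain ⟨r, hr, hry⟩ := exists_eval_ne_zero_of_mem_iSup_eigenspace hy
  have hrv : Polynomial.aeval f r v = r.eval Λ • v :=
    Module.End.aeval_apply_of_hasEigenvector
      ⟨Module.End.mem_eigenspace_iff.2 hv, fun h => hvp (h ▸ zero_mem p)⟩
  have mem : (c * r.eval Λ) • v ∈ p := by
    have := Polynomial.aeval_apply_smul_mem_of_le_comap hw r f hp
    rwa [map_add, hry, add_zero, map_smul, hrv, smul_smul] at this
  have hc : c = 0 := by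
    by_contra hc
    exact hvp ((p.smul_mem_iff (mul_ne_zero hc hr)).1 mem)
  simpa [hc] using hy

end Eigenspaces

section EnvModule

variable {n : ℕ}

theorem adjoin_range_toEnv : Algebra.adjoin ℂ (Set.range (toEnv n)) = ⊤ := by
  set S := Algebra.adjoin ℂ (Set.range (toEnv n))
  let f : Lie n →ₗ⁅ℂ⁆ S :=
    { toFun x := ⟨toEnv n x, Algebra.subset_adjoin ⟨x, rfl⟩⟩
      map_add' x y := Subtype.ext (map_add (UniversalEnvelopingAlgebra.ι ℂ) x y)
      map_smul' c x := Subtype.ext (map_smul (UniversalEnvelopingAlgebra.ι ℂ) c x)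
      map_lie' {x y} := Subtype.ext (LieHom.map_lie (UniversalEnvelopingAlgebra.ι ℂ) x y) }
  have val_comp_lift : S.val.comp (UniversalEnvelopingAlgebra.lift ℂ f) = AlgHom.id ℂ (Env n) :=
    UniversalEnvelopingAlgebra.hom_ext ℂ (by ext x; simp [f, toEnv])
  refine eq_top_iff.2 fun u _ => ?_
  rw [← AlgHom.id_apply (R := ℂ) u, ← val_comp_lift]
  exact Subtype.property _

variable (n) (W : Type*) [AddCommGroup W] [Module ℂ W] [Module (Env n) W]
  [IsScalarTower ℂ (Env n) W]

/-- The action of the Lie algebra on a module over its enveloping algebra. -/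
def envRep : Lie n →ₗ⁅ℂ⁆ Module.End ℂ W :=
  (AlgHom.toLieHom (Algebra.lsmul ℂ ℂ W : Env n →ₐ[ℂ] Module.End ℂ W)).comp
    (UniversalEnvelopingAlgebra.ι ℂ)

@[simp] theorem envRep_apply (x : Lie n) (w : W) : envRep n W x w = toEnv n x • w := rfl

variable {n W} {lam : Fin n → ℤ} {v : W}

theorem env_smul_mem {p : Submodule ℂ W} (hp : ∀ x : Lie n, ∀ w ∈ p, toEnv n x • w ∈ p)
    (u : Env n) {w : W} (hw : w ∈ p) : u • w ∈ p := by
  have hu : u ∈ Algebra.adjoin ℂ (Set.range (toEnv n)) := adjoin_range_toEnv ▸ Algebra.mem_top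
  induction hu using Algebra.adjoin_induction generalizing w with
  | mem u hu => obtain ⟨x, rfl⟩ := hu; exact hp x w hw
  | algebraMap c => rw [algebraMap_smul]; exact p.smul_mem c hw
  | add a b _ _ ha hb => rw [add_smul]; exact add_mem (ha hw) (hb hw)
  | mul a b _ _ ha hb => rw [mul_smul]; exact ha (hb hw)

theorem IsHighest.descSpan_eq_top (hv : IsHighest (envRep n W) lam v)
    (hgen : Submodule.span (Env n) {v} = ⊤) : descSpan (envRep n W) v = ⊤ := by
  refine eq_top_iff.2 fun w _ => ?_
  obtain ⟨u, rfl⟩ := Submodule.mem_span_singleton.1 (hgen ▸ Submodule.mem_top : w ∈ _)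
  exact env_smul_mem (fun x _ => hv.apply_mem_descSpan x) u self_mem_descSpan

theorem IsHighest.span_sup_iSup_eigenspace_eq_top (hv : IsHighest (envRep n W) lam v)
    (hgen : Submodule.span (Env n) {v} = ⊤) :
    Submodule.span ℂ {v} ⊔ ⨆ μ, ⨆ _ : μ ≠ ∑ i, (rho n i : ℂ) * lam i,
      (envRep n W (∑ i, (rho n i : ℂ) • cartan n i)).eigenspace μ = ⊤ := by
  rw [eq_top_iff, ← hv.descSpan_eq_top hgen]
  refine Submodule.span_le.2 fun w ⟨δ, h⟩ => ?_
  rcases h.eq_or_rho_dotProduct_pos with ⟨_, rfl⟩ | hδ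
  · exact Submodule.mem_sup_left (Submodule.mem_span_singleton_self w)
  · refine Submodule.mem_sup_right (Submodule.mem_iSup_of_mem _ (Submodule.mem_iSup_of_mem ?_
      (Module.End.mem_eigenspace_iff.2 (sum_smul_cartan_apply (h.mem_wtSpace hv) _))))
    have hne : rho n ⬝ᵥ (lam - δ) ≠ rho n ⬝ᵥ lam := by
      rw [dotProduct_sub]
      omega
    simpa only [dotProduct, ← Int.cast_mul, ← Int.cast_sum] using mod_cast hne

end EnvModule

section Verma

variable {n : ℕ} (lam : Fin n → ℤ)

/-- The canonical generator of the Verma module. -/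
def vermaGen : Verma lam := Submodule.Quotient.mk 1

theorem smul_vermaGen (u : Env n) : u • vermaGen lam = Submodule.Quotient.mk u := by
  rw [vermaGen, ← Submodule.Quotient.mk_smul, smul_eq_mul, mul_one]

theorem span_vermaGen : Submodule.span (Env n) {vermaGen lam} = ⊤ := by
  refine eq_top_iff.2 fun w _ => ?_
  obtain ⟨u, rfl⟩ := Submodule.Quotient.mk_surjective _ w
  exact Submodule.mem_span_singleton.2 ⟨u, smul_vermaGen lam u⟩

variable {lam} in
theorem vermaGen_mem_iff {N : Submodule (Env n) (Verma lam)} : vermaGen lam ∈ N ↔ N = ⊤ := by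
  rw [← top_le_iff, ← span_vermaGen, Submodule.span_le, Set.singleton_subset_iff, SetLike.mem_coe]

theorem isHighest_vermaGen : IsHighest (envRep n (Verma lam)) lam (vermaGen lam) where
  mem := mem_wtSpace.2 fun i => by
    rw [envRep_apply, ← algebraMap_smul (Env n) (lam i : ℂ), ← sub_eq_zero, ← sub_smul,
      smul_vermaGen, Submodule.Quotient.mk_eq_zero]
    exact Submodule.subset_span (.inr ⟨i, rfl⟩)
  apply_eq_zero x hx := by
    rw [envRep_apply, smul_vermaGen, Submodule.Quotient.mk_eq_zero]
    exact Submodule.subset_span (.inl ⟨x, hx, rfl⟩)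

variable {lam}

theorem vermaRadical_ne_top (h0 : vermaGen lam ≠ 0) : vermaRadical lam ≠ ⊤ := by
  have hv := isHighest_vermaGen lam
  set z : Lie n := ∑ i, (rho n i : ℂ) • cartan n i
  have hz := sum_smul_cartan_apply hv.mem fun i => (rho n i : ℂ)
  set K : Submodule ℂ (Verma lam) := ⨆ μ, ⨆ _ : μ ≠ ∑ i, (rho n i : ℂ) * lam i,
    (envRep n (Verma lam) z).eigenspace μ
  have proper_le (N : {N : Submodule (Env n) (Verma lam) // N ≠ ⊤}) : ∀ w ∈ N.1, w ∈ K :=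
    le_iSup_eigenspace_ne (p := N.1.restrictScalars ℂ) hz
      (hv.span_sup_iSup_eigenspace_eq_top (span_vermaGen lam))
      (fun _ hw => N.1.smul_mem (toEnv n z) hw) (fun h => N.2 (vermaGen_mem_iff.1 h))
  refine fun htop => notMem_iSup_eigenspace_ne hz h0 ?_
  have mem : vermaGen lam ∈ vermaRadical lam := htop ▸ Submodule.mem_top
  rw [vermaRadical, sSup_eq_iSup'] at mem
  exact Submodule.iSup_induction _ (motive := (· ∈ K)) mem proper_le (zero_mem K)
    fun _ _ => add_mem

variable (lam) in
/-- The image in the simple quotient of the generator of the Verma module. -/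
def simpleGen : Simple lam := Submodule.Quotient.mk (vermaGen lam)

theorem simpleGen_ne_zero (h0 : vermaGen lam ≠ 0) : simpleGen lam ≠ 0 := fun h =>
  vermaRadical_ne_top h0 (vermaGen_mem_iff.1 ((Submodule.Quotient.mk_eq_zero _).1 h))

variable (lam) in
theorem isHighest_simpleGen : IsHighest (envRep n (Simple lam)) lam (simpleGen lam) where
  mem := mem_wtSpace.2 fun i =>
    congrArg ((vermaRadical lam).mkQ ·) (mem_wtSpace.1 (isHighest_vermaGen lam).mem i)
  apply_eq_zero x hx :=
    congrArg ((vermaRadical lam).mkQ ·) ((isHighest_vermaGen lam).apply_eq_zero x hx)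

variable (lam) in
theorem span_simpleGen : Submodule.span (Env n) {simpleGen lam} = ⊤ := by
  have h := congrArg (Submodule.map (vermaRadical lam).mkQ) (span_vermaGen lam)
  rwa [Submodule.map_span, Set.image_singleton, Submodule.map_top, Submodule.range_mkQ] at h

section Lift

variable {W : Type*} [AddCommGroup W] [Module ℂ W] [Module (Env n) W] [IsScalarTower ℂ (Env n) W]
  {v : W}

theorem IsHighest.vermaIdeal_le_ker (hv : IsHighest (envRep n W) lam v) :
    vermaIdeal lam ≤ LinearMap.ker (LinearMap.toSpanSingleton (Env n) W v) := by
  refine Submodule.span_le.2 ?_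
  rintro _ (⟨x, hx, rfl⟩ | ⟨i, rfl⟩)
  · exact hv.apply_eq_zero x hx
  · change (toEnv n (cartan n i) - algebraMap ℂ (Env n) (lam i)) • v = 0
    rw [sub_smul, algebraMap_smul, sub_eq_zero]
    exact mem_wtSpace.1 hv.mem i

/-- The homomorphism from the Verma module that maps its generator to a given highest weight
vector. -/
def IsHighest.vermaLift (hv : IsHighest (envRep n W) lam v) : Verma lam →ₗ[Env n] W :=
  (vermaIdeal lam).liftQ _ hv.vermaIdeal_le_ker

theorem IsHighest.vermaLift_vermaGen (hv : IsHighest (envRep n W) lam v) :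
    hv.vermaLift (vermaGen lam) = v := by
  simp [vermaLift, vermaGen]

theorem IsHighest.vermaGen_ne_zero (hv : IsHighest (envRep n W) lam v) (hv0 : v ≠ 0) :
    vermaGen lam ≠ 0 := fun h => hv0 (by rw [← hv.vermaLift_vermaGen, h, map_zero])

theorem IsHighest.finiteDimensional_simple (hv : IsHighest (envRep n W) lam v) (hv0 : v ≠ 0)
    {p : Submodule ℂ W} [FiniteDimensional ℂ p] (hp : ∀ x : Lie n, ∀ w ∈ p, toEnv n x • w ∈ p)
    (hvp : v ∈ p) : FiniteDimensional ℂ (Simple lam) := by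
  have ker_le : LinearMap.ker hv.vermaLift ≤ vermaRadical lam := le_sSup fun h =>
    hv0 (by rw [← hv.vermaLift_vermaGen, LinearMap.mem_ker.1 (vermaGen_mem_iff.2 h)])
  set φ : Verma lam →ₗ[ℂ] W := hv.vermaLift.restrictScalars ℂ
  have range_le : LinearMap.range φ ≤ p := by
    rintro _ ⟨w, rfl⟩
    obtain ⟨u, rfl⟩ := Submodule.Quotient.mk_surjective _ w
    rw [← smul_vermaGen]
    change hv.vermaLift _ ∈ p
    rw [map_smul, hv.vermaLift_vermaGen]
    exact env_smul_mem hp u hvp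
  have := Submodule.finiteDimensional_of_le range_le
  have : FiniteDimensional ℂ (Verma lam ⧸ LinearMap.ker φ) :=
    φ.quotKerEquivRange.symm.finiteDimensional
  exact Module.Finite.of_surjective
    ((LinearMap.ker φ).liftQ ((vermaRadical lam).mkQ.restrictScalars ℂ)
      fun w hw => (Submodule.Quotient.mk_eq_zero _).2 (ker_le hw))
    fun w => by
      obtain ⟨w, rfl⟩ := Submodule.Quotient.mk_surjective _ w
      exact ⟨Submodule.Quotient.mk w, rfl⟩

end Lift

end Verma

/-! ### Highest weight vectors in a polynomial ring -/

section Jacobi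

variable {R A : Type*} [CommRing R] [CommRing A] [Algebra R A] (D : Derivation R A A)

theorem derivation_prod {ι : Type*} [DecidableEq ι] (s : Finset ι) (f : ι → A) :
    D (∏ i ∈ s, f i) = ∑ i ∈ s, (∏ j ∈ s.erase i, f j) * D (f i) := by
  induction s using Finset.induction_on with
  | empty => simp
  | insert a s ha ih =>
    rw [Finset.prod_insert ha, D.leibniz, ih, Finset.sum_insert ha, Finset.erase_insert ha,
      smul_eq_mul, smul_eq_mul, add_comm, Finset.mul_sum]
    congr 1
    refine Finset.sum_congr rfl fun i hi => ?_
    rw [Finset.erase_insert_of_ne (ne_of_mem_of_not_mem hi ha).symm, Finset.prod_insert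
      fun h => ha (Finset.mem_of_mem_erase h), mul_assoc]

variable {m : Type*} [Fintype m] [DecidableEq m]

theorem derivation_det (M : Matrix m m A) :
    D M.det = ∑ i, (M.updateCol i fun j => D (M j i)).det := by
  simp only [Matrix.det_apply, map_sum, Derivation.map_smul_of_tower, derivation_prod,
    Finset.smul_sum]
  rw [Finset.sum_comm]
  refine Finset.sum_congr rfl fun i _ => Finset.sum_congr rfl fun σ _ => ?_
  rw [← Finset.prod_erase_mul _ _ (Finset.mem_univ i), Matrix.updateCol_self]
  congr 2
  exact Finset.prod_congr rfl fun j hj => (Matrix.updateCol_ne (Finset.ne_of_mem_erase hj)).symm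

theorem derivation_det_of_eq_sum {M : Matrix m m A} {B : Matrix m m R}
    (hM : ∀ j i, D (M j i) = ∑ l, B l i • M j l) : D M.det = B.trace • M.det := by
  rw [derivation_det, Matrix.trace, Finset.sum_smul]
  refine Finset.sum_congr rfl fun i _ => ?_
  simp only [hM, Algebra.smul_def]
  exact Matrix.det_updateCol_sum M i fun l => algebraMap R A (B l i)

end Jacobi

section PolyRep

variable {n : ℕ}

/-- The polynomial functions on `n`-tuples of vectors of the dual of the vector representation. The
variable `(a, j)` stands for the basis vector `e_a` in the `j`-th component. -/
abbrev PolyRing (n : ℕ) := MvPolynomial (VecIdx n × Fin n) ℂ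

/-- The derivation of `PolyRing n` that extends the action of `X` on the variables. -/
def polyDer (X : Lie n) : Derivation ℂ (PolyRing n) (PolyRing n) :=
  MvPolynomial.mkDerivation ℂ fun p => ∑ b, X.1 b p.1 • MvPolynomial.X (b, p.2)

theorem polyDer_X (X : Lie n) (a : VecIdx n) (j : Fin n) :
    polyDer X (.X (a, j)) = ∑ b, X.1 b a • MvPolynomial.X (b, j) :=
  MvPolynomial.mkDerivation_X ..

variable (n) in
/-- The representation of the Lie algebra on `PolyRing n` by derivations. -/
def polyRep : Lie n →ₗ⁅ℂ⁆ Module.End ℂ (PolyRing n) where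
  toFun X := (polyDer X : PolyRing n →ₗ[ℂ] PolyRing n)
  map_add' X Y := by
    suffices polyDer (X + Y) = polyDer X + polyDer Y by rw [this]; rfl
    exact MvPolynomial.derivation_ext fun ⟨a, j⟩ => by
      simp [polyDer_X, add_smul, Finset.sum_add_distrib]
  map_smul' c X := by
    suffices polyDer (c • X) = c • polyDer X by rw [this]; rfl
    exact MvPolynomial.derivation_ext fun ⟨a, j⟩ => by
      simp [polyDer_X, Finset.smul_sum, smul_smul]
  map_lie' {X Y} := by
    suffices polyDer ⁅X, Y⁆ = ⁅polyDer X, polyDer Y⁆ by rw [this]; rfl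
    refine MvPolynomial.derivation_ext fun ⟨a, j⟩ => ?_
    simp only [polyDer_X, Derivation.commutator_apply, map_sum, Derivation.map_smul,
      LieSubalgebra.coe_bracket, Ring.lie_def, Matrix.sub_apply, Matrix.mul_apply, sub_smul,
      Finset.sum_sub_distrib, Finset.sum_smul, Finset.smul_sum, smul_smul]
    congr 1 <;> rw [Finset.sum_comm] <;>
      exact Finset.sum_congr rfl fun _ _ => Finset.sum_congr rfl fun _ _ => by rw [mul_comm]

theorem polyRep_apply (X : Lie n) (f : PolyRing n) : polyRep n X f = polyDer X f := rfl

theorem polyRep_mul (X : Lie n) (f g : PolyRing n) :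
    polyRep n X (f * g) = f * polyRep n X g + g * polyRep n X f := (polyDer X).leibniz f g

theorem exists_finiteDimensional_polyRep_stable (f : PolyRing n) :
    ∃ p : Submodule ℂ (PolyRing n),
      FiniteDimensional ℂ p ∧ (∀ X, ∀ w ∈ p, polyRep n X w ∈ p) ∧ f ∈ p := by
  induction f using MvPolynomial.induction_on with
  | C c =>
    refine ⟨1, Module.Finite.iff_fg.2 ⟨{1}, by simp [Submodule.one_eq_span]⟩, fun X w hw => ?_,
      Submodule.mem_one.2 ⟨c, rfl⟩⟩
    obtain ⟨a, rfl⟩ := Submodule.mem_one.1 hw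
    rw [polyRep_apply, Derivation.map_algebraMap]
    exact zero_mem _
  | add f g hf hg =>
    obtain ⟨p, _, hp, hfp⟩ := hf
    obtain ⟨r, _, hr, hgr⟩ := hg
    refine ⟨p ⊔ r, inferInstance, fun X => ?_,
      add_mem (Submodule.mem_sup_left hfp) (Submodule.mem_sup_right hgr)⟩
    change p ⊔ r ≤ (p ⊔ r).comap (polyRep n X)
    exact sup_le (fun w hw => Submodule.mem_sup_left (hp X w hw))
      fun w hw => Submodule.mem_sup_right (hr X w hw)
  | mul_X f i hf =>
    obtain ⟨p, hfin, hp, hfp⟩ := hf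
    set V : Submodule ℂ (PolyRing n) := Submodule.span ℂ (Set.range MvPolynomial.X)
    have mem_V (j) : MvPolynomial.X j ∈ V := Submodule.subset_span ⟨j, rfl⟩
    have stable_V (X : Lie n) : V ≤ V.comap (polyRep n X) := by
      refine Submodule.span_le.2 ?_
      rintro _ ⟨⟨a, j⟩, rfl⟩
      change polyDer X _ ∈ V
      rw [polyDer_X]
      exact Submodule.sum_mem _ fun b _ => Submodule.smul_mem _ _ (mem_V _)
    refine ⟨p * V, Module.Finite.iff_fg.2 (.mul (Module.Finite.iff_fg.1 hfin)
      (Submodule.fg_span (Set.finite_range _))), fun X => ?_, Submodule.mul_mem_mul hfp (mem_V i)⟩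
    change p * V ≤ (p * V).comap (polyRep n X)
    refine Submodule.mul_le.2 fun w hw v hv => ?_
    rw [Submodule.mem_comap, polyRep_mul, mul_comm v]
    exact add_mem (Submodule.mul_mem_mul hw (stable_V X hv))
      (Submodule.mul_mem_mul (hp X w hw) hv)

theorem isHighest_polyRep_one : IsHighest (polyRep n) 0 1 where
  mem := mem_wtSpace.2 fun i => by simp [polyRep_apply]
  apply_eq_zero X _ := (polyDer X).map_one_eq_zero

theorem IsHighest.mul {lam lam' : Fin n → ℤ} {f g : PolyRing n} (hf : IsHighest (polyRep n) lam f)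
    (hg : IsHighest (polyRep n) lam' g) : IsHighest (polyRep n) (lam + lam') (f * g) where
  mem := mem_wtSpace.2 fun i => by
    rw [polyRep_mul, mem_wtSpace.1 hf.mem, mem_wtSpace.1 hg.mem, mul_smul_comm, mul_smul_comm,
      mul_comm g, ← add_smul, Pi.add_apply, Int.cast_add, add_comm (lam i : ℂ)]
  apply_eq_zero X hX := by
    rw [polyRep_mul, hf.apply_eq_zero X hX, hg.apply_eq_zero X hX, mul_zero, mul_zero, add_zero]

theorem IsHighest.pow {lam : Fin n → ℤ} {f : PolyRing n} (hf : IsHighest (polyRep n) lam f)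
    (m : ℕ) : IsHighest (polyRep n) (m • lam) (f ^ m) := by
  induction m with
  | zero => simpa using isHighest_polyRep_one
  | succ m ih => rw [succ_nsmul, pow_succ]; exact ih.mul hf

theorem exists_lt_of_mem_posRootVectors {X : Lie n} (hX : X ∈ posRootVectors n) {b : VecIdx n}
    {i : Fin n} (h : X.1 b (.inr (.inl i)) ≠ 0) : ∃ j < i, b = .inr (.inl j) := by
  obtain ⟨α, hα, hX⟩ := hX
  have hpos := dotProduct_pos_of_mem_posRoots (rho_strictAnti n) rho_pos hα
  have hb := congrArg (rho n ⬝ᵥ ·) (hasWeights_incl.eq_add_of_apply_ne_zero hX _ _ h)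
  have hi := rho_pos i
  rcases b with b | b | b
  all_goals
    simp only [wt, Sum.elim_inl, Sum.elim_inr, Pi.zero_apply, eps, dotProduct_zero, dotProduct_neg,
      dotProduct_add, dotProduct_single_one] at hb
  · omega
  · exact ⟨b, (rho_strictAnti n).lt_iff_gt.1 (by omega), rfl⟩
  · have := rho_pos b
    omega

variable {s : ℕ} (hs : s ≤ n)

/-- The minor in the variables `(i, j)` with `i, j < s`. -/
def minor (hs : s ≤ n) : PolyRing n :=
  (Matrix.of fun j i : Fin s => MvPolynomial.X (.inr (.inl (i.castLE hs)), j.castLE hs)).det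

/-- The weight `ε_1 + ⋯ + ε_s`. -/
def columnWt (n s : ℕ) : Fin n → ℤ := fun i => if (i : ℕ) < s then 1 else 0

theorem minor_ne_zero : minor hs ≠ 0 := fun h => by
  have eval : MvPolynomial.eval (fun p : VecIdx n × Fin n => if p.1 = .inr (.inl p.2) then 1 else 0)
      (minor hs) = (1 : Matrix (Fin s) (Fin s) ℂ).det := by
    rw [minor, RingHom.map_det]
    congr 1
    ext j i
    simp [Matrix.one_apply, eq_comm]
  simp [h] at eval

theorem polyRep_minor {X : Lie n}
    (hX : ∀ (i : Fin n) b, X.1 b (.inr (.inl i)) ≠ 0 → ∃ j ≤ i, b = .inr (.inl j)) :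
    polyRep n X (minor hs) =
      (∑ i : Fin s, X.1 (.inr (.inl (i.castLE hs))) (.inr (.inl (i.castLE hs)))) • minor hs := by
  refine derivation_det_of_eq_sum (polyDer X) (B := .of fun l i : Fin s =>
    X.1 (.inr (.inl (l.castLE hs))) (.inr (.inl (i.castLE hs)))) fun j i => ?_
  simp only [Matrix.of_apply, polyDer_X]
  symm
  refine Finset.sum_of_injOn (fun l : Fin s => .inr (.inl (l.castLE hs))) ?_ (by simp) ?_
    (fun _ _ => rfl)
  · intro l _ l' _ h
    simpa using h
  · intro b _ hb
    by_contra h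
    obtain ⟨l, hl, rfl⟩ := hX (i.castLE hs) b (left_ne_zero_of_smul h)
    exact hb ⟨⟨l, (Fin.le_def.1 hl).trans_lt i.2⟩, by simp, rfl⟩

theorem isHighest_minor : IsHighest (polyRep n) (columnWt n s) (minor hs) where
  mem := mem_wtSpace.2 fun i => by
    rw [polyRep_minor hs fun j b hb => ⟨j, le_rfl, (by simpa [cartan_apply] using hb : _ ∧ _).1⟩]
    congr 1
    simp only [cartan_apply, if_true, wt, Sum.elim_inr, Sum.elim_inl, eps, columnWt, ← Int.cast_sum,
      Pi.single_apply]
    by_cases hi : (i : ℕ) < s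
    · obtain ⟨j, rfl⟩ : ∃ j : Fin s, j.castLE hs = i := ⟨⟨i, hi⟩, rfl⟩
      simp
    · rw [if_neg hi, Finset.sum_eq_zero]
      rintro j -
      exact_mod_cast if_neg fun h => hi (by simp [h])
  apply_eq_zero X hX := by
    rw [polyRep_minor hs fun i b hb => (exists_lt_of_mem_posRootVectors hX hb).imp
      fun j h => ⟨h.1.le, h.2⟩, Finset.sum_eq_zero, zero_smul]
    intro i _
    by_contra h
    obtain ⟨j, hj, h⟩ := exists_lt_of_mem_posRootVectors hX h
    exact hj.ne (Sum.inl_injective (Sum.inr_injective h)).symm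

theorem exists_isHighest_polyRep {lam : Fin n → ℤ} (hanti : Antitone lam) (h0 : ∀ i, 0 ≤ lam i) :
    ∃ f ≠ 0, IsHighest (polyRep n) lam f := by
  suffices ∀ s ≤ n, ∀ lam : Fin n → ℤ, Antitone lam → (∀ i, 0 ≤ lam i) →
      (∀ i : Fin n, s ≤ i → lam i = 0) → ∃ f ≠ 0, IsHighest (polyRep n) lam f from
    this n le_rfl lam hanti h0 fun i hi => absurd i.2 hi.not_gt
  intro s
  induction s with
  | zero =>
    intro _ lam _ _ hzero
    obtain rfl : lam = 0 := funext fun i => hzero i i.val.zero_le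
    exact ⟨1, one_ne_zero, isHighest_polyRep_one⟩
  | succ s ih =>
    intro hs lam hanti h0 hzero
    obtain ⟨m, hm⟩ := Int.eq_ofNat_of_zero_le (h0 ⟨s, hs⟩)
    have sub_apply (i : Fin n) :
        (lam - m • columnWt n (s + 1)) i = if (i : ℕ) < s then lam i - m else 0 := by
      have hi : (i : ℕ) = s → lam i = m := fun h => hm ▸ congrArg lam (Fin.ext h)
      have := hzero i
      rw [Pi.sub_apply, Pi.smul_apply, columnWt, nsmul_eq_mul, mul_ite, mul_one, mul_zero]
      split_ifs <;> omega
    have le_apply (i : Fin n) (hi : (i : ℕ) < s) : m ≤ lam i := hm ▸ hanti (Fin.le_def.2 hi.le)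
    have sub_antitone : Antitone (lam - m • columnWt n (s + 1)) := fun i j hij => by
      have := Fin.le_def.1 hij
      have := hanti hij
      have := le_apply i
      rw [sub_apply, sub_apply]
      split_ifs <;> omega
    have sub_nonneg (i : Fin n) : 0 ≤ (lam - m • columnWt n (s + 1)) i := by
      have := le_apply i
      rw [sub_apply]
      split_ifs <;> omega
    obtain ⟨f, hf0, hf⟩ := ih (Nat.le_of_succ_le hs) _ sub_antitone sub_nonneg fun i hi => by
      rw [sub_apply, if_neg hi.not_gt]
    refine ⟨f * minor hs ^ m, mul_ne_zero hf0 (pow_ne_zero _ (minor_ne_zero hs)), ?_⟩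
    simpa only [sub_add_cancel] using hf.mul ((isHighest_minor hs).pow m)

end PolyRep

theorem vermaGen_ne_zero_and_finiteDimensional_simple {n : ℕ} {lam : Fin n → ℤ}
    (hanti : Antitone lam) (h0 : ∀ i, 0 ≤ lam i) :
    vermaGen lam ≠ 0 ∧ FiniteDimensional ℂ (Simple lam) := by
  obtain ⟨f, hf0, hf⟩ := exists_isHighest_polyRep hanti h0
  let A : Env n →ₐ[ℂ] Module.End ℂ (PolyRing n) := UniversalEnvelopingAlgebra.lift ℂ (polyRep n)
  let _ : Module (Env n) (PolyRing n) := Module.compHom _ A.toRingHom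
  have : IsScalarTower ℂ (Env n) (PolyRing n) :=
    ⟨fun c u w => congrArg (fun B : Module.End ℂ (PolyRing n) => B w) (map_smul A c u)⟩
  have smul_eq (X : Lie n) (w : PolyRing n) : toEnv n X • w = polyRep n X w :=
    congrArg (fun B : Module.End ℂ (PolyRing n) => B w)
      (UniversalEnvelopingAlgebra.lift_ι_apply ℂ (polyRep n) X)
  have envRep_eq : envRep n (PolyRing n) = polyRep n :=
    LieHom.ext fun X => LinearMap.ext (smul_eq X)
  rw [← envRep_eq] at hf
  obtain ⟨p, _, hp, hfp⟩ := exists_finiteDimensional_polyRep_stable f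
  exact ⟨hf.vermaGen_ne_zero hf0,
    hf.finiteDimensional_simple hf0 (fun X w hw => smul_eq X w ▸ hp X w hw) hfp⟩

/-! ### Laurent polynomials and antisymmetry -/

section Laurent

/-- The group algebra over `R` of the lattice spanned by the `ε_i`. -/
abbrev Laurent (R : Type*) [CommRing R] (n : ℕ) := AddMonoidAlgebra R (Fin n → ℤ)

variable (R : Type*) [CommRing R] {n : ℕ}

/-- The unit `e^{ε_i}` of the group algebra. -/
def xU (i : Fin n) : (Laurent R n)ˣ :=
  (AddMonoidAlgebra.of R (Fin n → ℤ)).toHomUnits (Multiplicative.ofAdd (eps i))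

theorem val_xU (i : Fin n) : (xU R i : Laurent R n) = AddMonoidAlgebra.single (eps i) 1 := rfl

theorem val_xU_zpow (i : Fin n) (m : ℤ) :
    ((xU R i ^ m : (Laurent R n)ˣ) : Laurent R n) = AddMonoidAlgebra.single (m • eps i) 1 := by
  rw [xU, ← map_zpow, ← ofAdd_zsmul]
  rfl

theorem val_xU_inv (i : Fin n) :
    (((xU R i)⁻¹ : (Laurent R n)ˣ) : Laurent R n) = AddMonoidAlgebra.single (-eps i) 1 := by
  simpa using val_xU_zpow R i (-1)

/-- The image of the exponent `l` under a sign change, in the shifted coordinates of `alt`: one of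
`l` and `1 - l`. -/
def flip (l : ℤ) (s : ℤˣ) : ℤ := if s = 1 then l else 1 - l

/-- The exponent of the monomial of the alternant `alt x l` that belongs to the signed permutation
`(σ, p)`. -/
def altExp (l : Fin n → ℤ) (σ : Equiv.Perm (Fin n)) (p : Fin n → ℤˣ) : Fin n → ℤ :=
  fun a => flip (l (σ.symm a)) (p (σ.symm a))

theorem altEntry_xU (i : Fin n) (m : ℤ) : altEntry (xU R i) m =
    ∑ s : ℤˣ, AddMonoidAlgebra.single (flip m s • eps i) ((s : ℤ) : R) := by
  simp [altEntry, val_xU_zpow, flip, UnitsInt.univ, AddMonoidAlgebra.single_neg, ← sub_eq_add_neg]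

theorem sum_zsmul_eps (c : Fin n → ℤ) : ∑ i, c i • eps i = c := by
  ext k
  simp [eps, Finset.sum_apply, Pi.single_apply]

theorem alt_xU_eq_sum (l : Fin n → ℤ) : alt (xU R) l =
    ∑ σ : Equiv.Perm (Fin n), ∑ p : Fin n → ℤˣ, AddMonoidAlgebra.single (altExp l σ p)
      (((Equiv.Perm.sign σ : ℤ) : R) * ∏ i, ((p i : ℤ) : R)) := by
  have sum_flip (σ : Equiv.Perm (Fin n)) (p : Fin n → ℤˣ) :
      ∑ i, flip (l i) (p i) • eps (σ i) = altExp l σ p := by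
    rw [← sum_zsmul_eps (altExp l σ p), ← Equiv.sum_comp σ fun a => altExp l σ p a • eps a]
    simp [altExp]
  rw [alt, Matrix.det_apply]
  simp only [Matrix.of_apply, altEntry_xU, Finset.prod_univ_sum, Fintype.piFinset_univ,
    AddMonoidAlgebra.prod_single, sum_flip, Finset.smul_sum, Units.smul_def,
    AddMonoidAlgebra.smul_single]
  simp only [zsmul_eq_mul]

theorem coeff_alt (l ν : Fin n → ℤ) : (alt (xU R) l).coeff ν =
    ∑ σ : Equiv.Perm (Fin n), ∑ p : Fin n → ℤˣ, if altExp l σ p = ν then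
      (((Equiv.Perm.sign σ : ℤ) : R) * ∏ i, ((p i : ℤ) : R)) else 0 := by
  simp only [alt_xU_eq_sum, AddMonoidAlgebra.coeff_sum, Finsupp.finsetSum_apply,
    AddMonoidAlgebra.coeff_single, Finsupp.single_apply]

/-- The norm `|ν|²` of a weight in the shifted coordinates of `alt`, up to a constant. -/
def quad (ν : Fin n → ℤ) : ℤ := ∑ i, (ν i * ν i - ν i)

theorem quad_altExp (l : Fin n → ℤ) (σ : Equiv.Perm (Fin n)) (p : Fin n → ℤˣ) :
    quad (altExp l σ p) = quad l := by
  have mul_self_sub_flip (m : ℤ) (s : ℤˣ) : flip m s * flip m s - flip m s = m * m - m := by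
    unfold flip
    split_ifs <;> ring
  simp only [quad, altExp, mul_self_sub_flip]
  exact Equiv.sum_comp σ.symm fun i => l i * l i - l i

theorem quad_eq_of_coeff_alt_ne_zero {l ν : Fin n → ℤ} (h : (alt (xU R) l).coeff ν ≠ 0) :
    quad ν = quad l := by
  contrapose! h
  rw [coeff_alt]
  refine Finset.sum_eq_zero fun σ _ => Finset.sum_eq_zero fun p _ => if_neg ?_
  rintro rfl
  exact h (quad_altExp l σ p)

theorem eq_one_of_altExp_dominant {l : Fin n → ℤ} {σ : Equiv.Perm (Fin n)} {p : Fin n → ℤˣ}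
    (hl : StrictAnti l) (hl1 : ∀ i, 1 ≤ l i) (h : StrictAnti (altExp l σ p))
    (h1 : ∀ i, 1 ≤ altExp l σ p i) : σ = 1 ∧ p = 1 := by
  obtain rfl : p = 1 := by
    ext1 i
    by_contra hp
    rw [Pi.one_apply] at hp
    have := h1 (σ i)
    rw [altExp, Equiv.symm_apply_apply, flip, if_neg hp] at this
    have := hl1 i
    omega
  have hσ : StrictMono σ.symm := fun i j hij => hl.lt_iff_gt.1 (h hij)
  exact ⟨inv_eq_one.1 ((Equiv.Perm.monotone_iff _).1 hσ.monotone), rfl⟩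

theorem altExp_one_one (l : Fin n → ℤ) : altExp l 1 1 = l := by
  ext a
  simp [altExp, flip, ← Equiv.Perm.inv_def]

theorem coeff_alt_dominant {l ν : Fin n → ℤ} (hl : StrictAnti l) (hl1 : ∀ i, 1 ≤ l i)
    (hν : StrictAnti ν) (hν1 : ∀ i, 1 ≤ ν i) :
    (alt (xU R) l).coeff ν = if l = ν then 1 else 0 := by
  have eq_one {σ p} (h : altExp l σ p = ν) : σ = 1 ∧ p = 1 :=
    eq_one_of_altExp_dominant hl hl1 (h ▸ hν) (h ▸ hν1)
  rw [coeff_alt, Finset.sum_eq_single 1, Finset.sum_eq_single 1]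
  · simp [altExp_one_one]
  · exact fun p _ hp => if_neg fun h => hp (eq_one h).2
  · simp
  · exact fun σ _ hσ => Finset.sum_eq_zero fun p _ => if_neg fun h => hσ (eq_one h).1
  · simp

/-- The permutation of two coordinates of the weight lattice. -/
def swapWt (i j : Fin n) : (Fin n → ℤ) ≃+ (Fin n → ℤ) where
  toFun ν := ν ∘ Equiv.swap i j
  invFun ν := ν ∘ Equiv.swap i j
  left_inv ν := by ext; simp
  right_inv ν := by ext; simp
  map_add' _ _ := rfl

/-- The change of sign of a coordinate of the weight lattice. -/
def negWt (i : Fin n) : (Fin n → ℤ) ≃+ (Fin n → ℤ) where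
  toFun ν := Function.update ν i (-ν i)
  invFun ν := Function.update ν i (-ν i)
  left_inv ν := by simp
  right_inv ν := by simp
  map_add' μ ν := by rw [Pi.add_apply, neg_add, Function.update_add]

theorem swapWt_eps (i j k : Fin n) : swapWt i j (eps k) = eps (Equiv.swap i j k) := by
  ext a
  simp [swapWt, eps, Pi.single_apply, Equiv.swap_apply_eq_iff]

theorem negWt_eps (i k : Fin n) :
    negWt i (eps k) = if k = i then -eps k else eps k := by
  ext a
  rcases eq_or_ne k i with rfl | hk <;> rcases eq_or_ne a k with rfl | ha <;>
    simp_all [negWt, eps, Function.update_apply]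

variable {R}

/-- A Laurent polynomial that behaves like the alternants `alt x l` under the Weyl group. -/
structure IsAntisymm (f : Laurent R n) : Prop where
  swap : ∀ i j, i ≠ j → AddMonoidAlgebra.domCongr R R (swapWt i j) f = -f
  neg : ∀ i, AddMonoidAlgebra.domCongr R R (negWt i) f = -((xU R i)⁻¹ : (Laurent R n)ˣ) * f

/-- Invariance under the Weyl group. -/
structure IsSymm (f : Laurent R n) : Prop where
  swap : ∀ i j, AddMonoidAlgebra.domCongr R R (swapWt i j) f = f
  neg : ∀ i, AddMonoidAlgebra.domCongr R R (negWt i) f = f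

theorem domCongr_alt (e : (Fin n → ℤ) ≃+ (Fin n → ℤ)) {y : Fin n → (Laurent R n)ˣ}
    (hy : ∀ k, (y k : Laurent R n) = AddMonoidAlgebra.single (e (eps k)) 1) (l : Fin n → ℤ) :
    AddMonoidAlgebra.domCongr R R e (alt (xU R) l) = alt y l := by
  refine (map_alt (AddMonoidAlgebra.domCongr R R e : Laurent R n →+* Laurent R n) _ l).trans ?_
  congr 1
  ext1 k
  exact Units.ext ((AddMonoidAlgebra.domCongr_single (R := R) e _ _).trans (hy k).symm)

theorem isAntisymm_alt (l : Fin n → ℤ) : IsAntisymm (alt (xU R) l) where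
  swap i j hij := by
    rw [domCongr_alt (y := xU R ∘ Equiv.swap i j) _ (fun k => by rw [swapWt_eps]; rfl),
      alt_perm_comp, Equiv.Perm.sign_swap hij]
    simp
  neg i := by
    rw [domCongr_alt (y := Function.update (xU R) i (xU R i)⁻¹), alt_update_inv]
    intro k
    rw [negWt_eps]
    rcases eq_or_ne k i with rfl | hk
    · rw [Function.update_self, if_pos rfl, val_xU_inv]
    · rw [Function.update_of_ne hk, if_neg hk, val_xU]

namespace IsAntisymm

variable {f g : Laurent R n}

theorem sub (hf : IsAntisymm f) (hg : IsAntisymm g) : IsAntisymm (f - g) where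
  swap i j hij := by rw [map_sub, hf.swap i j hij, hg.swap i j hij]; ring
  neg i := by rw [map_sub, hf.neg i, hg.neg i]; ring

theorem mul_isSymm (hf : IsAntisymm f) (hg : IsSymm g) : IsAntisymm (f * g) where
  swap i j hij := by rw [map_mul, hf.swap i j hij, hg.swap i j]; ring
  neg i := by rw [map_mul, hf.neg i, hg.neg i]; ring

theorem coeff_comp_swap (hf : IsAntisymm f) {i j : Fin n} (hij : i ≠ j) (ν : Fin n → ℤ) :
    f.coeff (ν ∘ Equiv.swap i j) = -f.coeff ν := by
  have h := congrArg (fun g : Laurent R n => g.coeff ν) (hf.swap i j hij)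
  simp only [AddMonoidAlgebra.coeff_domCongr, AddMonoidAlgebra.coeff_neg, Finsupp.neg_apply] at h
  exact h

theorem coeff_update_one_sub (hf : IsAntisymm f) (i : Fin n) (ν : Fin n → ℤ) :
    f.coeff (Function.update ν i (1 - ν i)) = -f.coeff ν := by
  have h := congrArg (fun g : Laurent R n => g.coeff (ν - eps i)) (hf.neg i)
  simp only [AddMonoidAlgebra.coeff_domCongr, neg_mul, AddMonoidAlgebra.coeff_neg,
    Finsupp.neg_apply, val_xU_inv, AddMonoidAlgebra.coeff_single_mul_apply, neg_neg,
    add_sub_cancel, one_mul] at h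
  rw [← h]
  congr 1
  change _ = Function.update (ν - eps i) i (-(ν - eps i) i)
  ext k
  rcases eq_or_ne k i with rfl | hk
  · simp [eps]
  · simp [hk, eps]

theorem one_le_of_maximal (hf : IsAntisymm f) {ν : Fin n → ℤ} (hν : f.coeff ν ≠ 0)
    (hmax : ∀ μ, f.coeff μ ≠ 0 → rho n ⬝ᵥ μ ≤ rho n ⬝ᵥ ν) (i : Fin n) : 1 ≤ ν i := by
  by_contra! hi
  have hle := hmax (Function.update ν i (1 - ν i)) (by rwa [hf.coeff_update_one_sub, neg_ne_zero])
  have hupdate : Function.update ν i (1 - ν i) = ν + Pi.single i (1 - 2 * ν i) := by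
    ext k
    rcases eq_or_ne k i with rfl | hk
    · simp; ring
    · simp [hk]
  have hpos : 0 < rho n i * (1 - 2 * ν i) := mul_pos (rho_pos i) (by omega)
  rw [hupdate, dotProduct_add, dotProduct_single] at hle
  omega

theorem strictAnti_of_maximal [NoZeroDivisors R] [CharZero R] (hf : IsAntisymm f)
    {ν : Fin n → ℤ} (hν : f.coeff ν ≠ 0)
    (hmax : ∀ μ, f.coeff μ ≠ 0 → rho n ⬝ᵥ μ ≤ rho n ⬝ᵥ ν) : StrictAnti ν := by
  intro i j hij
  have hswap : ν ∘ Equiv.swap i j = ν + Pi.single i (ν j - ν i) + Pi.single j (ν i - ν j) := by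
    ext k
    rcases eq_or_ne k i with rfl | hi
    · simp [hij.ne]
    · rcases eq_or_ne k j with rfl | hj
      · simp [hi]
      · simp [hi, hj, Equiv.swap_apply_of_ne_of_ne]
  by_contra! hle
  rcases hle.eq_or_lt with heq | hlt
  · have := hf.coeff_comp_swap hij.ne ν
    rw [hswap, heq, sub_self, Pi.single_zero, Pi.single_zero, add_zero, add_zero] at this
    exact hν (self_eq_neg.1 this)
  · have hle := hmax _ (by rwa [hf.coeff_comp_swap hij.ne, neg_ne_zero])
    rw [hswap, dotProduct_add, dotProduct_add, dotProduct_single, dotProduct_single] at hle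
    have hpos : 0 < (rho n i - rho n j) * (ν j - ν i) :=
      mul_pos (sub_pos.2 (rho_strictAnti n hij)) (sub_pos.2 hlt)
    linarith

theorem eq_zero [NoZeroDivisors R] [CharZero R] (hf : IsAntisymm f)
    (hdom : ∀ ν, StrictAnti ν → (∀ i, 1 ≤ ν i) → f.coeff ν = 0) : f = 0 := by
  by_contra hf0
  have hne : f.coeff.support.Nonempty := by
    rw [Finsupp.support_nonempty_iff]
    simpa using hf0
  obtain ⟨ν, hν, hmax⟩ := Finset.exists_max_image f.coeff.support (rho n ⬝ᵥ ·) hne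
  simp only [Finsupp.mem_support_iff] at hν hmax
  exact hν (hdom ν (hf.strictAnti_of_maximal hν hmax) (hf.one_le_of_maximal hν hmax))

end IsAntisymm

end Laurent

/-! ### Formal exponentials and derivations -/

section FormalExp

variable {K : Type*} [Field K] {n : ℕ}

theorem fexp_add (μ ν : Fin n → ℤ) : fexp K (μ + ν) = fexp K μ * fexp K ν := by
  rw [fexp, fexp, fexp, ← map_mul, AddMonoidAlgebra.single_mul_single, one_mul]

theorem fexp_zero : fexp K (0 : Fin n → ℤ) = 1 := map_one _

theorem fexp_injective : Function.Injective (fexp K : (Fin n → ℤ) → CharField K n) :=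
  (IsFractionRing.injective (AddMonoidAlgebra K (Fin n → ℤ)) (CharField K n)).comp
    (AddMonoidAlgebra.of_injective (R := K))

theorem fexp_neg (μ : Fin n → ℤ) : fexp K (-μ) = (fexp K μ)⁻¹ :=
  eq_inv_of_mul_eq_one_left (by rw [← fexp_add, neg_add_cancel, fexp_zero])

theorem fexp_ne_zero (μ : Fin n → ℤ) : fexp K μ ≠ 0 :=
  left_ne_zero_of_mul_eq_one (b := fexp K (-μ)) (by rw [← fexp_add, add_neg_cancel, fexp_zero])

theorem fexp_ne_one {μ : Fin n → ℤ} (h : μ ≠ 0) : fexp K μ ≠ 1 :=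
  fexp_zero (K := K) ▸ fexp_injective.ne h

theorem eps_ne_zero (i : Fin n) : (eps i : Fin n → ℤ) ≠ 0 := by simp [eps]

theorem eps_injective : Function.Injective (eps : Fin n → Fin n → ℤ) := fun i j h => by
  by_contra hne
  simpa [eps, hne] using congrFun h i

theorem eps_add_eps_ne_zero (i j : Fin n) : (eps i + eps j : Fin n → ℤ) ≠ 0 := fun h => by
  have := congrFun h i
  simp only [eps, Pi.add_apply, Pi.single_apply, Pi.zero_apply] at this
  split_ifs at this <;> omega

theorem fexp_eps_mul_fexp_eps_ne_one (i j : Fin n) : fexp K (eps i) * fexp K (eps j) ≠ 1 := by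
  rw [← fexp_add]
  exact fexp_ne_one (eps_add_eps_ne_zero i j)

end FormalExp

section LogDerivative

variable {n : ℕ} {k : Fin n}

/-- The linear map with `e^μ ↦ μ_k e^μ`. -/
def derLinear (k : Fin n) : Laurent ℂ n →ₗ[ℂ] Laurent ℂ n :=
  (Finsupp.lsum ℂ fun μ : Fin n → ℤ =>
    (μ k : ℂ) • AddMonoidAlgebra.lsingle (R := ℂ) (S := ℂ) μ).comp
      (AddMonoidAlgebra.coeffLinearEquiv ℂ).toLinearMap

theorem derLinear_single (k : Fin n) (μ : Fin n → ℤ) (c : ℂ) :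
    derLinear k (AddMonoidAlgebra.single μ c) = AddMonoidAlgebra.single μ ((μ k : ℂ) * c) := by
  change Finsupp.lsum ℂ _ (Finsupp.single μ c) = _
  rw [Finsupp.lsum_single, LinearMap.smul_apply, AddMonoidAlgebra.lsingle_apply,
    AddMonoidAlgebra.smul_single, smul_eq_mul]

/-- The derivation `∂_k` of the group algebra with `∂_k e^μ = μ_k e^μ`. -/
def der (k : Fin n) : Derivation ℂ (Laurent ℂ n) (Laurent ℂ n) :=
  Derivation.mk' (derLinear k) fun f g => by
    induction f using AddMonoidAlgebra.induction_linear with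
    | zero => simp
    | add f f' hf hf' => simp only [add_mul, map_add, hf, hf', add_smul, smul_add]; abel
    | single μ c =>
      induction g using AddMonoidAlgebra.induction_linear with
      | zero => simp
      | add g g' hg hg' => simp only [mul_add, map_add, hg, hg', add_smul, smul_add]; abel
      | single ν d =>
        simp only [AddMonoidAlgebra.single_mul_single, smul_eq_mul, derLinear_single,
          add_comm ν μ, ← AddMonoidAlgebra.single_add, Pi.add_apply, Int.cast_add]
        congr 1
        ring

theorem der_single (k : Fin n) (μ : Fin n → ℤ) (c : ℂ) :
    der k (AddMonoidAlgebra.single μ c) = AddMonoidAlgebra.single μ ((μ k : ℂ) * c) :=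
  derLinear_single k μ c

theorem coeff_der (k : Fin n) (f : Laurent ℂ n) (μ : Fin n → ℤ) :
    (der k f).coeff μ = (μ k : ℂ) * f.coeff μ := by
  induction f using AddMonoidAlgebra.induction_linear with
  | zero => simp
  | add f g hf hg => simp [hf, hg, mul_add]
  | single ν c =>
    rw [der_single, AddMonoidAlgebra.coeff_single, AddMonoidAlgebra.coeff_single,
      Finsupp.single_apply, Finsupp.single_apply]
    split_ifs with h
    · rw [h]
    · rw [mul_zero]

theorem der_xU_self (k : Fin n) : der k (xU ℂ k : Laurent ℂ n) = xU ℂ k := by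
  simp [val_xU, der_single, eps]

theorem der_xU_inv_self (k : Fin n) : der k (((xU ℂ k)⁻¹ : (Laurent ℂ n)ˣ) : Laurent ℂ n) =
    -(((xU ℂ k)⁻¹ : (Laurent ℂ n)ˣ) : Laurent ℂ n) := by
  simp [val_xU_inv, der_single, eps, AddMonoidAlgebra.single_neg]

theorem der_xU_zpow_of_ne {i : Fin n} (h : i ≠ k) (m : ℤ) :
    der k ((xU ℂ i ^ m : (Laurent ℂ n)ˣ) : Laurent ℂ n) = 0 := by
  simp [val_xU_zpow, der_single, eps, h.symm]

theorem der_alt_of_forall_ne {m : ℕ} {ι : Fin m → Fin n} (h : ∀ i, ι i ≠ k) (l : Fin m → ℤ) :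
    der k (alt (xU ℂ ∘ ι) l) = 0 := by
  have := derivation_det_of_eq_sum (der k) (B := (0 : Matrix (Fin m) (Fin m) ℂ))
    (M := .of fun i j => altEntry (xU ℂ (ι i)) (l j)) fun i j => by
      simp [altEntry, der_xU_zpow_of_ne (h i)]
  rwa [Matrix.trace_zero, zero_smul] at this

/-- The embedding of the Laurent polynomials into their field of fractions. -/
abbrev toFrac (n : ℕ) : Laurent ℂ n →+* CharField ℂ n := algebraMap _ _

theorem toFrac_injective (n : ℕ) : Function.Injective (toFrac n) := IsFractionRing.injective _ _

theorem toFrac_xU (i : Fin n) : toFrac n (xU ℂ i) = fexp ℂ (eps i) := rfl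

theorem toFrac_xU_inv (i : Fin n) :
    toFrac n ((xU ℂ i)⁻¹ : (Laurent ℂ n)ˣ) = (fexp ℂ (eps i))⁻¹ := by
  rw [val_xU_inv, ← fexp_neg, fexp]

/-- `s` is a logarithmic derivative `∂_k f / f` of `f`. -/
def HasLogDer (k : Fin n) (f : Laurent ℂ n) (s : CharField ℂ n) : Prop :=
  toFrac n (der k f) = s * toFrac n f

theorem HasLogDer.mul {f g : Laurent ℂ n} {s t : CharField ℂ n}
    (hf : HasLogDer k f s) (hg : HasLogDer k g t) : HasLogDer k (f * g) (s + t) := by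
  unfold HasLogDer at *
  rw [Derivation.leibniz, map_add, smul_eq_mul, smul_eq_mul, map_mul, map_mul, map_mul, hf, hg]
  ring

theorem HasLogDer.prod {ι : Type*} (S : Finset ι) {f : ι → Laurent ℂ n} {s : ι → CharField ℂ n}
    (h : ∀ i ∈ S, HasLogDer k (f i) (s i)) : HasLogDer k (∏ i ∈ S, f i) (∑ i ∈ S, s i) := by
  classical
  induction S using Finset.induction_on with
  | empty => simp [HasLogDer]
  | insert a S ha ih =>
    rw [Finset.prod_insert ha, Finset.sum_insert ha]
    exact (h a (Finset.mem_insert_self a S)).mul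
      (ih fun i hi => h i (Finset.mem_insert_of_mem hi))

theorem hasLogDer_zero_of_der_eq_zero {f : Laurent ℂ n} (hf : der k f = 0) : HasLogDer k f 0 := by
  rw [HasLogDer, hf, map_zero, zero_mul]

theorem hasLogDer_xU_sub_one (k : Fin n) :
    HasLogDer k ((xU ℂ k : Laurent ℂ n) - 1) (fexp ℂ (eps k) / (fexp ℂ (eps k) - 1)) := by
  rw [HasLogDer, map_sub, Derivation.map_one_eq_zero, sub_zero, der_xU_self, map_sub, toFrac_xU,
    map_one, div_mul_cancel₀ _ (sub_ne_zero.2 (fexp_ne_one (eps_ne_zero k)))]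

section Scalar

variable {F : Type*} [Field F] {y z : F}

theorem add_inv_sub_add_inv (hy : y ≠ 0) (hz : z ≠ 0) :
    y + y⁻¹ - (z + z⁻¹) = (y - z) * (y * z - 1) / (y * z) := by
  field_simp
  ring

theorem add_inv_sub_add_inv_ne_zero (hy : y ≠ 0) (hz : z ≠ 0) (hyz : y ≠ z) (hyz' : y * z ≠ 1) :
    y + y⁻¹ - (z + z⁻¹) ≠ 0 := by
  rw [add_inv_sub_add_inv hy hz]
  exact div_ne_zero (mul_ne_zero (sub_ne_zero.2 hyz) (sub_ne_zero.2 hyz')) (mul_ne_zero hy hz)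

theorem add_one_div_sub_one (hy : y ≠ 1) : (y + 1) / (y - 1) = 2 * (y / (y - 1)) - 1 := by
  have := sub_ne_zero.2 hy
  field_simp
  ring

theorem add_one_div_sub_one_add (hy : y ≠ 0) (hz : z ≠ 0) (hyz : y ≠ z) (hyz' : y * z ≠ 1) :
    (y * z + 1) / (y * z - 1) + (y * z⁻¹ + 1) / (y * z⁻¹ - 1) =
      2 * ((y - y⁻¹) / (y + y⁻¹ - (z + z⁻¹))) := by
  have h₁ := sub_ne_zero.2 hyz'
  have h₂ := sub_ne_zero.2 hyz
  have h₃ : (y * z⁻¹ + 1) / (y * z⁻¹ - 1) = (y + z) / (y - z) := by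
    rw [← mul_div_mul_right _ _ hz, add_mul, sub_mul, inv_mul_cancel_right₀ hz, one_mul]
  rw [h₃, add_inv_sub_add_inv hy hz]
  field_simp
  ring

end Scalar

theorem hasLogDer_xU_add_inv_sub {j : Fin n} (h : j ≠ k) :
    HasLogDer k ((xU ℂ k : Laurent ℂ n) + ((xU ℂ k)⁻¹ : (Laurent ℂ n)ˣ) -
        ((xU ℂ j : Laurent ℂ n) + ((xU ℂ j)⁻¹ : (Laurent ℂ n)ˣ)))
      ((fexp ℂ (eps k) - (fexp ℂ (eps k))⁻¹) /
        (fexp ℂ (eps k) + (fexp ℂ (eps k))⁻¹ - (fexp ℂ (eps j) + (fexp ℂ (eps j))⁻¹))) := by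
  have der_j : der k ((xU ℂ j : Laurent ℂ n) + ((xU ℂ j)⁻¹ : (Laurent ℂ n)ˣ)) = 0 := by
    simpa using congrArg₂ (· + ·) (der_xU_zpow_of_ne h 1) (der_xU_zpow_of_ne h (-1))
  have hne := add_inv_sub_add_inv_ne_zero (fexp_ne_zero (K := ℂ) (eps k)) (fexp_ne_zero (eps j))
    (fexp_injective.ne (eps_injective.ne h.symm)) (fexp_eps_mul_fexp_eps_ne_one k j)
  simp only [HasLogDer, map_sub, map_add _ (xU ℂ k : Laurent ℂ n), der_j, der_xU_self,
    der_xU_inv_self, sub_zero, ← sub_eq_add_neg, map_add, toFrac_xU, toFrac_xU_inv]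
  exact (div_mul_cancel₀ _ hne).symm

theorem hasLogDer_alt_rho (k : Fin (n + 1)) : HasLogDer k (alt (xU ℂ) (rho (n + 1)))
    (fexp ℂ (eps k) / (fexp ℂ (eps k) - 1) + ∑ j : Fin n,
      (fexp ℂ (eps k) - (fexp ℂ (eps k))⁻¹) / (fexp ℂ (eps k) + (fexp ℂ (eps k))⁻¹ -
        (fexp ℂ (eps (k.succAbove j)) + (fexp ℂ (eps (k.succAbove j)))⁻¹))) := by
  have h_sign : HasLogDer k ((-1) ^ (k : ℕ) : Laurent ℂ (n + 1)) 0 :=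
    hasLogDer_zero_of_der_eq_zero (by simp [Derivation.leibniz_pow])
  have h_rest := hasLogDer_zero_of_der_eq_zero
    (der_alt_of_forall_ne (fun j => Fin.succAbove_ne k j) (rho n))
  have h_alt : alt (xU ℂ) (rho (n + 1)) =
      (-1) ^ (k : ℕ) * alt (Fin.cons (xU ℂ k) (xU ℂ ∘ k.succAbove)) (rho (n + 1)) := by
    rw [alt_cons_succAbove, ← mul_assoc, ← mul_pow, neg_one_mul, neg_neg, one_pow, one_mul]
  rw [h_alt, alt_cons_rho]
  have h_prod := HasLogDer.prod Finset.univ fun j _ =>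
    hasLogDer_xU_add_inv_sub (Fin.succAbove_ne k j)
  simpa only [Function.comp_apply, zero_add, add_zero] using
    h_sign.mul (((hasLogDer_xU_sub_one k).mul h_prod).mul h_rest)

/-- The roots `α` with `α_k = 1` are the `ε_k + wt c` with `wt c k = 0`. -/
theorem sum_add_one_div_sub_one (k : Fin (n + 1)) :
    ∑ c : VecIdx (n + 1) with wt c k = 0,
        (fexp ℂ (eps k + wt c) + 1) / (fexp ℂ (eps k + wt c) - 1) =
      2 * (fexp ℂ (eps k) / (fexp ℂ (eps k) - 1) + ∑ j : Fin n,
        (fexp ℂ (eps k) - (fexp ℂ (eps k))⁻¹) / (fexp ℂ (eps k) + (fexp ℂ (eps k))⁻¹ -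
          (fexp ℂ (eps (k.succAbove j)) + (fexp ℂ (eps (k.succAbove j)))⁻¹))) - 1 := by
  have eps_self : eps k k = 1 := Pi.single_eq_same k 1
  have eps_succAbove (j : Fin n) : eps (k.succAbove j) k = 0 :=
    Pi.single_eq_of_ne (Fin.succAbove_ne k j).symm 1
  rw [Finset.sum_filter, Fintype.sum_sum_type, Fintype.sum_sum_type]
  simp only [wt, Sum.elim_inl, Sum.elim_inr,
    Pi.zero_apply, Pi.neg_apply, Fin.sum_univ_succAbove _ k, eps_self, eps_succAbove, neg_eq_zero,
    one_ne_zero, if_true, if_false, zero_add, add_zero, Finset.univ_unique, Finset.sum_singleton,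
    ← Finset.sum_add_distrib, fexp_add, fexp_neg]
  rw [add_one_div_sub_one (fexp_ne_one (eps_ne_zero k)), mul_add, Finset.mul_sum,
    add_sub_right_comm]
  congr 1
  exact Finset.sum_congr rfl fun j _ => add_one_div_sub_one_add (fexp_ne_zero _) (fexp_ne_zero _)
    (fexp_injective.ne (eps_injective.ne (Fin.succAbove_ne k j).symm))
    (fexp_eps_mul_fexp_eps_ne_one k _)

theorem sum_add_one_div_sub_one_mul_alt_rho (k : Fin n) :
    (∑ c : VecIdx n with wt c k = 0,
      (fexp ℂ (eps k + wt c) + 1) / (fexp ℂ (eps k + wt c) - 1)) *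
        toFrac n (alt (xU ℂ) (rho n)) =
      2 * toFrac n (der k (alt (xU ℂ) (rho n))) - toFrac n (alt (xU ℂ) (rho n)) := by
  cases n with
  | zero => exact k.elim0
  | succ n =>
    rw [sum_add_one_div_sub_one, hasLogDer_alt_rho k]
    ring

end LogDerivative

/-! ### The Casimir element and the Laplacian -/

section Laplacian

variable {n : ℕ}

/-- The operator `∑ k, ∂_k² - ∂_k`, for which `e^μ` has the eigenvalue `quad μ`. -/
def laplacian (f : Laurent ℂ n) : Laurent ℂ n := ∑ k, (der k (der k f) - der k f)

theorem coeff_laplacian (f : Laurent ℂ n) (μ : Fin n → ℤ) :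
    (laplacian f).coeff μ = (quad μ : ℂ) * f.coeff μ := by
  simp only [laplacian, AddMonoidAlgebra.coeff_sum, Finsupp.finsetSum_apply,
    AddMonoidAlgebra.coeff_sub, Finsupp.sub_apply, coeff_der, quad, Int.cast_sum, Finset.sum_mul,
    Int.cast_sub, Int.cast_mul]
  exact Finset.sum_congr rfl fun k _ => by ring

theorem laplacian_mul (f g : Laurent ℂ n) : laplacian (f * g) =
    f * ∑ k, der k (der k g) + ∑ k, (2 * der k f - f) * der k g + laplacian f * g := by
  simp only [laplacian, Finset.mul_sum, Finset.sum_mul, ← Finset.sum_add_distrib]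
  refine Finset.sum_congr rfl fun k _ => ?_
  simp only [Derivation.leibniz, map_add, smul_eq_mul]
  ring

theorem laplacian_alt (l : Fin n → ℤ) :
    laplacian (alt (xU ℂ) l) = (quad l : ℂ) • alt (xU ℂ) l := by
  apply AddMonoidAlgebra.ext
  ext μ
  rw [coeff_laplacian, AddMonoidAlgebra.coeff_smul, Finsupp.smul_apply, smul_eq_mul]
  by_cases h : (alt (xU ℂ) l).coeff μ = 0
  · rw [h, mul_zero, mul_zero]
  · rw [quad_eq_of_coeff_alt_ne_zero ℂ h]

end Laplacian

section FormalTrace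

variable {n : ℕ} {ι : Type*} [Fintype ι]

/-- The formal trace `∑ i, X i i e^(w i)` of a matrix whose rows are graded by the weights `w`. -/
def ftr (w : ι → Fin n → ℤ) : Matrix ι ι ℂ →ₗ[ℂ] Laurent ℂ n :=
  ∑ i, AddMonoidAlgebra.lsingle (R := ℂ) (S := ℂ) (w i) ∘ₗ Matrix.entryLinearMap ℂ ℂ i i

theorem ftr_apply (w : ι → Fin n → ℤ) (X : Matrix ι ι ℂ) :
    ftr w X = ∑ i, AddMonoidAlgebra.single (w i) (X i i) := by
  simp [ftr]

/-- The formal character `∑ i, e^(w i)` of a family of weights. -/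
def fchar (w : ι → Fin n → ℤ) : Laurent ℂ n := ∑ i, AddMonoidAlgebra.single (w i) 1

theorem ftr_one [DecidableEq ι] (w : ι → Fin n → ℤ) : ftr w 1 = fchar w := by
  simp [ftr_apply, fchar]

theorem der_fchar (w : ι → Fin n → ℤ) (k : Fin n) :
    der k (fchar w) = ∑ i, AddMonoidAlgebra.single (w i) (w i k : ℂ) := by
  simp only [fchar, map_sum, der_single, mul_one]

theorem ftr_mul_comm {w : ι → Fin n → ℤ} {A : Matrix ι ι ℂ} {α : Fin n → ℤ}
    (hA : ∀ i j, A i j ≠ 0 → w i = w j + α) (B : Matrix ι ι ℂ) :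
    ftr w (A * B) = AddMonoidAlgebra.single α 1 * ftr w (B * A) := by
  have single_sum (μ : Fin n → ℤ) (f : ι → ℂ) : AddMonoidAlgebra.single μ (∑ i, f i) =
      ∑ i, AddMonoidAlgebra.single μ (f i) := by
    simp only [← AddMonoidAlgebra.lsingle_apply (R := ℂ), map_sum]
  simp only [ftr_apply, Matrix.mul_apply, single_sum, Finset.mul_sum,
    AddMonoidAlgebra.single_mul_single, one_mul]
  rw [Finset.sum_comm]
  refine Finset.sum_congr rfl fun j _ => Finset.sum_congr rfl fun i _ => ?_
  by_cases h : A i j = 0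
  · simp [h]
  · rw [hA i j h, add_comm α, mul_comm]

variable [DecidableEq ι] {R : Lie n →ₗ⁅ℂ⁆ Matrix ι ι ℂ} {w : ι → Fin n → ℤ}

theorem HasWeights.ftr_cartan (hw : HasWeights R w) (k : Fin n) :
    ftr w (R (cartan n k)) = der k (fchar w) := by
  simp [hw k, ftr_apply, der_fchar]

theorem HasWeights.ftr_wedge_mul (hw : HasWeights R w) {a c : VecIdx n} (h : a ≠ c) :
    (1 - AddMonoidAlgebra.single (-(wt a + wt c)) 1) *
        ftr w (R (wedge a c) * R (wedge (dualIdx c) (dualIdx a))) =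
      (formCoeff a * formCoeff c) • ∑ k, ((wt a k : ℂ) + (wt c k : ℂ)) • der k (fchar w) := by
  have hroot : IsRootVector (-(wt a + wt c)) (wedge (dualIdx c) (dualIdx a)) := by
    simpa [add_comm] using isRootVector_wedge (dualIdx c) (dualIdx a)
  rw [sub_mul, one_mul, ← ftr_mul_comm (hw.eq_add_of_apply_ne_zero hroot), ← map_sub,
    ← Ring.lie_def, ← LieHom.map_lie, lie_wedge_wedge_dualIdx h]
  simp only [map_smul, map_sum, hw.ftr_cartan]

theorem HasWeights.apply_wedge_dualIdx (hw : HasWeights R w) (a : VecIdx n) :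
    R (wedge a (dualIdx a)) =
      Matrix.diagonal fun i => formCoeff a * ∑ k, (wt a k : ℂ) * (w i k : ℂ) := by
  rw [wedge_dualIdx]
  simp only [map_smul, map_sum, hw _]
  ext i j
  simp only [Matrix.smul_apply, Matrix.sum_apply, Matrix.diagonal_apply, smul_eq_mul]
  split_ifs <;> simp

theorem sum_wt_mul_sq (a : VecIdx n) (u : Fin n → ℂ) :
    (∑ k, (wt a k : ℂ) * u k) ^ 2 = ∑ k, (wt a k : ℂ) ^ 2 * u k ^ 2 := by
  rcases a with a | a | a <;> simp [wt, eps, Pi.single_apply]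

theorem HasWeights.ftr_wedge_dualIdx_mul (hw : HasWeights R w) (a : VecIdx n) :
    ftr w (R (wedge a (dualIdx a)) * R (wedge a (dualIdx a))) =
      formCoeff a ^ 2 • ∑ k, (wt a k : ℂ) ^ 2 • der k (der k (fchar w)) := by
  simp only [hw.apply_wedge_dualIdx, Matrix.diagonal_mul_diagonal, ftr_apply,
    Matrix.diagonal_apply_eq, der_fchar, map_sum, der_single, Finset.smul_sum,
    AddMonoidAlgebra.smul_single, smul_eq_mul]
  rw [Finset.sum_comm]
  refine Finset.sum_congr rfl fun i _ => ?_
  rw [← sq, mul_pow, sum_wt_mul_sq, Finset.mul_sum]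
  simp only [← AddMonoidAlgebra.lsingle_apply (R := ℂ), map_sum, sq (w i _ : ℂ)]

end FormalTrace

section Casimir

variable {n : ℕ}

/-- The image of (a multiple of) the Casimir element of `𝔰𝔬_{2n+1}` under a representation in an
associative algebra. -/
def casimir {A : Type*} [Ring A] [Algebra ℂ A] (R : Lie n →ₗ⁅ℂ⁆ A) : A :=
  ∑ a, ∑ c, (formCoeff a * formCoeff c)⁻¹ •
    (R (wedge a c) * R (wedge (dualIdx c) (dualIdx a)))

/-- The factor `(1 - e^(-α))⁻¹` that the root `α = wt a + wt c` contributes to the formal trace of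
the Casimir element, and `0` if `wt a + wt c` is not a root. -/
def rootCoeff (a c : VecIdx n) : CharField ℂ n :=
  if a = c ∨ c = dualIdx a then 0 else (1 - fexp ℂ (-(wt a + wt c)))⁻¹

theorem rootCoeff_comm (a c : VecIdx n) : rootCoeff a c = rootCoeff c a := by
  simp only [rootCoeff, add_comm (wt a), eq_comm (a := a) (b := c),
    eq_dualIdx_comm (a := c) (b := a)]

theorem wt_add_wt_ne_zero {a c : VecIdx n} (h₁ : a ≠ c) (h₂ : c ≠ dualIdx a) :
    wt a + wt c ≠ 0 := by
  intro h
  have zero_notMem : (0 : Fin n → ℤ) ∉ posRoots n := fun h0 => by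
    simpa using dotProduct_pos_of_mem_posRoots (rho_strictAnti n) rho_pos h0
  rcases wt_add_wt_cases a c with h₃ | h₃ | h₃ | h₃
  · exact h₁ h₃
  · exact h₂ h₃
  · exact zero_notMem (h ▸ h₃)
  · exact zero_notMem (by rwa [h, neg_zero] at h₃)

theorem toFrac_smul (z : ℂ) (f : Laurent ℂ n) : toFrac n (z • f) = z • toFrac n f :=
  map_smul ((Algebra.linearMap (Laurent ℂ n) (CharField ℂ n)).restrictScalars ℂ) z f

theorem inv_one_sub_inv_sub_inv_one_sub {F : Type*} [Field F] {y : F} (hy : y ≠ 0) :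
    (1 - y⁻¹)⁻¹ - (1 - y)⁻¹ = (y + 1) / (y - 1) := by
  have h₁ : 1 - y⁻¹ = (y - 1) / y := by rw [sub_div, div_self hy, one_div]
  rw [h₁, inv_div, ← neg_sub y 1, inv_neg, sub_neg_eq_add, add_div, one_div]

theorem rootCoeff_sub_rootCoeff_dualIdx (a c : VecIdx n) :
    rootCoeff a c - rootCoeff (dualIdx a) (dualIdx c) = if a = c ∨ c = dualIdx a then 0 else
      (fexp ℂ (wt a + wt c) + 1) / (fexp ℂ (wt a + wt c) - 1) := by
  simp only [rootCoeff, dualIdx_inj]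
  split_ifs with h
  · exact sub_zero 0
  · rw [wt_dualIdx, wt_dualIdx, ← neg_add, neg_neg, fexp_neg]
    exact inv_one_sub_inv_sub_inv_one_sub (fexp_ne_zero _)

theorem sum_wt_mul_rootCoeff (k : Fin n) :
    ∑ a : VecIdx n, ∑ c : VecIdx n, (wt a k : CharField ℂ n) * rootCoeff a c =
      ∑ c : VecIdx n with wt c k = 0,
        (fexp ℂ (eps k + wt c) + 1) / (fexp ℂ (eps k + wt c) - 1) := by
  let e : VecIdx n := Sum.inr (Sum.inl k)
  have sum_eq (f : VecIdx n → CharField ℂ n) :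
      ∑ a, (wt a k : CharField ℂ n) * f a = f e - f (dualIdx e) := by
    simp [Fintype.sum_sum_type, wt, eps, Pi.single_apply, e, dualIdx, sub_eq_add_neg]
  have wt_eq_zero_iff (c : VecIdx n) : wt c k = 0 ↔ ¬(e = c ∨ c = dualIdx e) := by
    rcases c with c | c | c <;> simp [wt, eps, Pi.single_apply, e, dualIdx, eq_comm]
  have dualIdx_involutive : Function.Involutive (dualIdx : VecIdx n → VecIdx n) := dualIdx_dualIdx
  simp only [← Finset.mul_sum, sum_eq]
  rw [← Equiv.sum_comp dualIdx_involutive.toPerm (fun c => rootCoeff (dualIdx e) c),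
    ← Finset.sum_sub_distrib, Finset.sum_filter]
  refine Finset.sum_congr rfl fun c _ => ?_
  rw [Function.Involutive.coe_toPerm, rootCoeff_sub_rootCoeff_dualIdx, ← ite_not]
  exact if_congr (wt_eq_zero_iff c).symm rfl rfl

variable {ι : Type*} [Fintype ι] [DecidableEq ι] {R : Lie n →ₗ⁅ℂ⁆ Matrix ι ι ℂ}
  {w : ι → Fin n → ℤ}

theorem HasWeights.toFrac_ftr_wedge_mul (hw : HasWeights R w) (a c : VecIdx n) :
    toFrac n (ftr w ((formCoeff a * formCoeff c)⁻¹ •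
        (R (wedge a c) * R (wedge (dualIdx c) (dualIdx a))))) =
      (if c = dualIdx a then ∑ k, (wt a k : ℂ) ^ 2 • toFrac n (der k (der k (fchar w))) else 0) +
      ∑ k, ((wt a k : ℂ) + (wt c k : ℂ)) • (rootCoeff a c * toFrac n (der k (fchar w))) := by
  have hcoeff := mul_ne_zero (formCoeff_ne_zero a) (formCoeff_ne_zero c)
  rcases eq_or_ne c (dualIdx a) with rfl | h₂
  · rw [dualIdx_dualIdx, map_smul, hw.ftr_wedge_dualIdx_mul, formCoeff_dualIdx, ← sq,
      inv_smul_smul₀ (pow_ne_zero 2 (formCoeff_ne_zero a))]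
    simp [rootCoeff, toFrac_smul]
  rw [if_neg h₂, zero_add]
  rcases eq_or_ne a c with rfl | h₁
  · simp [rootCoeff, wedge_self]
  · have hne : (1 : CharField ℂ n) - fexp ℂ (-(wt a + wt c)) ≠ 0 :=
      sub_ne_zero.2 (fexp_ne_one (neg_ne_zero.2 (wt_add_wt_ne_zero h₁ h₂))).symm
    have htrace := congrArg (toFrac n) (hw.ftr_wedge_mul h₁)
    rw [map_mul, map_sub, map_one, toFrac_smul, ← fexp, mul_comm, ← eq_div_iff hne] at htrace
    rw [map_smul, toFrac_smul, htrace, div_eq_inv_mul, mul_smul_comm, inv_smul_smul₀ hcoeff,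
      rootCoeff, if_neg (not_or.2 ⟨h₁, h₂⟩), map_sum, Finset.mul_sum]
    simp only [toFrac_smul, mul_smul_comm]

theorem sum_wt_sq (k : Fin n) : ∑ a : VecIdx n, (wt a k : ℂ) ^ 2 = 2 := by
  simp [Fintype.sum_sum_type, wt, eps, Pi.single_apply, one_add_one_eq_two]

theorem HasWeights.toFrac_ftr_casimir (hw : HasWeights R w) : toFrac n (ftr w (casimir R)) =
    2 * (∑ k, toFrac n (der k (der k (fchar w))) + ∑ k, (∑ c : VecIdx n with wt c k = 0,
      (fexp ℂ (eps k + wt c) + 1) / (fexp ℂ (eps k + wt c) - 1)) * toFrac n (der k (fchar w))) := by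
  have wt_symm (k : Fin n) : ∑ a, ∑ c, (wt c k : CharField ℂ n) * rootCoeff a c =
      ∑ a, ∑ c, (wt a k : CharField ℂ n) * rootCoeff a c := by
    rw [Finset.sum_comm]
    simp only [rootCoeff_comm]
  simp only [casimir, map_sum, hw.toFrac_ftr_wedge_mul, Finset.sum_add_distrib,
    Finset.sum_ite_eq', Finset.mem_univ, if_true]
  rw [mul_add]
  congr 1
  · rw [Finset.sum_comm, Finset.mul_sum]
    refine Finset.sum_congr rfl fun k _ => ?_
    rw [← Finset.sum_smul, sum_wt_sq, two_smul, two_mul]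
  · rw [Finset.sum_congr rfl fun a _ => Finset.sum_comm, Finset.sum_comm, Finset.mul_sum]
    refine Finset.sum_congr rfl fun k _ => ?_
    rw [← sum_wt_mul_rootCoeff, ← mul_assoc, two_mul, ← congrArg₂ (· + ·) (wt_symm k) rfl]
    simp only [add_smul, Int.cast_smul_eq_zsmul, zsmul_eq_mul, add_mul, Finset.sum_add_distrib,
      Finset.sum_mul, mul_assoc]
    rw [add_comm]

/-- Multiplication by `alt rho` turns the Casimir operator into the Laplacian because the sums over
the roots are the logarithmic derivatives of the Weyl denominator. -/
theorem HasWeights.two_mul_laplacian (hw : HasWeights R w) :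
    2 * laplacian (alt (xU ℂ) (rho n) * fchar w) =
      alt (xU ℂ) (rho n) * ftr w (casimir R) +
        (2 * quad (rho n) : ℂ) • (alt (xU ℂ) (rho n) * fchar w) := by
  have alt_mul_ftr : alt (xU ℂ) (rho n) * ftr w (casimir R) =
      2 * (alt (xU ℂ) (rho n) * ∑ k, der k (der k (fchar w)) +
        ∑ k, (2 * der k (alt (xU ℂ) (rho n)) - alt (xU ℂ) (rho n)) * der k (fchar w)) := by
    apply toFrac_injective n
    simp only [map_mul, hw.toFrac_ftr_casimir, map_add, map_sum, map_sub, map_ofNat,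
      ← sum_add_one_div_sub_one_mul_alt_rho]
    rw [mul_left_comm, mul_add _ (∑ k, _), Finset.mul_sum _ _ (toFrac n (alt (xU ℂ) (rho n))),
      Finset.mul_sum]
    congr 2
    exact Finset.sum_congr rfl fun k _ => by ring
  rw [laplacian_mul, laplacian_alt, alt_mul_ftr, mul_add 2, smul_mul_assoc, mul_smul,
    two_smul ℂ (_ • _), two_mul (_ • _)]

theorem HasWeights.two_mul_quad_eq (hw : HasWeights R w) {κ : ℂ} (hκ : casimir R = κ • 1)
    {ν : Fin n → ℤ} (hν : (alt (xU ℂ) (rho n) * fchar w).coeff ν ≠ 0) :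
    (2 * quad ν : ℂ) = κ + 2 * quad (rho n) := by
  have h := congrArg (fun f : Laurent ℂ n => f.coeff ν) hw.two_mul_laplacian
  simp only [hκ, map_smul, ftr_one, mul_smul_comm, ← add_smul, two_mul (laplacian _),
    AddMonoidAlgebra.coeff_add, Finsupp.add_apply, coeff_laplacian, AddMonoidAlgebra.coeff_smul,
    Finsupp.smul_apply, smul_eq_mul] at h
  exact mul_right_cancel₀ hν (by linear_combination h)

end Casimir

/-! ### The Weyl group acts on the weights -/

section ExpConjugation

variable {A : Type*} [Ring A]

theorem isNilpotent_of_lie_eq_smul {𝕜 : Type*} [Field 𝕜] [CharZero 𝕜] [Algebra 𝕜 A]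
    [FiniteDimensional 𝕜 A] {h e : A} {c : 𝕜} (hc : c ≠ 0) (he : ⁅h, e⁆ = c • e) :
    IsNilpotent e := by
  have hpow (m : ℕ) : ⁅h, e ^ m⁆ = (m * c) • e ^ m := by
    induction m with
    | zero => simp [Ring.lie_def]
    | succ m ih =>
      calc ⁅h, e ^ (m + 1)⁆ = ⁅h, e ^ m⁆ * e + e ^ m * ⁅h, e⁆ := by
            simp only [Ring.lie_def, pow_succ]
            noncomm_ring
        _ = ((m + 1 : ℕ) * c) • e ^ (m + 1) := by
            rw [ih, he, smul_mul_assoc, mul_smul_comm, ← pow_succ, ← add_smul]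
            push_cast
            ring_nf
  by_contra hnil
  have heig (m : ℕ) : (LieAlgebra.ad 𝕜 A h).HasEigenvalue (m * c) :=
    Module.End.hasEigenvalue_of_hasEigenvector (x := e ^ m)
      ⟨Module.End.mem_eigenspace_iff.2 (hpow m), fun h0 => hnil ⟨m, h0⟩⟩
  refine Set.infinite_range_of_injective (f := fun m : ℕ => (m : 𝕜) * c) (fun m m' hm => ?_)
    ((LieAlgebra.ad 𝕜 A h).finite_hasEigenvalue.subset (Set.range_subset_iff.2 heig))
  exact Nat.cast_injective (mul_right_cancel₀ hc hm)

theorem semiconjBy_exp [Algebra ℚ A] {a b c d : A} (ha : IsNilpotent a) (hb : ⁅a, b⁆ = c)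
    (hc : ⁅a, c⁆ = d) (hd : ⁅a, d⁆ = 0) :
    SemiconjBy (IsNilpotent.exp a) b (b + c + (2 : ℚ)⁻¹ • d) := by
  set L := LinearMap.mulLeft ℚ a
  set R := LinearMap.mulRight ℚ a
  have hcomm : Commute L R := LinearMap.commute_mulLeft_right a a
  have hL : IsNilpotent L := (LinearMap.isNilpotent_mulLeft_iff ℚ a).2 ha
  have hR : IsNilpotent R := (LinearMap.isNilpotent_mulRight_iff ℚ a).2 ha
  have hLR : IsNilpotent (L - R) := hcomm.isNilpotent_sub hL hR
  obtain ⟨k, hk⟩ := ha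
  have hexpL (x : A) : IsNilpotent.exp L x = IsNilpotent.exp a * x := by
    have hLk : L ^ k = 0 := by rw [LinearMap.pow_mulLeft, hk, LinearMap.mulLeft_zero_eq_zero]
    simp [IsNilpotent.exp_eq_sum hk, IsNilpotent.exp_eq_sum hLk, L, Finset.sum_mul]
  have hexpR (x : A) : IsNilpotent.exp R x = x * IsNilpotent.exp a := by
    have hRk : R ^ k = 0 := by rw [LinearMap.pow_mulRight, hk, LinearMap.mulRight_zero_eq_zero]
    simp [IsNilpotent.exp_eq_sum hk, IsNilpotent.exp_eq_sum hRk, R, Finset.mul_sum]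
  have hD (x : A) : (L - R) x = ⁅a, x⁆ := rfl
  have hexpD : IsNilpotent.exp (L - R) b = b + c + (2 : ℚ)⁻¹ • d := by
    have h3 : (L - R) ^ 3 • b = 0 := by
      simp only [Module.End.smul_def, pow_succ, pow_zero, one_mul, Module.End.mul_apply, hD, hb,
        hc, hd]
    rw [← Module.End.smul_def, IsNilpotent.exp_smul_eq_sum h3 hLR]
    simp [Finset.sum_range_succ, pow_two, hD, hb, hc, -LinearMap.sub_apply]
  have hRD : Commute R (L - R) := hcomm.symm.sub_right (Commute.refl R)
  rw [SemiconjBy, ← hexpL, ← hexpD, ← hexpR, ← Module.End.mul_apply,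
    ← IsNilpotent.exp_add_of_commute hRD hR hLR, add_sub_cancel]

theorem semiconjBy_exp_of_lie_eq_smul [Algebra ℚ A] {𝕜 : Type*} [Field 𝕜] [Algebra 𝕜 A]
    {a x : A} {c : 𝕜} (ha : IsNilpotent a) (hx : ⁅x, a⁆ = c • a) :
    SemiconjBy (IsNilpotent.exp a) x (x - c • a) := by
  simpa [sub_eq_add_neg] using
    semiconjBy_exp ha (b := x) (c := -(c • a)) (d := 0) (by rw [← lie_skew, hx]) (by simp) (by simp)

/-- The element `θ = exp e * exp (-f) * exp e` represents the reflection. -/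
theorem exists_unit_semiconjBy {𝕜 : Type*} [Field 𝕜] [CharZero 𝕜] [Algebra 𝕜 A] {h e f : A}
    (hef : ⁅e, f⁆ = h) (hhe : ⁅h, e⁆ = (2 : 𝕜) • e) (hhf : ⁅h, f⁆ = -((2 : 𝕜) • f))
    (he : IsNilpotent e) (hf : IsNilpotent f) :
    ∃ θ : Aˣ, ∀ (x : A) (c : 𝕜), ⁅x, e⁆ = c • e → ⁅x, f⁆ = -(c • f) →
      SemiconjBy (θ : A) x (x - c • h) := by
  let : Algebra ℚ A := Algebra.compHom A (algebraMap ℚ 𝕜)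
  refine ⟨(IsNilpotent.isUnit_exp he).unit * (IsNilpotent.isUnit_exp hf.neg).unit *
    (IsNilpotent.isUnit_exp he).unit, fun x c hxe hxf => ?_⟩
  have hEx : SemiconjBy (IsNilpotent.exp e) x (x - c • e) := semiconjBy_exp_of_lie_eq_smul he hxe
  have hEe : SemiconjBy (IsNilpotent.exp e) e e := by
    simpa using semiconjBy_exp_of_lie_eq_smul he (x := e) (c := (0 : 𝕜)) (by simp)
  have hEh : SemiconjBy (IsNilpotent.exp e) h (h - (2 : 𝕜) • e) :=
    semiconjBy_exp_of_lie_eq_smul he hhe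
  have hFx : SemiconjBy (IsNilpotent.exp (-f)) x (x - c • f) := by
    simpa using semiconjBy_exp_of_lie_eq_smul hf.neg (x := x) (c := -c) (by simp [hxf])
  have hFe : SemiconjBy (IsNilpotent.exp (-f)) e (e + h - f) := by
    have hfe : ⁅-f, e⁆ = h := by rw [neg_lie, lie_skew, hef]
    have hfh : ⁅-f, h⁆ = (2 : ℚ) • -f := by
      rw [neg_lie, lie_skew, hhf, two_smul, two_smul, neg_add]
    simpa [sub_eq_add_neg] using semiconjBy_exp hf.neg hfe hfh (by simp)
  have hF : SemiconjBy (IsNilpotent.exp (-f)) (x - c • e) (x - c • e - c • h) := by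
    convert! hFx.sub_right (hFe.smul_right c) using 1
    module
  have hE : SemiconjBy (IsNilpotent.exp e) (x - c • e - c • h) (x - c • h) := by
    convert! (hEx.sub_right (hEe.smul_right c)).sub_right (hEh.smul_right c) using 1
    module
  exact (hE.mul_left hF).mul_left hEx

end ExpConjugation

section WeylGroup

variable {n : ℕ} {W : Type*} [AddCommGroup W] [Module ℂ W] {ρ : Lie n →ₗ⁅ℂ⁆ Module.End ℂ W}

/-- The value of a weight `μ` on the multiple `⁅wedge a c, wedge (dualIdx c) (dualIdx a)⁆` of the
coroot of `wt a + wt c`. -/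
def corootPairing (a c : VecIdx n) (μ : Fin n → ℤ) : ℂ :=
  formCoeff a * formCoeff c * ((wt a + wt c) ⬝ᵥ μ : ℤ)

theorem lie_wedge_dualIdx_apply {a c : VecIdx n} (h : a ≠ c) {μ : Fin n → ℤ} {w : W}
    (hw : w ∈ wtSpace ρ μ) :
    ρ ⁅wedge a c, wedge (dualIdx c) (dualIdx a)⁆ w = corootPairing a c μ • w := by
  rw [lie_wedge_wedge_dualIdx h, map_smul, LinearMap.smul_apply, sum_smul_cartan_apply hw,
    smul_smul, corootPairing]
  simp [dotProduct]

theorem lie_eq_corootPairing_smul {a c : VecIdx n} (h : a ≠ c) {α : Fin n → ℤ} {x : Lie n}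
    (hx : IsRootVector α x) :
    ⁅⁅wedge a c, wedge (dualIdx c) (dualIdx a)⁆, x⁆ = corootPairing a c α • x :=
  lie_wedge_dualIdx_apply (ρ := LieAlgebra.ad ℂ (Lie n)) h (mem_wtSpace.2 hx)

variable [FiniteDimensional ℂ W]

theorem exists_unit_apply_mem_wtSpace (ρ : Lie n →ₗ⁅ℂ⁆ Module.End ℂ W) {a c : VecIdx n} (h : a ≠ c)
    (h₂ : corootPairing a c (wt a + wt c) = 2) :
    ∃ θ : (Module.End ℂ W)ˣ, ∀ (μ : Fin n → ℤ) (m : ℤ), corootPairing a c μ = m →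
      ∀ w ∈ wtSpace ρ μ, (θ : Module.End ℂ W) w ∈ wtSpace ρ (μ - m • (wt a + wt c)) := by
  set α := wt a + wt c
  set e := wedge a c
  set f := wedge (dualIdx c) (dualIdx a)
  have he : IsRootVector α e := isRootVector_wedge a c
  have hf : IsRootVector (-α) f := by
    simpa [α, neg_add_rev] using isRootVector_wedge (dualIdx c) (dualIdx a)
  have hhe : ⁅ρ ⁅e, f⁆, ρ e⁆ = (2 : ℂ) • ρ e := by
    rw [← LieHom.map_lie, lie_eq_corootPairing_smul h he, h₂, map_smul]
  have hhf : ⁅ρ ⁅e, f⁆, ρ f⁆ = -((2 : ℂ) • ρ f) := by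
    have hneg : corootPairing a c (-α) = -2 := by 
      rw [← h₂, corootPairing, dotProduct_neg, Int.cast_neg, mul_neg, corootPairing]
    rw [← LieHom.map_lie, lie_eq_corootPairing_smul h hf, hneg, map_smul, neg_smul]
  obtain ⟨θ, hθ⟩ := exists_unit_semiconjBy (ρ.map_lie e f).symm hhe hhf
    (isNilpotent_of_lie_eq_smul two_ne_zero hhe)
    (isNilpotent_of_lie_eq_smul (neg_ne_zero.2 two_ne_zero) (hhf.trans (neg_smul _ _).symm))
  refine ⟨θ, fun μ m hm w hw => mem_wtSpace.2 fun i => ?_⟩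
  have hi := hθ (ρ (cartan n i)) (α i) (by rw [← LieHom.map_lie, he i, map_smul])
    (by rw [← LieHom.map_lie, hf i, map_smul, Pi.neg_apply, Int.cast_neg, neg_smul])
  have hi := congr($hi.eq w)
  have hh := congr($((hθ _ 2 hhe hhf).eq) w)
  simp only [Module.End.mul_apply, LinearMap.sub_apply, LinearMap.smul_apply, mem_wtSpace.1 hw,
    lie_wedge_dualIdx_apply h hw, hm, map_smul, e, f] at hi hh
  push_cast [Pi.sub_apply, Pi.smul_apply, smul_eq_mul]
  linear_combination (norm := module) (α i : ℂ) • hh - hi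

theorem finrank_wtSpace_sub_smul (ρ : Lie n →ₗ⁅ℂ⁆ Module.End ℂ W) {a c : VecIdx n} (h : a ≠ c)
    (h₂ : corootPairing a c (wt a + wt c) = 2) {μ : Fin n → ℤ} {m : ℤ}
    (hm : corootPairing a c μ = m) :
    Module.finrank ℂ (wtSpace ρ (μ - m • (wt a + wt c))) = Module.finrank ℂ (wtSpace ρ μ) := by
  obtain ⟨θ, hθ⟩ := exists_unit_apply_mem_wtSpace ρ h h₂
  have hle {μ : Fin n → ℤ} {m : ℤ} (hm : corootPairing a c μ = m) :
      Module.finrank ℂ (wtSpace ρ μ) ≤ Module.finrank ℂ (wtSpace ρ (μ - m • (wt a + wt c))) :=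
    LinearMap.finrank_le_finrank_of_injective
      (f := (θ : Module.End ℂ W).restrict fun w hw => hθ μ m hm w hw) <|
      fun _ _ hxy => Subtype.ext (((Module.End.isUnit_iff _).1 θ.isUnit).1 congr(($hxy).1))
  refine le_antisymm ?_ (hle hm)
  have hm' : corootPairing a c (μ - m • (wt a + wt c)) = (-m : ℤ) := by
    rw [corootPairing] at h₂ hm ⊢
    push_cast [dotProduct_sub, dotProduct_smul, smul_eq_mul]
    linear_combination hm - m * h₂
  refine (hle hm').trans_eq ?_
  rw [neg_smul, sub_neg_eq_add, sub_add_cancel]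

theorem finrank_wtSpace_swapWt (ρ : Lie n →ₗ⁅ℂ⁆ Module.End ℂ W) (i j : Fin n) (μ : Fin n → ℤ) :
    Module.finrank ℂ (wtSpace ρ (swapWt i j μ)) = Module.finrank ℂ (wtSpace ρ μ) := by
  rcases eq_or_ne i j with rfl | hij
  · rw [show swapWt i i μ = μ by ext; simp [swapWt]]
  have hpair (ν : Fin n → ℤ) :
      corootPairing (.inr (.inl i)) (.inr (.inr j)) ν = (ν i - ν j : ℤ) := by
    simp [corootPairing, wt, formCoeff, eps, sub_dotProduct, ← sub_eq_add_neg]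
  have hswap : swapWt i j μ = μ - (μ i - μ j) • (wt (.inr (.inl i)) + wt (.inr (.inr j))) := by
    ext k
    simp only [swapWt, AddEquiv.coe_mk, Equiv.coe_fn_mk, Function.comp_apply, wt, eps,
      Equiv.swap_apply_def, Sum.elim_inr, Sum.elim_inl, Pi.sub_apply, Pi.add_apply, Pi.neg_apply,
      Pi.smul_apply, Pi.single_apply, smul_eq_mul]
    grind
  rw [hswap, finrank_wtSpace_sub_smul ρ (by simp) _ (hpair μ)]
  rw [hpair]
  simp [wt, eps, hij, hij.symm]

theorem finrank_wtSpace_negWt (ρ : Lie n →ₗ⁅ℂ⁆ Module.End ℂ W) (i : Fin n) (μ : Fin n → ℤ) :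
    Module.finrank ℂ (wtSpace ρ (negWt i μ)) = Module.finrank ℂ (wtSpace ρ μ) := by
  have hpair (ν : Fin n → ℤ) : corootPairing (.inr (.inl i)) (.inl ()) ν = (2 * ν i : ℤ) := by
    simp [corootPairing, wt, formCoeff, eps]
  have hneg : negWt i μ = μ - (2 * μ i) • (wt (.inr (.inl i)) + wt (.inl ())) := by
    ext k
    simp only [negWt, AddEquiv.coe_mk, Equiv.coe_fn_mk, Function.update_apply, wt, eps,
      Sum.elim_inr, Sum.elim_inl, Pi.zero_apply, add_zero, Pi.sub_apply, Pi.smul_apply,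
      Pi.single_apply, smul_eq_mul, mul_ite, mul_one, mul_zero]
    grind
  rw [hneg, finrank_wtSpace_sub_smul ρ (by simp) _ (hpair μ)]
  rw [hpair]
  simp [wt, eps]

end WeylGroup

section WeightBasis

variable {n : ℕ} {W : Type*} [AddCommGroup W] [Module ℂ W] {ρ : Lie n →ₗ⁅ℂ⁆ Module.End ℂ W}
  {ι : Type*} {b : Module.Basis ι ℂ W} {w : ι → Fin n → ℤ}

theorem wtSpace_eq_span (hb : ∀ i, b i ∈ wtSpace ρ (w i)) (μ : Fin n → ℤ) :
    wtSpace ρ μ = Submodule.span ℂ (Set.range fun i : {i // w i = μ} => b i) := by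
  refine le_antisymm (fun v hv => ?_) (Submodule.span_le.2 ?_)
  · have heq (i : ι) (hi : b.repr v i ≠ 0) : w i = μ := by
      ext k
      have hdiag : (b.coord i) ∘ₗ ρ (cartan n k) = (w i k : ℂ) • b.coord i := by
        refine b.ext fun j => ?_
        rcases eq_or_ne i j with rfl | hij
        · simp [mem_wtSpace.1 (hb _)]
        · simp [mem_wtSpace.1 (hb _), hij.symm]
      have hcoord : (μ k : ℂ) * b.repr v i = w i k * b.repr v i := by
        simpa [mem_wtSpace.1 hv k] using LinearMap.congr_fun hdiag v
      exact_mod_cast (mul_right_cancel₀ hi hcoord).symm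
    rw [← b.linearCombination_repr v, Finsupp.linearCombination_apply]
    exact Submodule.sum_mem _ fun i hi => Submodule.smul_mem _ _
      (Submodule.subset_span ⟨⟨i, heq i (Finsupp.mem_support_iff.1 hi)⟩, rfl⟩)
  · rintro _ ⟨⟨i, rfl⟩, rfl⟩
    exact hb i

variable [Fintype ι]

theorem finrank_wtSpace (hb : ∀ i, b i ∈ wtSpace ρ (w i)) (μ : Fin n → ℤ) :
    Module.finrank ℂ (wtSpace ρ μ) = Fintype.card {i // w i = μ} := by
  rw [wtSpace_eq_span hb, finrank_span_eq_card]
  exact b.linearIndependent.comp _ Subtype.val_injective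

theorem coeff_fchar (w : ι → Fin n → ℤ) (μ : Fin n → ℤ) :
    (fchar w).coeff μ = (Fintype.card {i // w i = μ} : ℂ) := by
  classical
  simp only [fchar, AddMonoidAlgebra.coeff_sum, Finsupp.finsetSum_apply,
    AddMonoidAlgebra.coeff_single, Finsupp.single_apply]
  rw [Finset.sum_boole, Fintype.card_subtype]

theorem isSymm_fchar (hb : ∀ i, b i ∈ wtSpace ρ (w i)) : IsSymm (fchar w) := by
  have : FiniteDimensional ℂ W := .of_basis b
  have hcoeff (μ : Fin n → ℤ) : (fchar w).coeff μ = Module.finrank ℂ (wtSpace ρ μ) := by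
    rw [coeff_fchar, finrank_wtSpace hb]
  refine ⟨fun i j => AddMonoidAlgebra.ext (Finsupp.ext fun μ => ?_),
    fun i => AddMonoidAlgebra.ext (Finsupp.ext fun μ => ?_)⟩
  · rw [AddMonoidAlgebra.coeff_domCongr, hcoeff, hcoeff]
    exact congrArg _ (finrank_wtSpace_swapWt ρ i j μ)
  · rw [AddMonoidAlgebra.coeff_domCongr, hcoeff, hcoeff]
    exact congrArg _ (finrank_wtSpace_negWt ρ i μ)

end WeightBasis

/-! ### The Casimir operator acts by a scalar -/

section Casimir

variable {n : ℕ}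

theorem inv_formCoeff_mul_apply_dualIdx (X : Lie n) (a b : VecIdx n) :
    (formCoeff b)⁻¹ * X.1 (dualIdx a) (dualIdx b) = -((formCoeff a)⁻¹ * X.1 b a) := by
  have h := (mem_Lie_iff X.1).1 X.2 (dualIdx b) a
  rw [dualIdx_dualIdx, formCoeff_dualIdx] at h
  have ha := formCoeff_ne_zero a
  have hb := formCoeff_ne_zero b
  field_simp
  linear_combination h

/-- The bivector `∑ a, (formCoeff a)⁻¹ e_a ⊗ e_(dualIdx a)`, on which `F` is evaluated here, is
invariant under the Lie algebra. -/
theorem sum_inv_formCoeff_smul_eq_zero {M : Type*} [AddCommGroup M] [Module ℂ M] (X : Lie n)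
    (F : VecIdx n → VecIdx n → M) :
    ∑ a, (formCoeff a)⁻¹ •
      (∑ b, X.1 b a • F b (dualIdx a) + ∑ b, X.1 b (dualIdx a) • F a b) = 0 := by
  have hdual : ∑ a, (formCoeff a)⁻¹ • ∑ b, X.1 b (dualIdx a) • F a b =
      -∑ a, (formCoeff a)⁻¹ • ∑ b, X.1 b a • F b (dualIdx a) := calc
    _ = ∑ a, ∑ b, ((formCoeff a)⁻¹ * X.1 (dualIdx b) (dualIdx a)) • F a (dualIdx b) := by
      refine Finset.sum_congr rfl fun a _ => ?_
      rw [Finset.smul_sum, ← Equiv.sum_comp (Function.Involutive.toPerm dualIdx dualIdx_dualIdx)]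
      exact Finset.sum_congr rfl fun b _ => smul_smul _ _ _
    _ = ∑ a, ∑ b, -((formCoeff b)⁻¹ * X.1 a b) • F a (dualIdx b) := by
      simp only [inv_formCoeff_mul_apply_dualIdx]
    _ = _ := by
      rw [Finset.sum_comm]
      simp only [neg_smul, Finset.sum_neg_distrib, Finset.smul_sum, smul_smul]
  simp only [smul_add, Finset.sum_add_distrib]
  rw [hdual, add_neg_cancel]

theorem casimir_comm {A : Type*} [Ring A] [Algebra ℂ A] (R : Lie n →ₗ⁅ℂ⁆ A) (X : Lie n) :
    R X * casimir R = casimir R * R X := by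
  have leibniz (Y Z : A) : R X * (Y * Z) - Y * Z * R X = ⁅R X, Y⁆ * Z + Y * ⁅R X, Z⁆ := by
    simp only [Ring.lie_def]
    noncomm_ring
  have hlie (a c : VecIdx n) : ⁅R X, R (wedge a c)⁆ =
      ∑ b, X.1 b a • R (wedge b c) + ∑ b, X.1 b c • R (wedge a b) := by
    simp only [← LieHom.map_lie, lie_wedge, map_add, map_sum, map_smul]
  let inner (a c : VecIdx n) : A :=
    ∑ b, X.1 b c • (R (wedge a b) * R (wedge (dualIdx c) (dualIdx a))) +
      ∑ b, X.1 b (dualIdx c) • (R (wedge a c) * R (wedge b (dualIdx a)))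
  let outer (a c : VecIdx n) : A :=
    ∑ b, X.1 b a • (R (wedge b c) * R (wedge (dualIdx c) (dualIdx a))) +
      ∑ b, X.1 b (dualIdx a) • (R (wedge a c) * R (wedge (dualIdx c) b))
  rw [← sub_eq_zero]
  calc R X * casimir R - casimir R * R X
      = ∑ a, ∑ c, (formCoeff a * formCoeff c)⁻¹ • (inner a c + outer a c) := by
        simp only [casimir, Finset.mul_sum, Finset.sum_mul, ← Finset.sum_sub_distrib,
          mul_smul_comm, smul_mul_assoc, ← smul_sub, leibniz, hlie, inner, outer, add_mul,
          mul_add]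
        refine Finset.sum_congr rfl fun a _ => Finset.sum_congr rfl fun c _ => ?_
        abel_nf
    _ = ∑ a, (formCoeff a)⁻¹ • ∑ c, (formCoeff c)⁻¹ • inner a c +
        ∑ c, (formCoeff c)⁻¹ • ∑ a, (formCoeff a)⁻¹ • outer a c := by
        simp only [smul_add, Finset.sum_add_distrib, mul_inv, Finset.smul_sum, smul_smul]
        congr 1
        rw [Finset.sum_comm]
        simp only [mul_comm]
    _ = 0 := by
        simp only [inner, outer, smul_zero, Finset.sum_const_zero, add_zero,
          fun a => sum_inv_formCoeff_smul_eq_zero X fun b d =>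
            R (wedge a b) * R (wedge d (dualIdx a)),
          fun c => sum_inv_formCoeff_smul_eq_zero X fun b d =>
            R (wedge b c) * R (wedge (dualIdx c) d)]

end Casimir

section WeightBasis

variable {n : ℕ} {V : Type*} [AddCommGroup V] [Module ℂ V]
  {ρ : Lie n →ₗ⁅ℂ⁆ Module.End ℂ V} {lam : Fin n → ℤ} {v : V}

theorem exists_descendant_basis [FiniteDimensional ℂ V] (hspan : descSpan ρ v = ⊤) :
    ∃ (ι : Type) (_ : Fintype ι) (b : Module.Basis ι ℂ V) (δ : ι → Fin n → ℤ),
      ∀ i, Descendant ρ v (δ i) (b i) := by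
  obtain ⟨s, hs, hs_span, hs_indep⟩ := exists_linearIndependent ℂ {w | ∃ δ, Descendant ρ v δ w}
  let b : Module.Basis s ℂ V := .mk hs_indep (by
    rw [Subtype.range_coe, hs_span]
    exact hspan.ge)
  have : Finite s := Module.Finite.finite_basis b
  obtain ⟨N, ⟨e⟩⟩ := Finite.exists_equiv_fin s
  have hb (i : Fin N) : ∃ δ, Descendant ρ v δ (b.reindex e i) := by
    simpa [b] using hs (e.symm i).2
  choose δ hδ using hb
  exact ⟨Fin N, inferInstance, b.reindex e, δ, hδ⟩

theorem card_descendant_basis_eq_one {ι : Type*} [Fintype ι] {b : Module.Basis ι ℂ V}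
    {δ : ι → Fin n → ℤ} (hv : IsHighest ρ lam v) (hv0 : v ≠ 0)
    (hδ : ∀ i, Descendant ρ v (δ i) (b i)) : Fintype.card {i // lam - δ i = lam} = 1 := by
  have eq_highest (i : ι) (hi : lam - δ i = lam) : b i = v := by
    rcases (hδ i).eq_or_rho_dotProduct_pos with ⟨_, h⟩ | hpos
    · exact h
    · rw [sub_eq_self.1 hi, dotProduct_zero] at hpos
      exact absurd hpos (lt_irrefl 0)
  refine le_antisymm (Fintype.card_le_one_iff_subsingleton.2 ⟨fun i j => Subtype.ext ?_⟩) ?_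
  · exact b.injective ((eq_highest i i.2).trans (eq_highest j j.2).symm)
  · rw [← finrank_wtSpace (fun i => (hδ i).mem_wtSpace hv), Nat.one_le_iff_ne_zero]
    have : Module.Finite ℂ V := .of_basis b
    exact fun h => hv0 ((Submodule.mem_bot ℂ).1 (Submodule.finrank_eq_zero.1 h ▸ hv.mem))

theorem IsHighest.casimir_eq_smul (hv : IsHighest ρ lam v) (hv0 : v ≠ 0)
    (hspan : descSpan ρ v = ⊤) (hone : Module.finrank ℂ (wtSpace ρ lam) = 1) :
    ∃ κ : ℂ, casimir ρ = κ • 1 := by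
  have comm (X : Lie n) (w : V) : casimir ρ (ρ X w) = ρ X (casimir ρ w) :=
    (LinearMap.congr_fun (casimir_comm ρ X) w).symm
  have hcv : casimir ρ v ∈ wtSpace ρ lam :=
    mem_wtSpace.2 fun i => by rw [← comm, mem_wtSpace.1 hv.mem, map_smul]
  obtain ⟨κ, hκ⟩ := (finrank_eq_one_iff_of_nonzero' (⟨v, hv.mem⟩ : wtSpace ρ lam)
    (fun h => hv0 (congrArg Subtype.val h))).1 hone ⟨_, hcv⟩
  have hdesc (δ : Fin n → ℤ) (w : V) (hw : Descendant ρ v δ w) : casimir ρ w = κ • w := by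
    induction hw with
    | base => exact (congrArg Subtype.val hκ).symm
    | step _ _ _ ih => rw [comm, ih, map_smul]
  exact ⟨κ, LinearMap.ext_on hspan fun w ⟨δ, hw⟩ => hdesc δ w hw⟩

end WeightBasis

/-! ### Leading exponents -/

section Below

variable {n : ℕ} {R : Type*} [CommRing R] {c d : Fin n → ℤ} {f g : Laurent R n}

/-- All exponents of `f` are at most `c` in the dominance order. -/
def Below (c : Fin n → ℤ) (f : Laurent R n) : Prop := ∀ ν, f.coeff ν ≠ 0 → c - ν ∈ cone n

theorem Below.add (hf : Below c f) (hg : Below c g) : Below c (f + g) := fun ν h => by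
  by_cases hfν : f.coeff ν = 0
  · exact hg ν fun hgν => h (by simp [hfν, hgν])
  · exact hf ν hfν

theorem Below.neg (hf : Below c f) : Below c (-f) := fun ν h => hf ν fun hfν => h (by simp [hfν])

theorem Below.sub (hf : Below c f) (hg : Below c g) : Below c (f - g) := by
  rw [sub_eq_add_neg]
  exact hf.add hg.neg

theorem below_single {μ : Fin n → ℤ} (h : c - μ ∈ cone n) (z : R) :
    Below c (AddMonoidAlgebra.single μ z) := fun ν hν => by
  rw [AddMonoidAlgebra.coeff_single] at hν
  rwa [← (Finsupp.single_apply_ne_zero.1 hν).1] at h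

theorem below_one (h : c ∈ cone n) : Below c (1 : Laurent R n) := by
  rw [AddMonoidAlgebra.one_def]
  exact below_single (by rwa [sub_zero]) 1

theorem Below.mul (hf : Below c f) (hg : Below d g) : Below (c + d) (f * g) := fun ν h => by
  by_contra hν
  refine h ?_
  rw [AddMonoidAlgebra.coeff_mul]
  refine Finset.sum_eq_zero fun a ha => Finset.sum_eq_zero fun b hb => if_neg ?_
  rintro rfl
  refine hν ?_
  rw [add_sub_add_comm]
  exact add_mem (hf a (Finsupp.mem_support_iff.1 ha)) (hg b (Finsupp.mem_support_iff.1 hb))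

theorem Below.prod {ι : Type*} (s : Finset ι) {c : ι → Fin n → ℤ} {f : ι → Laurent R n}
    (h : ∀ i ∈ s, Below (c i) (f i)) : Below (∑ i ∈ s, c i) (∏ i ∈ s, f i) := by
  classical
  induction s using Finset.induction_on with
  | empty => exact below_one (zero_mem _)
  | insert a s ha ih =>
    rw [Finset.prod_insert ha, Finset.sum_insert ha]
    exact (h a (Finset.mem_insert_self a s)).mul
      (ih fun i hi => h i (Finset.mem_insert_of_mem hi))

theorem mem_cone_of_mem_posRoots {α : Fin n → ℤ} (h : α ∈ posRoots n) : α ∈ cone n :=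
  AddSubmonoid.subset_closure h

theorem eps_mem_cone (i : Fin n) : eps i ∈ cone n := mem_cone_of_mem_posRoots (.inl ⟨i, rfl⟩)

theorem below_xU (i : Fin n) : Below (eps i) (xU R i : Laurent R n) := by
  rw [val_xU]
  exact below_single (by simp) 1

theorem below_xU_add_inv_sub {i j : Fin n} (hij : i < j) :
    Below (eps i) ((xU R i : Laurent R n) + (((xU R i)⁻¹ : (Laurent R n)ˣ) : Laurent R n) -
      ((xU R j : Laurent R n) + (((xU R j)⁻¹ : (Laurent R n)ˣ) : Laurent R n))) := by
  refine ((below_xU i).add ?_).sub (.add ?_ ?_)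
  · rw [val_xU_inv]
    exact below_single (by rw [sub_neg_eq_add]; exact add_mem (eps_mem_cone i) (eps_mem_cone i)) 1
  · rw [val_xU]
    exact below_single (mem_cone_of_mem_posRoots (.inr ⟨i, j, hij, .inr rfl⟩)) 1
  · rw [val_xU_inv]
    exact below_single
      (mem_cone_of_mem_posRoots (.inr ⟨i, j, hij, .inl (sub_neg_eq_add _ _)⟩)) 1

theorem rho_eq_sum_eps : rho n = ∑ i, eps i + ∑ i, ∑ _j ∈ Finset.Ioi i, eps i := by
  rw [← Finset.sum_add_distrib, ← sum_zsmul_eps (rho n)]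
  refine Finset.sum_congr rfl fun i _ => ?_
  have hi : rho n i = 1 + ((n - 1 - i : ℕ) : ℤ) := by
    have := i.isLt
    simp only [rho]
    omega
  rw [Finset.sum_const, Fin.card_Ioi, hi, add_zsmul, one_zsmul, natCast_zsmul]

theorem below_alt_rho : Below (rho n) (alt (xU R) (rho n)) := by
  rw [alt_rho, rho_eq_sum_eps]
  exact (Below.prod _ fun i _ => (below_xU i).sub (below_one (eps_mem_cone i))).mul
    (.prod _ fun i _ => .prod _ fun j hj => below_xU_add_inv_sub (Finset.mem_Ioi.1 hj))

theorem eq_zero_of_mem_cone_of_neg_mem_cone {δ : Fin n → ℤ} (h : δ ∈ cone n) (h' : -δ ∈ cone n) :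
    δ = 0 := by
  have hpos {δ} (h : δ ∈ cone n) := eq_zero_or_dotProduct_pos_of_mem_cone
    (rho_strictAnti n) rho_pos h
  rcases hpos h, hpos h' with ⟨h | h, h' | h'⟩
  · exact h
  · exact h
  · exact neg_eq_zero.1 h'
  · rw [dotProduct_neg] at h'
    omega

theorem Below.coeff_mul_add (hf : Below c f) (hg : Below d g) :
    (f * g).coeff (c + d) = f.coeff c * g.coeff d := by
  refine AddMonoidAlgebra.coeff_mul_add_of_uniqueAdd fun a b ha hb h => ?_
  have ha := hf a (Finsupp.mem_support_iff.1 ha)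
  have hb := hg b (Finsupp.mem_support_iff.1 hb)
  have hneg : -(c - a) = d - b := by linear_combination h
  have hca := eq_zero_of_mem_cone_of_neg_mem_cone ha (hneg ▸ hb)
  rw [hca, neg_zero] at hneg
  exact ⟨(sub_eq_zero.1 hca).symm, (sub_eq_zero.1 hneg.symm).symm⟩

theorem quad_sub_quad (l ν : Fin n → ℤ) : quad l - quad ν = (l + ν - 1) ⬝ᵥ (l - ν) := by
  simp only [quad, dotProduct, ← Finset.sum_sub_distrib, Pi.sub_apply, Pi.add_apply, Pi.one_apply]
  exact Finset.sum_congr rfl fun i _ => by ring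

end Below

/-! ### The Weyl character formula -/

section WeylCharacter

variable {n : ℕ} {lam : Fin n → ℤ}

theorem casimir_algHom_comp {A B : Type*} [Ring A] [Algebra ℂ A] [Ring B] [Algebra ℂ B]
    (f : A →ₐ[ℂ] B) (R : Lie n →ₗ⁅ℂ⁆ A) : casimir (f.toLieHom.comp R) = f (casimir R) := by
  simp [casimir]

theorem strictAnti_add_rho (hanti : Antitone lam) : StrictAnti (lam + rho n) :=
  hanti.add_strictAnti (rho_strictAnti n)

theorem one_le_add_rho (h0 : ∀ i, 0 ≤ lam i) (i : Fin n) : 1 ≤ (lam + rho n) i :=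
  le_add_of_nonneg_of_le (h0 i) (rho_pos i)

theorem eq_of_quad_eq_of_sub_mem_cone {l ν : Fin n → ℤ} (hl : StrictAnti l) (hl1 : ∀ i, 1 ≤ l i)
    (hν : StrictAnti ν) (hν1 : ∀ i, 1 ≤ ν i) (hquad : quad l = quad ν) (h : l - ν ∈ cone n) :
    l = ν := by
  have hanti : StrictAnti (l + ν - 1) := fun i j hij =>
    sub_lt_sub_right (add_lt_add (hl hij) (hν hij)) 1
  have hpos (i : Fin n) : 0 < (l + ν - 1) i := by
    have := hl1 i
    have := hν1 i
    simp only [Pi.sub_apply, Pi.add_apply, Pi.one_apply]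
    omega
  rcases eq_zero_or_dotProduct_pos_of_mem_cone hanti hpos h with h0 | hlt
  · exact sub_eq_zero.1 h0
  · rw [← quad_sub_quad, hquad, sub_self] at hlt
    exact absurd hlt (lt_irrefl 0)

variable {V : Type*} [AddCommGroup V] [Module ℂ V] {ρ : Lie n →ₗ⁅ℂ⁆ Module.End ℂ V}
  {ι : Type*} [Fintype ι] {b : Module.Basis ι ℂ V} {w : ι → Fin n → ℤ}

theorem hasWeights_toMatrix [DecidableEq ι] (hb : ∀ i, b i ∈ wtSpace ρ (w i)) :
    HasWeights ((LinearMap.toMatrixAlgEquiv b).toAlgHom.toLieHom.comp ρ) w := fun k => by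
  ext i j
  change LinearMap.toMatrixAlgEquiv b (ρ (cartan n k)) i j = _
  rw [LinearMap.toMatrixAlgEquiv_apply, mem_wtSpace.1 (hb j), map_smul, b.repr_self]
  rcases eq_or_ne i j with rfl | hij
  · simp
  · simp [hij]

theorem quad_eq_of_coeff_alt_rho_mul_fchar_ne_zero (hb : ∀ i, b i ∈ wtSpace ρ (w i)) {κ : ℂ}
    (hκ : casimir ρ = κ • 1) {μ ν : Fin n → ℤ}
    (hμ : (alt (xU ℂ) (rho n) * fchar w).coeff μ ≠ 0)
    (hν : (alt (xU ℂ) (rho n) * fchar w).coeff ν ≠ 0) : quad μ = quad ν := by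
  classical
  have hκ' : casimir ((LinearMap.toMatrixAlgEquiv b).toAlgHom.toLieHom.comp ρ) = κ • 1 := by
    rw [casimir_algHom_comp, hκ, map_smul, map_one]
  have h := ((hasWeights_toMatrix hb).two_mul_quad_eq hκ' hμ).trans
    ((hasWeights_toMatrix hb).two_mul_quad_eq hκ' hν).symm
  exact_mod_cast mul_left_cancel₀ two_ne_zero h

theorem alt_rho_mul_fchar (hb : ∀ i, b i ∈ wtSpace ρ (w i)) {κ : ℂ} (hκ : casimir ρ = κ • 1)
    (hle : Below lam (fchar w)) (hone : Fintype.card {i // w i = lam} = 1)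
    (hanti : Antitone lam) (h0 : ∀ i, 0 ≤ lam i) :
    alt (xU ℂ) (rho n) * fchar w = alt (xU ℂ) (lam + rho n) := by
  have hdom := strictAnti_add_rho hanti
  have hge := one_le_add_rho h0
  have leading_coeff : (alt (xU ℂ) (rho n) * fchar w).coeff (lam + rho n) = 1 := by
    rw [add_comm lam, below_alt_rho.coeff_mul_add hle, coeff_fchar, hone,
      coeff_alt_dominant ℂ (rho_strictAnti n) rho_pos (rho_strictAnti n) rho_pos, if_pos rfl,
      Nat.cast_one, mul_one]
  have hanti_sub : IsAntisymm (alt (xU ℂ) (rho n) * fchar w - alt (xU ℂ) (lam + rho n)) :=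
    ((isAntisymm_alt _).mul_isSymm (isSymm_fchar hb)).sub (isAntisymm_alt _)
  refine sub_eq_zero.1 (hanti_sub.eq_zero fun ν hν hν1 => ?_)
  rw [AddMonoidAlgebra.coeff_sub, Finsupp.sub_apply, coeff_alt_dominant ℂ hdom hge hν hν1]
  split_ifs with h
  · rw [← h, leading_coeff, sub_self]
  · rw [sub_zero]
    by_contra hne
    have hcone : lam + rho n - ν ∈ cone n := by
      rw [add_comm lam]
      exact below_alt_rho.mul hle ν hne
    refine h (eq_of_quad_eq_of_sub_mem_cone hdom hge hν hν1 ?_ hcone)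
    exact quad_eq_of_coeff_alt_rho_mul_fchar_ne_zero hb hκ (leading_coeff ▸ one_ne_zero) hne

theorem IsHighest.exists_character [FiniteDimensional ℂ V] {v : V} (hv : IsHighest ρ lam v)
    (hv0 : v ≠ 0) (hspan : descSpan ρ v = ⊤) (hanti : Antitone lam) (h0 : ∀ i, 0 ≤ lam i) :
    ∃ (ι : Type) (_ : Fintype ι) (w : ι → Fin n → ℤ),
      (∀ μ, Module.finrank ℂ (wtSpace ρ μ) = Fintype.card {i // w i = μ}) ∧
        alt (xU ℂ) (rho n) * fchar w = alt (xU ℂ) (lam + rho n) := by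
  obtain ⟨ι, _, b, δ, hδ⟩ := exists_descendant_basis hspan
  have hb (i : ι) : b i ∈ wtSpace ρ (lam - δ i) := (hδ i).mem_wtSpace hv
  have hone := card_descendant_basis_eq_one hv hv0 hδ
  obtain ⟨κ, hκ⟩ := hv.casimir_eq_smul hv0 hspan ((finrank_wtSpace hb lam).trans hone)
  refine ⟨ι, inferInstance, fun i => lam - δ i, finrank_wtSpace hb,
    alt_rho_mul_fchar hb hκ (fun ν hν => ?_) hone hanti h0⟩
  rw [coeff_fchar, Nat.cast_ne_zero, ← Nat.pos_iff_ne_zero, Fintype.card_pos_iff] at hν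
  obtain ⟨i, rfl⟩ := hν
  rw [sub_sub_cancel]
  exact (hδ i).mem_cone

end WeylCharacter

section Coefficients

variable {n : ℕ}

theorem mapRingHom_alt {R S : Type*} [CommRing R] [CommRing S] (f : R →+* S) (l : Fin n → ℤ) :
    AddMonoidAlgebra.mapRingHom (Fin n → ℤ) f (alt (xU R) l) = alt (xU S) l := by
  rw [map_alt]
  congr 1
  ext1 i
  apply Units.ext
  change AddMonoidAlgebra.mapRingHom (Fin n → ℤ) f (xU R i : Laurent R n) = _
  rw [val_xU, val_xU, AddMonoidAlgebra.mapRingHom_single, map_one]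

theorem mapRingHom_alt_mul_sum_single {R S : Type*} [CommRing R] [CommRing S] (f : R →+* S)
    (l : Fin n → ℤ) {ι : Type*} [Fintype ι] (w : ι → Fin n → ℤ) :
    AddMonoidAlgebra.mapRingHom (Fin n → ℤ) f
        (alt (xU R) l * ∑ i, AddMonoidAlgebra.single (w i) 1) =
      alt (xU S) l * ∑ i, AddMonoidAlgebra.single (w i) 1 := by
  simp only [map_mul, mapRingHom_alt, map_sum, AddMonoidAlgebra.mapRingHom_single, map_one]

/-- An identity between alternants and formal characters with complex coefficients holds over `ℤ`,
hence over any ring. -/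
theorem alt_rho_mul_sum_single (S : Type*) [CommRing S] {ι : Type*} [Fintype ι]
    {w : ι → Fin n → ℤ} {l : Fin n → ℤ} (h : alt (xU ℂ) (rho n) * fchar w = alt (xU ℂ) l) :
    alt (xU S) (rho n) * ∑ i, AddMonoidAlgebra.single (w i) 1 = alt (xU S) l := by
  have hinj : Function.Injective
      (AddMonoidAlgebra.mapRingHom (Fin n → ℤ) (Int.castRingHom ℂ)) := fun f g hfg =>
    AddMonoidAlgebra.ext (Finsupp.ext fun ν => (Int.castRingHom ℂ).injective_int (by
      simpa only [AddMonoidAlgebra.coeff_mapRingHom] using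
        congrArg (fun p : Laurent ℂ n => p.coeff ν) hfg))
  have hZ : alt (xU ℤ) (rho n) * ∑ i, AddMonoidAlgebra.single (w i) 1 = alt (xU ℤ) l := by
    apply hinj
    rw [mapRingHom_alt_mul_sum_single, mapRingHom_alt]
    exact h
  rw [← mapRingHom_alt_mul_sum_single (Int.castRingHom S), hZ, mapRingHom_alt]

variable (K : Type*) [Field K]

theorem chi_eq_algebraMap {lam : Fin n → ℤ} {ι : Type*} [Fintype ι] {w : ι → Fin n → ℤ}
    (hw : ∀ μ, Module.finrank ℂ (weightSpace lam μ) = Fintype.card {i // w i = μ}) :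
    chi K lam =
      algebraMap (Laurent K n) (CharField K n) (∑ i, AddMonoidAlgebra.single (w i) 1) := by
  classical
  have support_subset : (Function.support fun μ : Fin n → ℤ =>
      (Module.finrank ℂ (weightSpace lam μ) : CharField K n) * fexp K μ) ⊆
        Finset.univ.image w := fun μ hμ => by
    have hne : Module.finrank ℂ (weightSpace lam μ) ≠ 0 := fun h => hμ (by simp [h])
    rw [hw, ← Nat.pos_iff_ne_zero, Fintype.card_pos_iff] at hne
    obtain ⟨i, rfl⟩ := hne
    simp
  rw [chi, finsum_eq_sum_of_support_subset _ support_subset, map_sum,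
    ← Finset.sum_fiberwise_of_maps_to fun i _ => Finset.mem_image_of_mem w (Finset.mem_univ i)]
  refine Finset.sum_congr rfl fun μ _ => ?_
  rw [hw, Fintype.card_subtype, ← nsmul_eq_mul, ← Finset.sum_const]
  exact Finset.sum_congr rfl fun i hi => by rw [(Finset.mem_filter.1 hi).2]; rfl

theorem alt_rho_mul_chi {lam : Fin n → ℤ} (hanti : Antitone lam) (h0 : ∀ i, 0 ≤ lam i) :
    algebraMap (Laurent K n) (CharField K n) (alt (xU K) (rho n)) * chi K lam =
      algebraMap (Laurent K n) (CharField K n) (alt (xU K) (lam + rho n)) := by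
  obtain ⟨hgen, _⟩ := vermaGen_ne_zero_and_finiteDimensional_simple hanti h0
  have hv := isHighest_simpleGen lam
  obtain ⟨ι, _, w, hrank, hweyl⟩ := hv.exists_character (simpleGen_ne_zero hgen)
    (hv.descSpan_eq_top (span_simpleGen lam)) hanti h0
  have weightSpace_eq (μ : Fin n → ℤ) :
      weightSpace lam μ = wtSpace (envRep n (Simple lam)) μ :=
    Submodule.ext fun _ => (mem_wtSpace (ρ := envRep n (Simple lam))).symm
  rw [chi_eq_algebraMap K fun μ => by rw [weightSpace_eq, hrank], ← map_mul,
    alt_rho_mul_sum_single K hweyl]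

end Coefficients

/-! ### The character of `G` -/

section Hooks

variable {n k r : ℕ}

theorem hook_add_rho : hook (n + 1) k r + rho (n + 1) =
    Fin.cons ((k : ℤ) - r + (n + 1)) (rhoOmit n (rbar (n + 1) r)) := by
  ext i
  refine Fin.cases ?_ (fun a => ?_) i
  · simp [hook, rho]
  · simp only [hook, rho, rhoOmit, Pi.add_apply, Fin.cons_succ, Fin.val_succ]
    push_cast
    split_ifs <;> omega

theorem hook_antitone (hk : r < k) : Antitone (hook n k r) := by
  intro i j hij
  have : (i : ℕ) ≤ j := hij
  simp only [hook]
  split_ifs <;> omega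

theorem hook_nonneg (hk : r < k) (i : Fin n) : 0 ≤ hook n k r i := by
  simp only [hook]
  split_ifs <;> omega

end Hooks

section ChG

variable {K : Type*} [Field K]

/-- The unit `e^{ε_i}` of the fraction field. -/
def fexpU (K : Type*) [Field K] {n : ℕ} (i : Fin n) : (CharField K n)ˣ :=
  Units.map (algebraMap (Laurent K n) (CharField K n) : Laurent K n →* CharField K n) (xU K i)

theorem val_fexpU_zpow {n : ℕ} (i : Fin n) (m : ℤ) :
    ((fexpU K i ^ m : (CharField K n)ˣ) : CharField K n) = fexp K (m • eps i) := by
  rw [fexpU, ← map_zpow, Units.coe_map, fexp, ← val_xU_zpow]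
  rfl

theorem algebraMap_alt {n : ℕ} (l : Fin n → ℤ) :
    algebraMap (Laurent K n) (CharField K n) (alt (xU K) l) = alt (fexpU K) l :=
  map_alt _ _ _

theorem alt_fexpU_rho_ne_zero (n : ℕ) : alt (fexpU K) (rho n) ≠ 0 := by
  rw [← algebraMap_alt, Ne,
    map_eq_zero_iff _ (IsFractionRing.injective (Laurent K n) (CharField K n))]
  intro h
  simpa [h] using coeff_alt_dominant K (rho_strictAnti n) rho_pos (rho_strictAnti n) rho_pos

theorem zsmul_eps_injective (n : ℕ) :
    Function.Injective fun a : Idx n => (a.2 : ℤ) • (eps a.1 : Fin n → ℤ) := by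
  rintro ⟨i, s⟩ ⟨j, t⟩ h
  have hi := congrFun h i
  have hj := congrFun h j
  simp only [eps, Pi.smul_apply, Pi.single_apply, smul_eq_mul, if_true] at hi hj
  have hs := Int.isUnit_iff.1 s.isUnit
  obtain rfl : i = j := by
    by_contra hij
    rw [if_neg hij] at hi
    omega
  exact Prod.ext rfl (Units.ext (by simpa using hi))

theorem fexpU_zpow_injective (n : ℕ) :
    Function.Injective fun a : Idx n => fexpU K a.1 ^ (a.2 : ℤ) := fun a b h =>
  zsmul_eps_injective n (fexp_injective (by
    simpa only [val_fexpU_zpow] using congrArg Units.val h))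

theorem alt_rho_mul_ChG {q : K} (hq : q ≠ 0) (n k : ℕ) :
    alt (fexpU K) (rho (n + 1)) * (ChG (n + 1) q k - (const (n + 1) q ^ k)⁻¹) =
      ∑ r ∈ Finset.range (2 * (n + 1)), (-1) ^ r *
        const (n + 1) q ^ (2 * ((n + 1 : ℕ) : ℤ) - 2 * r - 1) *
          alt (fexpU K) (Fin.cons ((k : ℤ) - r + (n + 1)) (rhoOmit n (rbar (n + 1) r))) := by
  have hconst : const (n + 1) q ≠ 0 :=
    (map_ne_zero_iff _ (algebraMap K (CharField K (n + 1))).injective).2 hq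
  simpa only [ChG, Units.val_mk0, val_fexpU_zpow] using
    alt_rho_mul_G (Units.mk0 _ hconst) (fexpU K) (fexpU_zpow_injective (n + 1)) k

theorem alt_rho_mul_chi_hook {n k r : ℕ} (hk : r < k) :
    alt (fexpU K) (rho (n + 1)) * chi K (hook (n + 1) k r) =
      alt (fexpU K) (Fin.cons ((k : ℤ) - r + (n + 1)) (rhoOmit n (rbar (n + 1) r))) := by
  rw [← hook_add_rho, ← algebraMap_alt, ← algebraMap_alt]
  exact alt_rho_mul_chi K (hook_antitone hk) (hook_nonneg hk)

theorem ChG_eq_sum {q : K} (hq : q ≠ 0) (n k : ℕ) :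
    ChG (n + 1) q k = (const (n + 1) q ^ k)⁻¹ + ∑ r ∈ Finset.range (2 * (n + 1)),
      (-1) ^ r * const (n + 1) q ^ (2 * ((n + 1 : ℕ) : ℤ) - 2 * r - 1) *
        if r < k then chi K (hook (n + 1) k r) else
          if k = 0 then (-1) ^ r else if k + 2 * n + 1 = 2 * r then -(-1) ^ r else 0 := by
  rw [← sub_eq_iff_eq_add']
  refine mul_left_cancel₀ (alt_fexpU_rho_ne_zero (n + 1)) ((alt_rho_mul_ChG hq n k).trans ?_)
  rw [Finset.mul_sum]
  refine Finset.sum_congr rfl fun r hr => ?_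
  rw [mul_left_comm]
  congr 1
  split_ifs with hk
  · exact (alt_rho_mul_chi_hook hk).symm
  all_goals
    rw [alt_cons_rhoOmit_of_le _ (Finset.mem_range.1 hr) (not_lt.1 hk), mul_comm]
    simp only [*, if_true, if_false]

theorem sum_Ico_straightened {F : Type*} [Field F] (q : F) (n k : ℕ) :
    ∑ r ∈ Finset.Ico k (2 * (n + 1)),
      (-1) ^ r * q ^ (2 * ((n + 1 : ℕ) : ℤ) - 2 * r - 1) *
        (if k = 0 then (-1) ^ r else if k + 2 * n + 1 = 2 * r then -(-1) ^ r else 0) =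
      if k = 0 then ∑ r ∈ Finset.range (2 * (n + 1)), q ^ (2 * ((n + 1 : ℕ) : ℤ) - 2 * r - 1)
      else if Odd k ∧ k ≤ 2 * (n + 1) - 1 then -q ^ (-(k : ℤ)) else 0 := by
  have sign_cancel (r : ℕ) (z : F) : (-1) ^ r * z * (-1) ^ r = z := by
    rw [mul_right_comm, ← mul_pow, neg_one_mul, neg_neg, one_pow, one_mul]
  split_ifs with h0 hodd
  · simp only [h0, sign_cancel, Finset.range_eq_Ico]
  · obtain ⟨⟨m, rfl⟩, hk⟩ := hodd
    rw [Finset.sum_eq_single_of_mem (m + n + 1) (Finset.mem_Ico.2 ⟨by omega, by omega⟩)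
      fun r _ hne => by rw [if_neg (by omega), mul_zero], if_pos (by omega), mul_neg, sign_cancel]
    congr 2
    push_cast
    ring
  · refine Finset.sum_eq_zero fun r hr => ?_
    have hr := Finset.mem_Ico.1 hr
    rw [if_neg fun h => hodd ⟨⟨r - n - 1, by omega⟩, by omega⟩, mul_zero]

theorem ChG_eq_sum_chi_add {q : K} (hq : q ≠ 0) {n : ℕ} (hn : n ≠ 0) (k : ℕ) :
    ChG n q k = const n q ^ (-(k : ℤ)) +
      (∑ r ∈ Finset.range (min k (2 * n)),
        (-1) ^ r * const n q ^ (2 * (n : ℤ) - 2 * r - 1) * chi K (hook n k r) +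
      if k = 0 then ∑ r ∈ Finset.range (2 * n), const n q ^ (2 * (n : ℤ) - 2 * r - 1)
      else if Odd k ∧ k ≤ 2 * n - 1 then -const n q ^ (-(k : ℤ)) else 0) := by
  obtain ⟨n, rfl⟩ := Nat.exists_eq_succ_of_ne_zero hn
  have hIco : Finset.Ico (min k (2 * (n + 1))) (2 * (n + 1)) = Finset.Ico k (2 * (n + 1)) := by
    ext r
    simp only [Finset.mem_Ico]
    omega
  rw [ChG_eq_sum hq, zpow_neg, zpow_natCast, ← Finset.sum_range_add_sum_Ico _ (min_le_right k _),
    hIco, ← zpow_natCast, ← zpow_neg, ← sum_Ico_straightened]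
  congr 2
  · exact Finset.sum_congr rfl fun r hr => by
      rw [if_pos ((Finset.mem_range.1 hr).trans_le (min_le_left _ _))]
  · exact Finset.sum_congr rfl fun r hr => by rw [if_neg (Finset.mem_Ico.1 hr).1.not_gt]

end ChG

end TypeB

end

theorem theorem3p5_general {K : Type*} [Field K] (q : K) (hq : q ≠ 0)
    (n : ℕ) (hn : n ≠ 0) (k : ℕ) :
    TypeB.ChG n q k =
      if k = 0 then
        1 + ∑ r ∈ Finset.range (2 * n),
          TypeB.const n q ^ (2 * (n : ℤ) - 2 * (r : ℤ) - 1)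
      else if Odd k ∧ k ≤ 2 * n - 1 then
        ∑ r ∈ Finset.range k,
          (-1) ^ r * TypeB.const n q ^ (2 * (n : ℤ) - 2 * (r : ℤ) - 1) *
            TypeB.chi K (TypeB.hook n k r)
      else
        TypeB.const n q ^ (-(k : ℤ)) +
          ∑ r ∈ Finset.range (min (k - 1) (2 * n - 1) + 1),
            (-1) ^ r * TypeB.const n q ^ (2 * (n : ℤ) - 2 * (r : ℤ) - 1) *
              TypeB.chi K (TypeB.hook n k r) := by
  rw [TypeB.ChG_eq_sum_chi_add hq hn]
  split_ifs with h0 hodd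
  · simp [h0]
  · rw [min_eq_left (by omega), add_comm, neg_add_cancel_right]
  · rw [show min k (2 * n) = min (k - 1) (2 * n - 1) + 1 by omega, add_zero]

theorem theorem3p5 {K : Type*} [Field K] [CharZero K] (q : K) (hq : q ≠ 0)
    (n : ℕ) (hn : 2 ≤ n) (k : ℕ) :
    TypeB.ChG n q k =
      if k = 0 then
        1 + ∑ r ∈ Finset.range (2 * n),
          TypeB.const n q ^ (2 * (n : ℤ) - 2 * (r : ℤ) - 1)
      else if Odd k ∧ k ≤ 2 * n - 1 then
        ∑ r ∈ Finset.range k,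
          (-1) ^ r * TypeB.const n q ^ (2 * (n : ℤ) - 2 * (r : ℤ) - 1) *
            TypeB.chi K (TypeB.hook n k r)
      else
        TypeB.const n q ^ (-(k : ℤ)) +
          ∑ r ∈ Finset.range (min (k - 1) (2 * n - 1) + 1),
            (-1) ^ r * TypeB.const n q ^ (2 * (n : ℤ) - 2 * (r : ℤ) - 1) *
              TypeB.chi K (TypeB.hook n k r) :=
  theorem3p5_general q hq n (by omega) k
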